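/- Let $d\ge 2$, $m>0$, and $p\cdot x=p_0x_0-\sum_{k=1}^{d-1}p_kx_k$. Let $\mathscr H_1=L^2(\mathbb R^{d-1},d\mu)$ with $d\mu(\mathbf p)=d\mathbf p/(2\omega_{\mathbf p})$, $\omega_{\mathbf p}=\sqrt{\mathbf p^2+m^2}$; let $\mathscr H$ be the bosonic Fock space over $\mathscr H_1$, $\mathcal D\subset\mathscr H$ the vectors of finite particle number, $P$ the energy-momentum operator on $\mathscr H$, and $\Gamma(U)=\bigoplus_k U^{\otimes k}$ for unitary $U$ on $\mathscr H_1$. For $f\in\mathscr S(\mathbb R^d)$ put $f^\pm(\mathbf p)=\int f(x)e^{\pm ip\cdot x}dx$ with $p=(\omega_{\mathbf p},\mathbf p)$, and let $\phi(f)=a(\overline{f^-})+a^*(f^+)$ be the free scalar field of mass $m$ on $\mathcal D$. Let $V$ be a unitary operator on $\mathscr H_1$, $X=\Gamma(V^{-1})P\,\Gamma(V)$, $V(y)=e^{iy\cdot X}=\Gamma(V^{-1})e^{iy\cdot P}\Gamma(V)$. For a real matrix $M$, $f\in\mathscr S(\mathbb R^d)$ and $\Psi\in\mathcal D$ put $$\phi_{M,X}(f)\Psi=\lim_{\varepsilon\downarrow0}(2\pi)^{-d}\iint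 dx\,dy\,e^{-ix\cdot y}\chi(\varepsilon x,\varepsilon y)\,V(Mx)\phi(f)V(-Mx)V(y)\Psi ,$$ where $\chi\in\mathscr S(\mathbb R^d\times\mathbb R^d)$, $\chi(0,0)=1$. Let $W_1=\{x: x_1>|x_0|\}$ and let $\mathcal W_0$ be the set of images $\Lambda W_1$ of $W_1$ under Lorentz transformations $\Lambda$ with $\det\Lambda=1$ (it contains $-W_1$). Let $\theta$ be an admissible matrix: $\theta_{01}=\theta_{10}=\lambda\ge0$, if $d=4$ also $\theta_{23}=-\theta_{32}=\eta\in\mathbb R$, and all other entries are $0$. Put $Q(\Lambda W_1)=\Lambda\theta\Lambda^{-1}$ if $\Lambda$ is orthochronous and $Q(\Lambda W_1)=-\Lambda\theta\Lambda^{-1}$ otherwise. Suppose that $V$ maps test functions supported in $W_1$ to test functions supported in $W_1$, and likewise for $-W_1$. That is, for $O=W_1$ and for $O=-W_1$: for every $f\in C_0^\infty(\mathbb R^d)$ with $\operatorname{supp}f\subset O$ there is $h\in\mathscr S(\mathbb R^d)$ (written $h=Vf$) with $\operatorname{supp}h\subset O$, $h^+=Vf^+$ and $\overline{h^-}=V\overline{f^-}$.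 Then the fields $\phi_W(f):=\phi_{Q(W),X}(f)$, $W\in\mathcal W_0$, are well defined and wedge-local on $\mathscr H$, in the following sense. 1. $Q(W)$ depends only on $W$; for all $W\in\mathcal W_0$, $f\in\mathscr S(\mathbb R^d)$ and $\Psi\in\mathcal D$ the integrals above converge absolutely, their limit exists in norm and does not depend on $\chi$, and $\phi_W(f)$ is a linear operator mapping $\mathcal D$ into $\mathcal D$. 2. For $W\in\mathcal W_0$, $\Psi,\Phi\in\mathcal D$, the map $f\mapsto\phi_W(f)\Psi$ is linear and continuous from $\mathscr S(\mathbb R^d)$ to $\mathscr H$, and $\langle\phi_W(f)\Psi,\Phi\rangle=\langle\Psi,\phi_W(\overline f)\Phi\rangle$. 3. $[\phi_{W_1}(f),\phi_{-W_1}(g)]\Psi=0$ for all $\Psi\in\mathcal D$ and all $f,g\in C_0^\infty(\mathbb R^d)$ with $\operatorname{supp}f\subset W_1$, $\operatorname{supp}g\subset -W_1$. -/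

import Mathlib

open MeasureTheory Filter Topology
open scoped ENNReal ComplexConjugate SchwartzMap

namespace WarpedField
noncomputable section

/-! ### Tensor powers of `L²` -/

/-- The `k`-fold Hilbert space tensor power of `L²(μ)`, realised as `L²(μᵏ)`. -/
abbrev TensorL2 {α : Type*} [MeasurableSpace α] (μ : Measure α) (k : ℕ) : Type _ :=
  Lp ℂ 2 (Measure.pi fun _ : Fin k => μ)

theorem memLp_tensor {α : Type*} [MeasurableSpace α] (μ : Measure α) [SigmaFinite μ] (k : ℕ)
    (f : Fin k → Lp ℂ 2 μ) :
    MemLp (fun p : Fin k → α => ∏ i, f i (p i)) 2 (Measure.pi fun _ : Fin k => μ) := by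
  have hm : ∀ i : Fin k, AEStronglyMeasurable (fun p : Fin k → α => f i (p i))
      (Measure.pi fun _ : Fin k => μ) := fun i =>
    (Lp.aestronglyMeasurable (f i)).comp_quasiMeasurePreserving
      (Measure.quasiMeasurePreserving_eval (fun _ : Fin k => μ) i)
  have hm' : AEStronglyMeasurable (fun p : Fin k → α => ∏ i, f i (p i))
      (Measure.pi fun _ : Fin k => μ) :=
    Finset.aestronglyMeasurable_fun_prod _ fun i _ => hm i
  rw [memLp_two_iff_integrable_sq_norm hm']
  simp_rw [norm_prod, ← Finset.prod_pow]
  exact Integrable.fintype_prod (f := fun i x => ‖f i x‖ ^ 2) fun i =>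
    (memLp_two_iff_integrable_sq_norm (Lp.aestronglyMeasurable (f i))).1 (Lp.memLp (f i))

/-- The elementary tensor `f₁ ⊗ ⋯ ⊗ f_k`. -/
def tensor {α : Type*} [MeasurableSpace α] (μ : Measure α) [SigmaFinite μ] {k : ℕ}
    (f : Fin k → Lp ℂ 2 μ) : TensorL2 μ k :=
  (memLp_tensor μ k f).toLp _

theorem inner_tensor {α : Type*} [MeasurableSpace α] (μ : Measure α) [SigmaFinite μ] {k : ℕ}
    (f g : Fin k → Lp ℂ 2 μ) :
    inner ℂ (tensor μ f) (tensor μ g) = ∏ i, inner ℂ (f i) (g i) := by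
  simp_rw [L2.inner_def]
  rw [← integral_fintype_prod_eq_prod (𝕜 := ℂ) (fun i x => inner ℂ (f i x) (g i x))]
  apply integral_congr_ae
  filter_upwards [(memLp_tensor μ k f).coeFn_toLp, (memLp_tensor μ k g).coeFn_toLp] with p h1 h2
  rw [tensor, tensor, h1, h2]
  simp [Finset.prod_mul_distrib]

theorem eq_zero_of_inner_tensor {α : Type*} [MeasurableSpace α] (μ : Measure α) [SigmaFinite μ]
    {k : ℕ} (F : TensorL2 μ k) (hF : ∀ f, inner ℂ (tensor μ f) F = 0) : F = 0 := by
  set ν := Measure.pi fun _ : Fin k => μ with hν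
  -- integrals over boxes vanish
  have hbox : ∀ s : Fin k → Set α, (∀ i, MeasurableSet (s i)) → (∀ i, μ (s i) ≠ ∞) →
      ∫ p in Set.univ.pi s, F p ∂ν = 0 := by
    intro s hs hfin
    have h := hF fun i => indicatorConstLp 2 (hs i) (hfin i) (1 : ℂ)
    have hae : (fun p : Fin k → α => ∏ i, indicatorConstLp 2 (hs i) (hfin i) (1 : ℂ) (p i))
        =ᵐ[ν] (Set.univ.pi s).indicator fun _ => (1 : ℂ) := by
      have h1 : ∀ i : Fin k, ∀ᵐ p ∂ν, indicatorConstLp 2 (hs i) (hfin i) (1 : ℂ) (p i)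
          = (s i).indicator (fun _ => (1 : ℂ)) (p i) := fun i =>
        (Measure.quasiMeasurePreserving_eval (fun _ : Fin k => μ) i).ae
          (indicatorConstLp_coeFn (hs := hs i) (hμs := hfin i) (c := (1 : ℂ)))
      filter_upwards [ae_all_iff.2 h1] with p hp
      simp_rw [hp]
      by_cases hmem : p ∈ Set.univ.pi s
      · rw [Set.indicator_of_mem hmem]
        exact Finset.prod_eq_one fun i _ => Set.indicator_of_mem (hmem i trivial) _
      · rw [Set.indicator_of_notMem hmem]
        simp only [Set.mem_pi, Set.mem_univ, true_implies, not_forall] at hmem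
        obtain ⟨i, hi⟩ := hmem
        exact Finset.prod_eq_zero (Finset.mem_univ i) (Set.indicator_of_notMem hi _)
    rw [L2.inner_def] at h
    rw [← integral_indicator (MeasurableSet.univ_pi hs), ← h]
    apply integral_congr_ae
    filter_upwards [hae, (memLp_tensor μ k fun i =>
      indicatorConstLp 2 (hs i) (hfin i) (1 : ℂ)).coeFn_toLp] with p h1 h2
    rw [tensor, h2, h1]
    by_cases hmem : p ∈ Set.univ.pi s <;> simp [hmem]
  let B : ℕ → Set (Fin k → α) := fun N => Set.univ.pi fun _ => spanningSets μ N
  have hBm : ∀ N, MeasurableSet (B N) := fun N =>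
    MeasurableSet.univ_pi fun _ => measurableSet_spanningSets μ N
  have hBfin : ∀ N, ν (B N) ≠ ∞ := fun N => by
    rw [hν, Measure.pi_pi]
    exact ENNReal.prod_ne_top fun i _ => (measure_spanningSets_lt_top μ N).ne
  have hint : ∀ N, IntegrableOn F (B N) ν := fun N =>
    integrableOn_Lp_of_measure_ne_top F (by norm_num) (hBfin N)
  have hzero : ∀ N, ∀ᵐ p ∂ν, p ∈ B N → F p = 0 := by
    intro N
    rw [← ae_restrict_iff' (hBm N)]
    refine (hint N).ae_eq_zero_of_forall_setIntegral_eq_zero ?_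
    intro A hA _
    have key : ∀ A, MeasurableSet A → ∫ p in A, F p ∂(ν.restrict (B N)) = 0 := by
      have huniv : ∫ p, F p ∂(ν.restrict (B N)) = 0 :=
        hbox _ (fun _ => measurableSet_spanningSets μ N)
          (fun _ => (measure_spanningSets_lt_top μ N).ne)
      intro A hA
      induction A, hA using MeasurableSpace.induction_on_inter
        (generateFrom_pi (α := fun _ : Fin k => α)).symm isPiSystem_pi with
      | empty => simp
      | basic t ht =>
        obtain ⟨s, hs, rfl⟩ := ht
        rw [Measure.restrict_restrict (MeasurableSet.univ_pi fun i => hs i trivial),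
          ← Set.pi_inter_distrib]
        exact hbox _ (fun i => (hs i trivial).inter (measurableSet_spanningSets μ N))
          (fun i => ((measure_mono Set.inter_subset_right).trans_lt
            (measure_spanningSets_lt_top μ N)).ne)
      | compl t ht ih =>
        have := integral_add_compl ht (hint N)
        rw [ih, zero_add] at this
        rw [this, huniv]
      | iUnion f hd hm ih =>
        rw [integral_iUnion hm hd (hint N).integrableOn]
        simp [ih]
    exact key A hA
  have : (F : (Fin k → α) → ℂ) =ᵐ[ν] 0 := by
    filter_upwards [ae_all_iff.2 hzero] with p hp
    have : ∃ N, ∀ i, p i ∈ spanningSets μ N := by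
      refine ⟨Finset.univ.sup fun i => spanningSetsIndex μ (p i), fun i => ?_⟩
      exact monotone_spanningSets μ (Finset.le_sup (f := fun i => spanningSetsIndex μ (p i))
        (Finset.mem_univ i)) (mem_spanningSetsIndex μ (p i))
    obtain ⟨N, hN⟩ := this
    exact hp N fun i _ => hN i
  exact (Lp.eq_zero_iff_ae_eq_zero).2 this

theorem tensor_update_add {α : Type*} [MeasurableSpace α] (μ : Measure α) [SigmaFinite μ]
    {k : ℕ} (f : Fin k → Lp ℂ 2 μ) (j : Fin k) (g h : Lp ℂ 2 μ) :
    tensor μ (Function.update f j (g + h)) =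
      tensor μ (Function.update f j g) + tensor μ (Function.update f j h) := by
  refine sub_eq_zero.1 (eq_zero_of_inner_tensor μ _ fun e => ?_)
  simp only [inner_sub_right, inner_add_right, inner_tensor]
  rw [← Finset.mul_prod_erase _ _ (Finset.mem_univ j), ← Finset.mul_prod_erase _ _ (Finset.mem_univ j),
    ← Finset.mul_prod_erase _ _ (Finset.mem_univ j)]
  have : ∀ u : Lp ℂ 2 μ, ∏ x ∈ Finset.univ.erase j, inner ℂ (e x) (Function.update f j u x) =
      ∏ x ∈ Finset.univ.erase j, inner ℂ (e x) (f x) := fun u =>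
    Finset.prod_congr rfl fun x hx => by rw [Function.update_of_ne (Finset.ne_of_mem_erase hx)]
  simp only [this, Function.update_self, inner_add_right]
  ring

theorem tensor_update_smul {α : Type*} [MeasurableSpace α] (μ : Measure α) [SigmaFinite μ]
    {k : ℕ} (f : Fin k → Lp ℂ 2 μ) (j : Fin k) (c : ℂ) (g : Lp ℂ 2 μ) :
    tensor μ (Function.update f j (c • g)) = c • tensor μ (Function.update f j g) := by
  refine sub_eq_zero.1 (eq_zero_of_inner_tensor μ _ fun e => ?_)
  simp only [inner_sub_right, inner_smul_right, inner_tensor]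
  rw [← Finset.mul_prod_erase _ _ (Finset.mem_univ j), ← Finset.mul_prod_erase _ _ (Finset.mem_univ j)]
  have : ∀ u : Lp ℂ 2 μ, ∏ x ∈ Finset.univ.erase j, inner ℂ (e x) (Function.update f j u x) =
      ∏ x ∈ Finset.univ.erase j, inner ℂ (e x) (f x) := fun u =>
    Finset.prod_congr rfl fun x hx => by rw [Function.update_of_ne (Finset.ne_of_mem_erase hx)]
  simp only [this, Function.update_self, inner_smul_right]
  ring

theorem norm_tensor {α : Type*} [MeasurableSpace α] (μ : Measure α) [SigmaFinite μ]
    {k : ℕ} (f : Fin k → Lp ℂ 2 μ) : ‖tensor μ f‖ = ∏ i, ‖f i‖ := by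
  have h := inner_tensor μ f f
  simp only [inner_self_eq_norm_sq_to_K] at h
  have h2 : ‖tensor μ f‖ ^ 2 = (∏ i, ‖f i‖) ^ 2 := by
    rw [← Finset.prod_pow]
    exact_mod_cast h
  exact (pow_left_inj₀ (norm_nonneg _) (Finset.prod_nonneg fun _ _ => norm_nonneg _)
    two_ne_zero).1 h2

/-- Elementary tensors of a Hilbert basis form a Hilbert basis. -/
def tensorBasis {α : Type*} [MeasurableSpace α] (μ : Measure α) [SigmaFinite μ] {ι : Type*}
    (b : HilbertBasis ι ℂ (Lp ℂ 2 μ)) (k : ℕ) : HilbertBasis (Fin k → ι) ℂ (TensorL2 μ k) :=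
  HilbertBasis.mkOfOrthogonalEqBot (v := fun a : Fin k → ι => tensor μ fun i => b (a i))
    (by
      classical
      rw [orthonormal_iff_ite]
      intro a a'
      rw [inner_tensor]
      simp only [orthonormal_iff_ite.1 b.orthonormal]
      split_ifs with h
      · subst h; simp
      · obtain ⟨i, hi⟩ := Function.ne_iff.1 h
        exact Finset.prod_eq_zero (Finset.mem_univ i) (if_neg hi))
    (by
      classical
      rw [Submodule.eq_bot_iff]
      intro F hF
      rw [Submodule.mem_orthogonal] at hF
      refine eq_zero_of_inner_tensor μ F ?_
      have hcl : ∀ (f : Fin k → Lp ℂ 2 μ) (j : Fin k),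
          (∀ i, inner ℂ F (tensor μ (Function.update f j (b i))) = 0) →
          ∀ g, inner ℂ F (tensor μ (Function.update f j g)) = 0 := by
        intro f j h0
        let L : Lp ℂ 2 μ →ₗ[ℂ] ℂ :=
          { toFun := fun g => inner ℂ F (tensor μ (Function.update f j g))
            map_add' := fun g h => by rw [tensor_update_add, inner_add_right]
            map_smul' := fun c g => by
              rw [tensor_update_smul, inner_smul_right]; rfl }
        let L' : Lp ℂ 2 μ →L[ℂ] ℂ := L.mkContinuous
          (‖F‖ * ∏ i ∈ Finset.univ.erase j, ‖f i‖) (fun g => by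
            refine (norm_inner_le_norm (𝕜 := ℂ) F (tensor μ (Function.update f j g))).trans
              (le_of_eq ?_)
            rw [norm_tensor, ← Finset.mul_prod_erase _ _ (Finset.mem_univ j), Function.update_self,
              Finset.prod_congr rfl fun x hx =>
                by rw [Function.update_of_ne (Finset.ne_of_mem_erase hx)]]
            ring)
        have hL : L' = 0 := by
          refine ContinuousLinearMap.ext_on (s := Set.range b) ?_ ?_
          · exact Submodule.dense_iff_topologicalClosure_eq_top.2 b.dense_span
          · rintro _ ⟨i, rfl⟩
            exact h0 i
        intro g
        exact DFunLike.congr_fun hL g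
      have main : ∀ (S : Finset (Fin k)) (f : Fin k → Lp ℂ 2 μ),
          (∀ i ∉ S, ∃ a, f i = b a) → inner ℂ F (tensor μ f) = 0 := by
        intro S
        induction S using Finset.induction_on with
        | empty =>
          intro f hf
          choose a ha using fun i => hf i (Finset.notMem_empty i)
          have := hF _ (Submodule.subset_span ⟨a, rfl⟩)
          rw [← inner_conj_symm, funext ha, this, map_zero]
        | insert j S _ ih =>
          intro f hf
          have := hcl f j (fun a => ih _ fun i hi => ?_) (f j)
          · rwa [Function.update_eq_self] at this
          · by_cases hij : i = j
            · subst hij; exact ⟨a, by simp⟩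
            · rw [Function.update_of_ne hij]
              exact hf i (by simp [hij, hi])
      intro f
      rw [← inner_conj_symm, main Finset.univ f (by simp), map_zero])

theorem tensorBasis_apply {α : Type*} [MeasurableSpace α] (μ : Measure α) [SigmaFinite μ]
    {ι : Type*} (b : HilbertBasis ι ℂ (Lp ℂ 2 μ)) (k : ℕ) (a : Fin k → ι) :
    tensorBasis μ b k a = tensor μ fun i => b (a i) := by
  simp [tensorBasis]

theorem exists_tensorPower {α : Type*} [MeasurableSpace α] (μ : Measure α) [SigmaFinite μ]
    (V : Lp ℂ 2 μ ≃ₗᵢ[ℂ] Lp ℂ 2 μ) (k : ℕ) :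
    ∃ T : TensorL2 μ k ≃ₗᵢ[ℂ] TensorL2 μ k, ∀ f, T (tensor μ f) = tensor μ fun i => V (f i) := by
  obtain ⟨w, b, -⟩ := exists_hilbertBasis ℂ (Lp ℂ 2 μ)
  let b' : HilbertBasis w ℂ (Lp ℂ 2 μ) := HilbertBasis.ofRepr (V.symm.trans b.repr)
  have hb' : ∀ i, b' i = V (b i) := fun i => by
    classical
    rw [← HilbertBasis.repr_symm_single, ← HilbertBasis.repr_symm_single]; rfl
  refine ⟨(tensorBasis μ b k).repr.trans (tensorBasis μ b' k).repr.symm, fun f => ?_⟩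
  apply (tensorBasis μ b' k).repr.injective
  ext a
  simp only [LinearIsometryEquiv.trans_apply, LinearIsometryEquiv.apply_symm_apply,
    HilbertBasis.repr_apply_apply, tensorBasis_apply, inner_tensor, hb',
    LinearIsometryEquiv.inner_map_map]

/-- The tensor power `V^{⊗k}` of a unitary `V`: the unitary of `L²(μᵏ)` with
`f₁ ⊗ ⋯ ⊗ f_k ↦ V f₁ ⊗ ⋯ ⊗ V f_k`. -/
def tensorPower {α : Type*} [MeasurableSpace α] (μ : Measure α) [SigmaFinite μ]
    (V : Lp ℂ 2 μ ≃ₗᵢ[ℂ] Lp ℂ 2 μ) (k : ℕ) : TensorL2 μ k ≃ₗᵢ[ℂ] TensorL2 μ k :=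
  Classical.choose (exists_tensorPower μ V k)

/-! ### The bosonic Fock space -/

theorem measurePreserving_permute {α : Type*} [MeasurableSpace α] (μ : Measure α) [SigmaFinite μ]
    {k : ℕ} (σ : Equiv.Perm (Fin k)) :
    MeasurePreserving (fun p : Fin k → α => p ∘ σ)
      (Measure.pi fun _ : Fin k => μ) (Measure.pi fun _ : Fin k => μ) := by
  have h := measurePreserving_piCongrLeft (α := fun _ : Fin k => α) (fun _ : Fin k => μ) σ.symm
  convert h using 1
  ext p i
  have := Equiv.piCongrLeft_apply_apply (P := fun _ : Fin k => α) σ.symm p (σ i)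
  simpa [MeasurableEquiv.coe_piCongrLeft] using this.symm

/-- The action `(σ F)(p₁, …, p_k) = F(p_{σ 1}, …, p_{σ k})` of a permutation. -/
def permute {α : Type*} [MeasurableSpace α] (μ : Measure α) [SigmaFinite μ]
    {k : ℕ} (σ : Equiv.Perm (Fin k)) : TensorL2 μ k →ₗᵢ[ℂ] TensorL2 μ k :=
  Lp.compMeasurePreservingₗᵢ ℂ (fun p : Fin k → α => p ∘ σ) (measurePreserving_permute μ σ)

/-- The `k`-boson space: the totally symmetric elements of `L²(μᵏ)`. -/
def bosons {α : Type*} [MeasurableSpace α] (μ : Measure α) [SigmaFinite μ] (k : ℕ) :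
    Submodule ℂ (TensorL2 μ k) where
  carrier := {F | ∀ σ : Equiv.Perm (Fin k), permute μ σ F = F}
  zero_mem' := fun σ => map_zero _
  add_mem' := fun hF hG σ => by rw [map_add, hF σ, hG σ]
  smul_mem' := fun c F hF σ => by rw [map_smul, hF σ]

theorem isClosed_bosons {α : Type*} [MeasurableSpace α] (μ : Measure α) [SigmaFinite μ] (k : ℕ) :
    IsClosed (bosons μ k : Set (TensorL2 μ k)) := by
  have : (bosons μ k : Set (TensorL2 μ k)) =
      ⋂ σ : Equiv.Perm (Fin k), {F | permute μ σ F = F} := by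
    ext F; simp [bosons]
  rw [this]
  exact isClosed_iInter fun σ => isClosed_eq (permute μ σ).continuous continuous_id

instance completeSpace_bosons {α : Type*} [MeasurableSpace α] (μ : Measure α) [SigmaFinite μ]
    (k : ℕ) : CompleteSpace (bosons μ k) :=
  (isClosed_bosons μ k).completeSpace_coe

/-- The bosonic Fock space over `L²(μ)`, the Hilbert sum of the `k`-boson spaces. -/
abbrev Fock {α : Type*} [MeasurableSpace α] (μ : Measure α) [SigmaFinite μ] : Type _ :=
  lp (fun k : ℕ => bosons μ k) 2

/-- The vectors of finite particle number. -/
def finiteParticle {α : Type*} [MeasurableSpace α] (μ : Measure α) [SigmaFinite μ] :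
    Submodule ℂ (Fock μ) where
  carrier := {Ψ | ∃ N : ℕ, ∀ k, N ≤ k → Ψ k = 0}
  zero_mem' := ⟨0, fun k _ => rfl⟩
  add_mem' := by
    rintro Ψ Φ ⟨M, hM⟩ ⟨N, hN⟩
    refine ⟨max M N, fun k hk => ?_⟩
    rw [lp.coeFn_add, Pi.add_apply, hM k ((le_max_left _ _).trans hk),
      hN k ((le_max_right _ _).trans hk), add_zero]
  smul_mem' := by
    rintro c Ψ ⟨N, hN⟩
    refine ⟨N, fun k hk => ?_⟩
    rw [lp.coeFn_smul, Pi.smul_apply, hN k hk, smul_zero]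

theorem memlp_of_finite {α : Type*} [MeasurableSpace α] (μ : Measure α) [SigmaFinite μ]
    (F : ∀ k, bosons μ k) (hF : ∃ N : ℕ, ∀ k, N ≤ k → F k = 0) : Memℓp F 2 := by
  obtain ⟨N, hN⟩ := hF
  refine memℓp_gen (summable_of_ne_finset_zero (s := Finset.range N) fun k hk => ?_)
  rw [hN k (by simpa using hk)]
  simp

/-- The finite particle vector with given components. -/
def ofComponents {α : Type*} [MeasurableSpace α] (μ : Measure α) [SigmaFinite μ]
    (F : ∀ k, bosons μ k) (hF : ∃ N : ℕ, ∀ k, N ≤ k → F k = 0) : finiteParticle μ :=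
  ⟨⟨F, memlp_of_finite μ F hF⟩, hF⟩

theorem memlp_diagonal {α : Type*} [MeasurableSpace α] {μ : Measure α} [SigmaFinite μ]
    (T : ∀ k, bosons μ k →ₗᵢ[ℂ] bosons μ k) (Ψ : Fock μ) : Memℓp (fun k => T k (Ψ k)) 2 := by
  have h : (0 : ℝ) < (2 : ℝ≥0∞).toReal := by norm_num
  have := (memℓp_gen_iff h).1 (lp.memℓp Ψ)
  exact (memℓp_gen_iff h).2 (by simpa using this)

/-- The particle number preserving isometry of Fock space with given `k`-boson components. -/
def diagonal {α : Type*} [MeasurableSpace α] {μ : Measure α} [SigmaFinite μ]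
    (T : ∀ k, bosons μ k →ₗᵢ[ℂ] bosons μ k) : Fock μ →ₗᵢ[ℂ] Fock μ where
  toFun Ψ := ⟨fun k => T k (Ψ k), memlp_diagonal T Ψ⟩
  map_add' Ψ Φ := by ext1; funext k; exact map_add (T k) _ _
  map_smul' c Ψ := by ext1; funext k; exact map_smul (T k) _ _
  norm_map' Ψ := by
    have h : (0 : ℝ) < (2 : ℝ≥0∞).toReal := by norm_num
    rw [lp.norm_eq_tsum_rpow h, lp.norm_eq_tsum_rpow h]
    simp

theorem diagonal_mem {α : Type*} [MeasurableSpace α] {μ : Measure α} [SigmaFinite μ]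
    (T : ∀ k, bosons μ k →ₗᵢ[ℂ] bosons μ k) (Ψ : Fock μ) (hΨ : Ψ ∈ finiteParticle μ) :
    (diagonal T).toLinearMap Ψ ∈ finiteParticle μ := by
  obtain ⟨N, hN⟩ := hΨ
  refine ⟨N, fun k hk => ?_⟩
  change T k (Ψ k) = 0
  rw [hN k hk, map_zero]

/-- The restriction to the `k`-boson space of an isometry of `L²(μᵏ)` that preserves it. -/
def restrictBosons {α : Type*} [MeasurableSpace α] {μ : Measure α} [SigmaFinite μ] {k : ℕ}
    (T : TensorL2 μ k →ₗᵢ[ℂ] TensorL2 μ k) (hT : ∀ F ∈ bosons μ k, T F ∈ bosons μ k) :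
    bosons μ k →ₗᵢ[ℂ] bosons μ k where
  toLinearMap := T.toLinearMap.restrict hT
  norm_map' F := T.norm_map F

theorem permute_tensor {α : Type*} [MeasurableSpace α] (μ : Measure α) [SigmaFinite μ]
    {k : ℕ} (σ : Equiv.Perm (Fin k)) (f : Fin k → Lp ℂ 2 μ) :
    permute μ σ (tensor μ f) = tensor μ fun i => f (σ.symm i) := by
  apply Lp.ext
  have h1 := Lp.coeFn_compMeasurePreserving (tensor μ f) (measurePreserving_permute μ σ)
  have h2 := (measurePreserving_permute μ σ).quasiMeasurePreserving.ae
    (memLp_tensor μ k f).coeFn_toLp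
  have h3 := (memLp_tensor μ k fun i => f (σ.symm i)).coeFn_toLp
  filter_upwards [h1, h2, h3] with p h1 h2 h3
  refine h1.trans (h2.trans (Eq.trans ?_ h3.symm))
  simp only [Function.comp_apply]
  rw [← Equiv.prod_comp σ fun i => f (σ.symm i) (p i)]
  simp

theorem tensorPower_tensor {α : Type*} [MeasurableSpace α] (μ : Measure α) [SigmaFinite μ]
    (V : Lp ℂ 2 μ ≃ₗᵢ[ℂ] Lp ℂ 2 μ) {k : ℕ} (f : Fin k → Lp ℂ 2 μ) :
    tensorPower μ V k (tensor μ f) = tensor μ fun i => V (f i) :=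
  Classical.choose_spec (exists_tensorPower μ V k) f

theorem tensorPower_mem_bosons {α : Type*} [MeasurableSpace α] (μ : Measure α) [SigmaFinite μ]
    (V : Lp ℂ 2 μ ≃ₗᵢ[ℂ] Lp ℂ 2 μ) (k : ℕ) (F : TensorL2 μ k) (hF : F ∈ bosons μ k) :
    tensorPower μ V k F ∈ bosons μ k := by
  intro σ
  have hcomm : (permute μ σ).toContinuousLinearMap ∘L
      ((tensorPower μ V k).toContinuousLinearEquiv : TensorL2 μ k →L[ℂ] TensorL2 μ k) =
      ((tensorPower μ V k).toContinuousLinearEquiv : TensorL2 μ k →L[ℂ] TensorL2 μ k) ∘L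
        (permute μ σ).toContinuousLinearMap := by
    obtain ⟨w, b, -⟩ := exists_hilbertBasis ℂ (Lp ℂ 2 μ)
    refine ContinuousLinearMap.ext_on (s := Set.range (tensorBasis μ b k))
      (Submodule.dense_iff_topologicalClosure_eq_top.2 (tensorBasis μ b k).dense_span) ?_
    rintro _ ⟨a, rfl⟩
    simp [tensorBasis_apply, tensorPower_tensor, permute_tensor]
  have := DFunLike.congr_fun hcomm F
  simp only [ContinuousLinearMap.comp_apply] at this
  refine this.trans ?_
  change tensorPower μ V k (permute μ σ F) = _
  rw [hF σ]

/-- The second quantization `Γ(V) = ⨁ₖ V^{⊗k}` of a unitary `V` on Fock space. -/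
def secondQuant {α : Type*} [MeasurableSpace α] {μ : Measure α} [SigmaFinite μ]
    (V : Lp ℂ 2 μ ≃ₗᵢ[ℂ] Lp ℂ 2 μ) : Fock μ →ₗᵢ[ℂ] Fock μ :=
  diagonal fun k =>
    restrictBosons (tensorPower μ V k).toLinearIsometry (tensorPower_mem_bosons μ V k)

theorem memLp_phase {α : Type*} [MeasurableSpace α] (μ : Measure α) (φ : α → ℝ)
    (hφ : Measurable φ) (F : Lp ℂ 2 μ) :
    MemLp (fun p => Complex.exp (φ p * Complex.I) * F p) 2 μ := by
  refine (Lp.memLp F).congr_norm ?_ ?_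
  · exact AEStronglyMeasurable.mul (by fun_prop) (Lp.aestronglyMeasurable F)
  · exact Eventually.of_forall fun p => by simp [Complex.norm_exp_ofReal_mul_I]

/-- Multiplication by the phase `e^{iφ}` on `L²`. -/
def phaseMul {α : Type*} [MeasurableSpace α] (μ : Measure α) (φ : α → ℝ) (hφ : Measurable φ) :
    Lp ℂ 2 μ →ₗᵢ[ℂ] Lp ℂ 2 μ where
  toFun F := (memLp_phase μ φ hφ F).toLp _
  map_add' F G := by
    rw [← MemLp.toLp_add, MemLp.toLp_eq_toLp_iff]
    filter_upwards [Lp.coeFn_add F G] with p hp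
    simp only [hp, Pi.add_apply]; ring
  map_smul' c F := by
    rw [RingHom.id_apply, ← MemLp.toLp_const_smul, MemLp.toLp_eq_toLp_iff]
    filter_upwards [Lp.coeFn_smul c F] with p hp
    simp only [hp, Pi.smul_apply, smul_eq_mul]; ring
  norm_map' F := by
    change ‖(memLp_phase μ φ hφ F).toLp _‖ = ‖F‖
    rw [Lp.norm_toLp, Lp.norm_def]
    congr 1
    exact eLpNorm_congr_norm_ae (Eventually.of_forall fun p => by
      simp [Complex.norm_exp_ofReal_mul_I])

theorem memLp_tensorLeft {α : Type*} [MeasurableSpace α] (μ : Measure α) [SigmaFinite μ] {k : ℕ}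
    (f : Lp ℂ 2 μ) (F : TensorL2 μ k) :
    MemLp (fun p : Fin (k + 1) → α => f (p 0) * F (fun i => p i.succ)) 2
      (Measure.pi fun _ : Fin (k + 1) => μ) := by
  have h := (measurePreserving_piFinSuccAbove (fun _ : Fin (k + 1) => μ) 0)
  have h2 : MemLp (fun z : α × (Fin k → α) => f z.1 * F z.2) 2
      (μ.prod (Measure.pi fun _ : Fin k => μ)) := by
    have hm : AEStronglyMeasurable (fun z : α × (Fin k → α) => f z.1 * F z.2)
        (μ.prod (Measure.pi fun _ : Fin k => μ)) :=
      (Lp.aestronglyMeasurable f).comp_fst.mul (Lp.aestronglyMeasurable F).comp_snd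
    rw [memLp_two_iff_integrable_sq_norm hm]
    simp_rw [norm_mul, mul_pow]
    exact ((memLp_two_iff_integrable_sq_norm (Lp.aestronglyMeasurable f)).1 (Lp.memLp f)).mul_prod
      ((memLp_two_iff_integrable_sq_norm (Lp.aestronglyMeasurable F)).1 (Lp.memLp F))
  exact h2.comp_measurePreserving h

theorem quasiMeasurePreserving_tail {α : Type*} [MeasurableSpace α] (μ : Measure α)
    [SigmaFinite μ] (k : ℕ) :
    Measure.QuasiMeasurePreserving (fun (p : Fin (k + 1) → α) (i : Fin k) => p i.succ)
      (Measure.pi fun _ : Fin (k + 1) => μ) (Measure.pi fun _ : Fin k => μ) :=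
  (Measure.quasiMeasurePreserving_snd (μ := μ) (ν := Measure.pi fun _ : Fin k => μ)).comp
    (measurePreserving_piFinSuccAbove (fun _ : Fin (k + 1) => μ) 0).quasiMeasurePreserving

theorem norm_sq_eq_integral {α : Type*} [MeasurableSpace α] {μ : Measure α} (F : Lp ℂ 2 μ) :
    ‖F‖ ^ 2 = ∫ p, ‖F p‖ ^ 2 ∂μ := by
  have h : inner ℂ F F = ((‖F‖ ^ 2 : ℝ) : ℂ) := by
    rw [inner_self_eq_norm_sq_to_K]; simp
  rw [L2.inner_def] at h
  simp only [inner_self_eq_norm_sq_to_K] at h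
  have h2 : ∫ p, ((‖F p‖ ^ 2 : ℝ) : ℂ) ∂μ = ((‖F‖ ^ 2 : ℝ) : ℂ) := by
    rw [← h]; simp
  rw [integral_complex_ofReal] at h2
  exact (Complex.ofReal_injective h2).symm

theorem norm_tensorLeft {α : Type*} [MeasurableSpace α] (μ : Measure α) [SigmaFinite μ] {k : ℕ}
    (f : Lp ℂ 2 μ) (F : TensorL2 μ k) :
    ‖(memLp_tensorLeft μ f F).toLp _‖ = ‖f‖ * ‖F‖ := by
  refine (pow_left_inj₀ (norm_nonneg _) (by positivity) two_ne_zero).1 ?_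
  rw [mul_pow, norm_sq_eq_integral, norm_sq_eq_integral, norm_sq_eq_integral,
    ← integral_prod_mul (fun x => ‖f x‖ ^ 2) (fun x => ‖F x‖ ^ 2)]
  rw [← (measurePreserving_piFinSuccAbove (fun _ : Fin (k + 1) => μ) 0).integral_comp'
    (g := fun z : α × (Fin k → α) => ‖f z.1‖ ^ 2 * ‖F z.2‖ ^ 2)]
  apply integral_congr_ae
  filter_upwards [(memLp_tensorLeft μ f F).coeFn_toLp] with p hp
  rw [hp, norm_mul, mul_pow]
  rfl

/-- The map `F ↦ f ⊗ F` from `L²(μᵏ)` to `L²(μᵏ⁺¹)`. -/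
def tensorLeft {α : Type*} [MeasurableSpace α] (μ : Measure α) [SigmaFinite μ] (k : ℕ)
    (f : Lp ℂ 2 μ) : TensorL2 μ k →L[ℂ] TensorL2 μ (k + 1) :=
  LinearMap.mkContinuous
    { toFun := fun F => (memLp_tensorLeft μ f F).toLp _
      map_add' := fun F G => by
        rw [← MemLp.toLp_add, MemLp.toLp_eq_toLp_iff]
        filter_upwards [(quasiMeasurePreserving_tail μ k).ae (Lp.coeFn_add F G)] with p hp
        simp only [hp, Pi.add_apply]; ring
      map_smul' := fun c F => by
        rw [RingHom.id_apply, ← MemLp.toLp_const_smul, MemLp.toLp_eq_toLp_iff]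
        filter_upwards [(quasiMeasurePreserving_tail μ k).ae (Lp.coeFn_smul c F)] with p hp
        simp only [hp, Pi.smul_apply, smul_eq_mul]; ring }
    ‖f‖ (fun F => (norm_tensorLeft μ f F).le)

/-- The bounded part `a*(f) : 𝓗ₖ → 𝓗ₖ₊₁`, `Ψ ↦ √(k+1) Sym (f ⊗ Ψ)`, of the creation operator;
`Sym` is the orthogonal projection onto the symmetric subspace. -/
def creationPart {α : Type*} [MeasurableSpace α] (μ : Measure α) [SigmaFinite μ] (k : ℕ)
    (f : Lp ℂ 2 μ) : bosons μ k →L[ℂ] bosons μ (k + 1) :=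
  (Real.sqrt (k + 1) : ℂ) •
    ((bosons μ (k + 1)).orthogonalProjectionOnto ∘L tensorLeft μ k f ∘L (bosons μ k).subtypeL)

/-- The `k`-boson component of `a*(f) Ψ`. -/
def creationComponent {α : Type*} [MeasurableSpace α] (μ : Measure α) [SigmaFinite μ]
    (f : Lp ℂ 2 μ) (Ψ : Fock μ) : ∀ k : ℕ, bosons μ k
  | 0 => 0
  | k + 1 => creationPart μ k f (Ψ k)

/-- The creation operator `a*(f)`, linear in `f`. -/
def creation {α : Type*} [MeasurableSpace α] (μ : Measure α) [SigmaFinite μ]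
    (f : Lp ℂ 2 μ) : finiteParticle μ →ₗ[ℂ] finiteParticle μ where
  toFun Ψ := ofComponents μ (creationComponent μ f Ψ) (by
    obtain ⟨N, hN⟩ := Ψ.2
    refine ⟨N + 1, fun k hk => ?_⟩
    obtain ⟨k, rfl⟩ : ∃ j, k = j + 1 := ⟨k - 1, by omega⟩
    change creationPart μ k f _ = 0
    rw [hN k (by omega), map_zero])
  map_add' Ψ Φ := by
    ext1; ext1; funext k
    cases k with
    | zero => exact (add_zero _).symm
    | succ k => exact map_add (creationPart μ k f) _ _
  map_smul' c Ψ := by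
    ext1; ext1; funext k
    cases k with
    | zero => exact (smul_zero c).symm
    | succ k => exact map_smul (creationPart μ k f) _ _

/-- The annihilation operator `a(g)`, antilinear in `g`: on each particle number it is the adjoint
of the creation operator `a*(g)`. -/
def annihilation {α : Type*} [MeasurableSpace α] (μ : Measure α) [SigmaFinite μ]
    (g : Lp ℂ 2 μ) : finiteParticle μ →ₗ[ℂ] finiteParticle μ where
  toFun Ψ := ofComponents μ
    (fun k => ContinuousLinearMap.adjoint (creationPart μ k g) ((Ψ : Fock μ) (k + 1))) (by
      obtain ⟨N, hN⟩ := Ψ.2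
      exact ⟨N, fun k hk => by rw [hN (k + 1) (by omega), map_zero]⟩)
  map_add' Ψ Φ := by
    ext1; ext1; funext k
    exact map_add (ContinuousLinearMap.adjoint (creationPart μ k g)) _ _
  map_smul' c Ψ := by
    ext1; ext1; funext k
    exact map_smul (ContinuousLinearMap.adjoint (creationPart μ k g)) _ _

/-! ### Minkowski space, the mass shell and test functions

Spacetime is `ℝᵈ` with `d = n + 2`; coordinate `0` is time. -/

/-- Spacetime `ℝᵈ`, `d = n + 2 ≥ 2`. -/
abbrev Spacetime (n : ℕ) : Type := EuclideanSpace ℝ (Fin (n + 2))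

/-- The space `ℝᵈ⁻¹` of spatial momenta. -/
abbrev Momentum (n : ℕ) : Type := EuclideanSpace ℝ (Fin (n + 1))

/-- The Lorentzian scalar product of signature `(+, -, …, -)`. -/
def minkowski {n : ℕ} (x y : Spacetime n) : ℝ :=
  x 0 * y 0 - ∑ i : Fin (n + 1), x i.succ * y i.succ

/-- The relativistic energy `ω_p = √(p² + m²)`. -/
def energy {n : ℕ} (m : ℝ) (p : Momentum n) : ℝ :=
  Real.sqrt (m ^ 2 + ∑ i, p i ^ 2)

/-- The on-shell momentum `(ω_p, p)`. -/
def onShell {n : ℕ} (m : ℝ) (p : Momentum n) : Spacetime n :=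
  WithLp.toLp 2 (Fin.cons (energy m p) p : Fin (n + 2) → ℝ)

/-- The measure `dμ(p) = dp / (2 ω_p)`. -/
def shellMeasure (n : ℕ) (m : ℝ) : Measure (Momentum n) :=
  volume.withDensity fun p => ENNReal.ofReal (1 / (2 * energy m p))

instance sigmaFinite_shellMeasure (n : ℕ) (m : ℝ) : SigmaFinite (shellMeasure n m) :=
  SigmaFinite.withDensity_ofReal _

/-- The one-particle space `L²(dμ)`. -/
abbrev OneParticle (n : ℕ) (m : ℝ) : Type := Lp ℂ 2 (shellMeasure n m)

/-- `f⁺(p) = ∫ f(x) e^{ipx} dx`, with `p` on the mass shell. -/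
def testPlus {n : ℕ} (m : ℝ) (f : 𝓢(Spacetime n, ℂ)) (p : Momentum n) : ℂ :=
  ∫ x, f x * Complex.exp (Complex.I * minkowski (onShell m p) x)

/-- `f⁻(p) = ∫ f(x) e^{-ipx} dx`, with `p` on the mass shell. -/
def testMinus {n : ℕ} (m : ℝ) (f : 𝓢(Spacetime n, ℂ)) (p : Momentum n) : ℂ :=
  ∫ x, f x * Complex.exp (-(Complex.I * minkowski (onShell m p) x))

theorem continuous_energy {n : ℕ} (m : ℝ) : Continuous (energy m : Momentum n → ℝ) := by
  unfold energy
  fun_prop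

theorem continuous_onShell {n : ℕ} (m : ℝ) :
    Continuous (onShell m : Momentum n → Spacetime n) := by
  unfold onShell
  refine (PiLp.continuous_toLp 2 _).comp (continuous_pi fun i => ?_)
  refine Fin.cases ?_ (fun i => ?_) i
  · exact continuous_energy (n := n) m
  · simp only [Fin.cons_succ]; fun_prop

theorem continuous_minkowski {n : ℕ} (y : Spacetime n) : Continuous (minkowski y) := by
  unfold minkowski
  fun_prop

theorem shellMeasure_le {n : ℕ} {m : ℝ} (hm : 0 < m) :
    shellMeasure n m ≤ ENNReal.ofReal (1 / (2 * m)) • (volume : Measure (Momentum n)) := by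
  rw [← withDensity_const]
  refine withDensity_mono (Eventually.of_forall fun p => ENNReal.ofReal_le_ofReal ?_)
  have : m ≤ energy m p := Real.le_sqrt_of_sq_le (by
    have : 0 ≤ ∑ i, p i ^ 2 := Finset.sum_nonneg fun i _ => sq_nonneg _
    linarith)
  gcongr

/-- The covector `∓ (ω_p, -p) / 2π` at which the Fourier transform is evaluated. -/
def fourierPoint {n : ℕ} (m s : ℝ) (p : Momentum n) : Spacetime n :=
  (-s / (2 * Real.pi)) • WithLp.toLp 2 (Fin.cons (energy m p) (fun i => -p i) : Fin (n + 2) → ℝ)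

theorem inner_fourierPoint {n : ℕ} (m s : ℝ) (p : Momentum n) (x : Spacetime n) :
    -2 * Real.pi * inner ℝ x (fourierPoint m s p) = s * minkowski (onShell m p) x := by
  have hpi := Real.pi_ne_zero
  simp only [fourierPoint, inner_smul_right, PiLp.inner_apply, Fin.sum_univ_succ (n := n + 1),
    minkowski, onShell, Fin.cons_zero, Fin.cons_succ]
  simp only [RCLike.inner_apply, conj_trivial, neg_mul, Finset.sum_neg_distrib]
  field_simp
  ring

theorem integral_eq_fourier {n : ℕ} (m s : ℝ) (f : 𝓢(Spacetime n, ℂ)) (p : Momentum n) :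
    ∫ x, f x * Complex.exp (Complex.I * (s * minkowski (onShell m p) x : ℝ)) =
      FourierTransform.fourier f (fourierPoint m s p) := by
  rw [SchwartzMap.fourier_coe, Real.fourier_eq']
  refine integral_congr_ae (Eventually.of_forall fun x => ?_)
  simp only [inner_fourierPoint, smul_eq_mul]
  rw [mul_comm, mul_comm Complex.I]

theorem norm_le_fourierPoint {n : ℕ} (m : ℝ) {s : ℝ} (hs : |s| = 1) (p : Momentum n) :
    (1 / (2 * Real.pi)) * ‖p‖ ≤ ‖fourierPoint m s p‖ := by
  rw [fourierPoint, norm_smul, Real.norm_eq_abs, abs_div, abs_neg, hs,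
    abs_of_pos (by positivity : (0 : ℝ) < 2 * Real.pi)]
  gcongr
  rw [EuclideanSpace.norm_eq, EuclideanSpace.norm_eq]
  apply Real.sqrt_le_sqrt
  rw [Fin.sum_univ_succ (n := n + 1)]
  simp only [Fin.cons_zero, Fin.cons_succ, norm_neg]
  linarith [sq_nonneg ‖energy m p‖]

theorem continuous_fourierPoint {n : ℕ} (m s : ℝ) :
    Continuous (fourierPoint m s : Momentum n → Spacetime n) := by
  have h : Continuous fun p : Momentum n =>
      (WithLp.toLp 2 (Fin.cons (energy m p) (fun i => -p i) : Fin (n + 2) → ℝ) : Spacetime n) := by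
    refine (PiLp.continuous_toLp 2 _).comp (continuous_pi fun i => ?_)
    refine Fin.cases ?_ (fun i => ?_) i
    · exact continuous_energy m
    · simp only [Fin.cons_succ]; fun_prop
  exact h.const_smul (-s / (2 * Real.pi))

theorem memLp_fourier {n : ℕ} {m : ℝ} (hm : 0 < m) {s : ℝ} (hs : |s| = 1)
    (f : 𝓢(Spacetime n, ℂ)) :
    MemLp (fun p => FourierTransform.fourier f (fourierPoint m s p)) 2 (shellMeasure n m) := by
  refine MemLp.of_measure_le_smul (c := ENNReal.ofReal (1 / (2 * m))) ENNReal.ofReal_ne_top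
    (shellMeasure_le hm) ?_
  have hcont : Continuous fun p : Momentum n =>
      FourierTransform.fourier f (fourierPoint m s p) :=
    (SchwartzMap.continuous _).comp (continuous_fourierPoint m s)
  rw [memLp_two_iff_integrable_sq_norm hcont.aestronglyMeasurable]
  obtain ⟨C, hC⟩ : ∃ C : ℝ, ∀ w, (1 + ‖w‖) ^ (n + 2) * ‖FourierTransform.fourier f w‖ ≤ C :=
    ⟨_, fun w => by
      simpa using SchwartzMap.one_add_le_sup_seminorm_apply (𝕜 := ℂ) (m := (n + 2, 0))
        (k := n + 2) (n := 0) le_rfl le_rfl (FourierTransform.fourier f) w⟩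
  have hC0 : 0 ≤ C := le_trans (by positivity) (hC 0)
  set c : ℝ := 1 / (2 * Real.pi) with hc
  have hcpos : 0 < c := by positivity
  have hc1 : c ≤ 1 := by
    rw [hc, div_le_one (by positivity)]
    linarith [Real.pi_gt_three]
  have hb : ∀ p : Momentum n, ‖FourierTransform.fourier f (fourierPoint m s p)‖ ≤
      C * (c⁻¹) ^ (n + 2) * ((1 + ‖p‖) ^ (n + 2))⁻¹ := by
    intro p
    have h1 := hC (fourierPoint m s p)
    have h2 : c * (1 + ‖p‖) ≤ 1 + ‖fourierPoint m s p‖ := by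
      have := norm_le_fourierPoint m hs p
      rw [← hc] at this
      linarith
    have h3 : (c * (1 + ‖p‖)) ^ (n + 2) * ‖FourierTransform.fourier f (fourierPoint m s p)‖ ≤ C :=
      le_trans (by gcongr) h1
    rw [inv_pow, mul_assoc, ← mul_inv, ← mul_pow, ← div_eq_mul_inv, le_div_iff₀ (by positivity),
      mul_comm]
    exact h3
  have hi : Integrable (fun p : Momentum n => (1 + ‖p‖) ^ (-((n + 2 : ℕ) : ℝ))) volume :=
    integrable_one_add_norm (by
      rw [finrank_euclideanSpace_fin]; push_cast; linarith)
  refine (hi.const_mul ((C * (c⁻¹) ^ (n + 2)) ^ 2)).mono'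
    ((hcont.norm.pow 2).aestronglyMeasurable) (Eventually.of_forall fun p => ?_)
  have hp : (1 : ℝ) ≤ (1 + ‖p‖) ^ (n + 2) := one_le_pow₀ (by linarith [norm_nonneg p])
  rw [Real.norm_of_nonneg (by positivity), Real.rpow_neg (by positivity), Real.rpow_natCast]
  calc ‖FourierTransform.fourier f (fourierPoint m s p)‖ ^ 2
      ≤ (C * (c⁻¹) ^ (n + 2) * ((1 + ‖p‖) ^ (n + 2))⁻¹) ^ 2 := by
        gcongr
        exact hb p
    _ = (C * (c⁻¹) ^ (n + 2)) ^ 2 * (((1 + ‖p‖) ^ (n + 2))⁻¹ * ((1 + ‖p‖) ^ (n + 2))⁻¹) := by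
        ring
    _ ≤ (C * (c⁻¹) ^ (n + 2)) ^ 2 * (1 * ((1 + ‖p‖) ^ (n + 2))⁻¹) := by
        gcongr
        exact inv_le_one_of_one_le₀ hp
    _ = _ := by rw [one_mul]

theorem memLp_testPlus {n : ℕ} {m : ℝ} (hm : 0 < m) (f : 𝓢(Spacetime n, ℂ)) :
    MemLp (testPlus m f) 2 (shellMeasure n m) := by
  have h : testPlus m f = fun p => FourierTransform.fourier f (fourierPoint m 1 p) := by
    funext p
    rw [← integral_eq_fourier, testPlus]
    simp
  rw [h]
  exact memLp_fourier hm (by simp) f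

theorem memLp_testMinus {n : ℕ} {m : ℝ} (hm : 0 < m) (f : 𝓢(Spacetime n, ℂ)) :
    MemLp (testMinus m f) 2 (shellMeasure n m) := by
  have h : testMinus m f = fun p => FourierTransform.fourier f (fourierPoint m (-1) p) := by
    funext p
    rw [← integral_eq_fourier, testMinus]
    simp
  rw [h]
  exact memLp_fourier hm (by simp) f

/-- `f⁺` as a one-particle vector. -/
def plusVector {n : ℕ} {m : ℝ} (hm : 0 < m) (f : 𝓢(Spacetime n, ℂ)) : OneParticle n m :=
  (memLp_testPlus hm f).toLp _

/-- The complex conjugate of `f⁻` as a one-particle vector. -/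
def conjMinusVector {n : ℕ} {m : ℝ} (hm : 0 < m) (f : 𝓢(Spacetime n, ℂ)) : OneParticle n m :=
  (memLp_testMinus hm f).star.toLp _

/-- The massive free scalar field `φ(f) = a(conj f⁻) + a*(f⁺)` on finite particle vectors. -/
def freeField {n : ℕ} {m : ℝ} (hm : 0 < m) (f : 𝓢(Spacetime n, ℂ)) :
    finiteParticle (shellMeasure n m) →ₗ[ℂ] finiteParticle (shellMeasure n m) :=
  annihilation (shellMeasure n m) (conjMinusVector hm f) +
    creation (shellMeasure n m) (plusVector hm f)

/-! ### The group generated by `X` and the deformed field -/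

/-- The function `(p₁, …, p_k) ↦ y · (p₁ + ⋯ + p_k)`. -/
def totalPhase {n : ℕ} (m : ℝ) (y : Spacetime n) (k : ℕ) (p : Fin k → Momentum n) : ℝ :=
  ∑ j, minkowski y (onShell m (p j))

theorem measurable_totalPhase {n : ℕ} (m : ℝ) (y : Spacetime n) (k : ℕ) :
    Measurable (totalPhase m y k) := by
  unfold totalPhase
  refine Finset.measurable_fun_sum _ fun j _ => ?_
  exact ((continuous_minkowski y).comp (continuous_onShell m)).measurable.comp
    (measurable_pi_apply j)

theorem phaseMul_mem_bosons {n : ℕ} (m : ℝ) (y : Spacetime n) (k : ℕ)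
    (F : TensorL2 (shellMeasure n m) k) (hF : F ∈ bosons (shellMeasure n m) k) :
    phaseMul (Measure.pi fun _ : Fin k => shellMeasure n m) (totalPhase m y k)
      (measurable_totalPhase m y k) F ∈ bosons (shellMeasure n m) k := by
  intro σ
  have hσ := measurePreserving_permute (shellMeasure n m) σ
  have hco := (memLp_phase _ (totalPhase m y k) (measurable_totalPhase m y k) F).coeFn_toLp
  apply Lp.ext
  have hFσ : ∀ᵐ p ∂(Measure.pi fun _ : Fin k => shellMeasure n m), F (p ∘ σ) = F p := by
    have h1 := Lp.coeFn_compMeasurePreserving F hσ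
    have h2 : Lp.compMeasurePreserving _ hσ F = F := hF σ
    rw [h2] at h1
    filter_upwards [h1] with p hp
    exact hp.symm
  have h1 := Lp.coeFn_compMeasurePreserving
    (phaseMul _ (totalPhase m y k) (measurable_totalPhase m y k) F) hσ
  filter_upwards [h1, hco, hσ.quasiMeasurePreserving.ae hco, hFσ] with p h1 h2 h3 h4
  refine h1.trans (h3.trans (Eq.trans ?_ h2.symm))
  have : totalPhase m y k (p ∘ σ) = totalPhase m y k p :=
    Equiv.sum_comp σ fun j => minkowski y (onShell m (p j))
  simp only [this, h4]

/-- The translation group `U(y) = e^{i y P}` on Fock space; on `k`-boson vectors the momentum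
operator `P` is multiplication by `p₁ + ⋯ + p_k`, with every `p_j` on the mass shell. -/
def translation {n : ℕ} (m : ℝ) (y : Spacetime n) :
    Fock (shellMeasure n m) →ₗᵢ[ℂ] Fock (shellMeasure n m) :=
  diagonal fun k => restrictBosons
    (phaseMul (Measure.pi fun _ : Fin k => shellMeasure n m) (totalPhase m y k)
      (measurable_totalPhase m y k))
    (phaseMul_mem_bosons m y k)

/-- The group `e^{i y X} = Γ(V⁻¹) e^{i y P} Γ(V)` generated by `X = Γ(V⁻¹) P Γ(V)`. -/
def expX {n : ℕ} {m : ℝ} (V : OneParticle n m ≃ₗᵢ[ℂ] OneParticle n m) (y : Spacetime n) :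
    Fock (shellMeasure n m) →ₗᵢ[ℂ] Fock (shellMeasure n m) :=
  (secondQuant V.symm).comp ((translation m y).comp (secondQuant V))

theorem expX_mem {n : ℕ} {m : ℝ} (V : OneParticle n m ≃ₗᵢ[ℂ] OneParticle n m) (y : Spacetime n)
    (Ψ : Fock (shellMeasure n m)) (hΨ : Ψ ∈ finiteParticle (shellMeasure n m)) :
    (expX V y).toLinearMap Ψ ∈ finiteParticle (shellMeasure n m) :=
  diagonal_mem _ _ (diagonal_mem _ _ (diagonal_mem _ _ hΨ))

/-- The restriction of `e^{i y X}` to the finite particle vectors. -/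
def expXFinite {n : ℕ} {m : ℝ} (V : OneParticle n m ≃ₗᵢ[ℂ] OneParticle n m) (y : Spacetime n) :
    finiteParticle (shellMeasure n m) →ₗ[ℂ] finiteParticle (shellMeasure n m) :=
  (expX V y).toLinearMap.restrict (expX_mem V y)

/-- A matrix acting on spacetime. -/
def act {n : ℕ} (A : Matrix (Fin (n + 2)) (Fin (n + 2)) ℝ) (x : Spacetime n) : Spacetime n :=
  WithLp.toLp 2 (A.mulVec x.ofLp)

/-- The integrand `e^{-ixy} χ(εx, εy) β_{θx}(φ(f)) e^{iyX} Ψ` of the warped convolution, where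
`z = (x, y)` and `β_b(A) = e^{ibX} A e^{-ibX}`. -/
def warpIntegrand {n : ℕ} {m : ℝ} (hm : 0 < m) (V : OneParticle n m ≃ₗᵢ[ℂ] OneParticle n m)
    (θ : Matrix (Fin (n + 2)) (Fin (n + 2)) ℝ) (f : 𝓢(Spacetime n, ℂ))
    (χ : 𝓢(Spacetime n × Spacetime n, ℂ)) (ε : ℝ) (Ψ : finiteParticle (shellMeasure n m))
    (z : Spacetime n × Spacetime n) : Fock (shellMeasure n m) :=
  (Complex.exp (-(Complex.I * minkowski z.1 z.2)) * χ (ε • z)) •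
    ((expXFinite V (act θ z.1) (freeField hm f (expXFinite V (-act θ z.1) (expXFinite V z.2 Ψ))) :
      finiteParticle (shellMeasure n m)) : Fock (shellMeasure n m))

/-- `φ_{θ,X}(f) Ψ` exists as an oscillatory integral and equals `Φ`: for every cutoff `χ` with
`χ(0, 0) = 1` the regularised integrals converge absolutely and tend to `Φ` in norm. -/
def IsWarpedValue {n : ℕ} {m : ℝ} (hm : 0 < m) (V : OneParticle n m ≃ₗᵢ[ℂ] OneParticle n m)
    (θ : Matrix (Fin (n + 2)) (Fin (n + 2)) ℝ) (f : 𝓢(Spacetime n, ℂ))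
    (Ψ : finiteParticle (shellMeasure n m)) (Φ : Fock (shellMeasure n m)) : Prop :=
  ∀ χ : 𝓢(Spacetime n × Spacetime n, ℂ), χ 0 = 1 →
    (∀ ε : ℝ, 0 < ε → Integrable (warpIntegrand hm V θ f χ ε Ψ)) ∧
    Tendsto (fun ε : ℝ => (((2 * Real.pi) ^ (n + 2))⁻¹ : ℂ) • ∫ z, warpIntegrand hm V θ f χ ε Ψ z)
      (𝓝[>] 0) (𝓝 Φ)

/-! ### Wedges and wedge-local fields -/

/-- The right wedge `W₁ = {x : x₁ > |x₀|}`. -/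
def rightWedge (n : ℕ) : Set (Spacetime n) := {x | |x 0| < x 1}

/-- The left wedge `-W₁`. -/
def leftWedge (n : ℕ) : Set (Spacetime n) := {x | -x ∈ rightWedge n}

/-- `Λ` is a Lorentz transformation with determinant `1`. -/
def IsProperLorentz {n : ℕ} (Λ : Matrix (Fin (n + 2)) (Fin (n + 2)) ℝ) : Prop :=
  (∀ x y : Spacetime n, minkowski (act Λ x) (act Λ y) = minkowski x y) ∧ Λ.det = 1

/-- The set of wedges: the images of `W₁` under proper Lorentz transformations. For `d ≥ 3` the
orthochronous ones give the same set; for `d = 2` it is `{W₁, -W₁}`. -/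
def wedges (n : ℕ) : Set (Set (Spacetime n)) :=
  {W | ∃ Λ, IsProperLorentz Λ ∧ W = act Λ '' rightWedge n}

/-- `γ_Λ(θ) = ± Λ θ Λ⁻¹`, with `+` for orthochronous `Λ`. The inverse of a Lorentz matrix is its
transpose with respect to the Lorentzian scalar product. -/
def gammaAct {n : ℕ} (Λ θ : Matrix (Fin (n + 2)) (Fin (n + 2)) ℝ) :
    Matrix (Fin (n + 2)) (Fin (n + 2)) ℝ :=
  if 0 < Λ 0 0 then Λ * θ * Λ⁻¹ else -(Λ * θ * Λ⁻¹)

/-- Admissible deformation matrices: `θ₀₁ = θ₁₀ = λ ≥ 0`, in dimension `d = 4` also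
`θ₂₃ = -θ₃₂ = η`, and all other entries vanish. -/
def IsAdmissible {n : ℕ} (θ : Matrix (Fin (n + 2)) (Fin (n + 2)) ℝ) : Prop :=
  ∃ lam η : ℝ, 0 ≤ lam ∧ (n ≠ 2 → η = 0) ∧ ∀ i j : Fin (n + 2), θ i j =
    if (i.val = 0 ∧ j.val = 1) ∨ (i.val = 1 ∧ j.val = 0) then lam
    else if i.val = 2 ∧ j.val = 3 then η
    else if i.val = 3 ∧ j.val = 2 then -η
    else 0

/-- Families of field operators indexed by regions (only wedges matter), defined on the finite
particle vectors and leaving them invariant. -/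
abbrev FieldFamily (n : ℕ) (m : ℝ) : Type :=
  Set (Spacetime n) → 𝓢(Spacetime n, ℂ) →ₗ[ℂ]
    finiteParticle (shellMeasure n m) →ₗ[ℂ] finiteParticle (shellMeasure n m)

/-- `φ_W(f) = φ_{Q(W),X}(f)` for every wedge `W`, where `Q(Λ W₁) = γ_Λ(θ)`. -/
def IsWarpedFamily {n : ℕ} {m : ℝ} (hm : 0 < m) (V : OneParticle n m ≃ₗᵢ[ℂ] OneParticle n m)
    (θ : Matrix (Fin (n + 2)) (Fin (n + 2)) ℝ) (φ : FieldFamily n m) : Prop :=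
  ∀ Λ, IsProperLorentz Λ → ∀ f Ψ,
    IsWarpedValue hm V (gammaAct Λ θ) f Ψ (φ (act Λ '' rightWedge n) f Ψ : finiteParticle _)

/-- Wedge-local families of fields: operator valued tempered distributions, hermitian on the common
invariant domain of finite particle vectors, such that the fields of `W₁` and `-W₁` commute on
test functions supported in the respective wedge. Covariance is not part of this notion. -/
structure IsWedgeLocal {n : ℕ} {m : ℝ} (φ : FieldFamily n m) : Prop where
  /-- Each `f ↦ φ_W(f) Ψ` is a vector valued tempered distribution. -/
  continuous : ∀ W ∈ wedges n, ∀ Ψ, Continuous fun f =>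
    ((φ W f Ψ : finiteParticle (shellMeasure n m)) : Fock (shellMeasure n m))
  /-- `φ_W(f)* ⊇ φ_W(conj f)` on the finite particle vectors. -/
  hermitian : ∀ W ∈ wedges n, ∀ f g : 𝓢(Spacetime n, ℂ), (∀ x, g x = conj (f x)) →
    ∀ Ψ Φ : finiteParticle (shellMeasure n m),
      inner ℂ ((φ W f Ψ : finiteParticle (shellMeasure n m)) : Fock (shellMeasure n m)) Φ =
        inner ℂ (Ψ : Fock (shellMeasure n m)) (φ W g Φ : finiteParticle (shellMeasure n m))
  /-- The fields of opposite wedges commute. -/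
  commute : ∀ f g : 𝓢(Spacetime n, ℂ), HasCompactSupport f → HasCompactSupport g →
    tsupport f ⊆ rightWedge n → tsupport g ⊆ leftWedge n →
      ∀ Ψ, φ (rightWedge n) f (φ (leftWedge n) g Ψ) = φ (leftWedge n) g (φ (rightWedge n) f Ψ)

/-- `h = V f` for test functions: `h⁺ = V f⁺` and `conj h⁻ = V (conj f⁻)`, which says
`φ(h) = Γ(V) φ(f) Γ(V⁻¹)`. -/
def IsImage {n : ℕ} {m : ℝ} (hm : 0 < m) (V : OneParticle n m ≃ₗᵢ[ℂ] OneParticle n m)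
    (f h : 𝓢(Spacetime n, ℂ)) : Prop :=
  plusVector hm h = V (plusVector hm f) ∧ conjMinusVector hm h = V (conjMinusVector hm f)

/-- `V` maps test functions supported in `O` to test functions supported in `O`. -/
def PreservesSupport {n : ℕ} {m : ℝ} (hm : 0 < m) (V : OneParticle n m ≃ₗᵢ[ℂ] OneParticle n m)
    (O : Set (Spacetime n)) : Prop :=
  ∀ f : 𝓢(Spacetime n, ℂ), HasCompactSupport f → tsupport f ⊆ O →
    ∃ h : 𝓢(Spacetime n, ℂ), tsupport h ⊆ O ∧ IsImage hm V f h

end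
end WarpedField

open WarpedField

namespace WarpedField
noncomputable section

/-! ### Permutations, phases and elementary tensors -/

section Algebra

variable {α : Type*} [MeasurableSpace α] {μ : Measure α}

/-! Conjugation with `Γ(V)` turns `e^{iyX}` into the ordinary translations and replaces the vectors
`f⁺`, `conj f⁻` by their images under `V`. It therefore suffices to deform a free field with
arbitrary one-particle vectors with respect to `e^{iyP}`.

On `k`-boson functions translations are phases. Each half of the deformed integrand is thus
multiplication by `e^{i(x·a + y·b)}`, where `a` and `b` are functions of the momenta. The
regularised integrals of `e^{-ix·y} e^{i(x·a + y·b)}` are bounded uniformly in `a`, `b` and tend to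
`e^{ia·b}` (`oscillatory_integral_eq`, `tendsto_oscFactor`), so dominated convergence in `L²` gives
the limit in norm. The result is explicit (`isWarpedValue_warpedField`): the creation operator `f ⊗
F` acquires the phase `∑ⱼ p₀·Mpⱼ`, and the annihilation operator is changed to the adjoint of such
an operator. Hermiticity and continuity in the test function are read off from this formula, since
only finitely many particle numbers occur and each component is bounded.

Two transformations with the same image of `W₁` differ by some `N` that stabilises `W₁`. Such an `N`
is block diagonal and satisfies `Nθ = sθN`, where `s` is the sign of `N₀₀`; the sign in the
definition of `Q` compensates `s` (`gammaAct_eq_of_image_eq`). For the wedge `-W₁` this gives the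
matrix `-θ`.

For locality, the twist of `-θ` is the transpose of the twist of `θ`. Hence creators commute with
creators, annihilators with annihilators, and in the mixed products everything cancels except two
contractions (`twistedField_comm`). These multiply by functions of the remaining momenta `q`, and
their equality reads `∫ f⁻ g⁺ e^{-2ip·k} dμ = ∫ g⁻ f⁺ e^{2ip·k} dμ` with `k = ∑ⱼ θqⱼ`. Because `λ ≥
0`, `k` lies in the closed right wedge. In rapidity coordinates the shift `u ↦ u + iπ` sends `p` to
`-p` up to a reflection of the transversal momentum, and the supports of `f`, `g` and the position
of `k` make all three exponentials bounded on the strip. Shifting the contour yields the equality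
(`integral_testMinus_mul_testPlus`). The support hypothesis on `V` is what allows this to be applied
to `Vf` and `Vg`. -/

theorem coeFn_phaseMul (φ : α → ℝ) (hφ : Measurable φ) (F : Lp ℂ 2 μ) :
    phaseMul μ φ hφ F =ᵐ[μ] fun p => Complex.exp (φ p * Complex.I) * F p :=
  (memLp_phase μ φ hφ F).coeFn_toLp

theorem phaseMul_phaseMul (φ ψ χ : α → ℝ) (hφ : Measurable φ) (hψ : Measurable ψ)
    (hχ : Measurable χ) (h : ∀ p, φ p + ψ p = χ p) (F : Lp ℂ 2 μ) :
    phaseMul μ φ hφ (phaseMul μ ψ hψ F) = phaseMul μ χ hχ F := by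
  apply Lp.ext
  filter_upwards [coeFn_phaseMul φ hφ (phaseMul μ ψ hψ F), coeFn_phaseMul ψ hψ F,
    coeFn_phaseMul χ hχ F] with p h1 h2 h3
  rw [h1, h2, h3, ← h p, ← mul_assoc, ← Complex.exp_add]
  push_cast
  ring_nf

theorem phaseMul_zero (φ : α → ℝ) (hφ : Measurable φ) (h : ∀ p, φ p = 0) (F : Lp ℂ 2 μ) :
    phaseMul μ φ hφ F = F := by
  apply Lp.ext
  filter_upwards [coeFn_phaseMul φ hφ F] with p h1
  rw [h1, h]; simp

theorem phaseMul_neg_cancel (φ : α → ℝ) (hφ : Measurable φ) (F : Lp ℂ 2 μ) :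
    phaseMul μ φ hφ (phaseMul μ (fun p => -φ p) hφ.neg F) = F := by
  rw [phaseMul_phaseMul φ (fun p => -φ p) (fun _ => 0) hφ hφ.neg measurable_const (by simp)]
  exact phaseMul_zero _ _ (fun _ => rfl) F

theorem inner_phaseMul_right (φ : α → ℝ) (hφ : Measurable φ) (F G : Lp ℂ 2 μ) :
    inner ℂ F (phaseMul μ φ hφ G) = inner ℂ (phaseMul μ (fun p => -φ p) hφ.neg F) G := by
  rw [← LinearIsometry.inner_map_map (phaseMul μ φ hφ)
    (phaseMul μ (fun p => -φ p) hφ.neg F) G, phaseMul_neg_cancel]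

/-! ### Permutations and the splitting off of particle `0`. -/

variable [SigmaFinite μ]

theorem coeFn_permute {k : ℕ} (σ : Equiv.Perm (Fin k)) (F : TensorL2 μ k) :
    permute μ σ F =ᵐ[Measure.pi fun _ : Fin k => μ] fun p => F (p ∘ σ) :=
  Lp.coeFn_compMeasurePreserving F (measurePreserving_permute μ σ)

theorem ae_comp_permute {k : ℕ} (σ : Equiv.Perm (Fin k)) {Q : (Fin k → α) → Prop}
    (h : ∀ᵐ p ∂(Measure.pi fun _ : Fin k => μ), Q p) :
    ∀ᵐ p ∂(Measure.pi fun _ : Fin k => μ), Q (p ∘ σ) :=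
  (measurePreserving_permute μ σ).quasiMeasurePreserving.ae h

theorem permute_permute {k : ℕ} (σ τ : Equiv.Perm (Fin k)) (F : TensorL2 μ k) :
    permute μ σ (permute μ τ F) = permute μ (σ * τ) F := by
  apply Lp.ext
  filter_upwards [coeFn_permute σ (permute μ τ F), ae_comp_permute σ (coeFn_permute τ F),
    coeFn_permute (σ * τ) F] with p h1 h2 h3
  rw [h1, h2, h3]; rfl

theorem permute_one {k : ℕ} (F : TensorL2 μ k) : permute μ 1 F = F := by
  apply Lp.ext
  filter_upwards [coeFn_permute 1 F] with p h1
  rw [h1]; rfl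

theorem inner_permute_left {k : ℕ} (σ : Equiv.Perm (Fin k)) (F G : TensorL2 μ k) :
    inner ℂ (permute μ σ F) G = inner ℂ F (permute μ σ⁻¹ G) := by
  rw [← LinearIsometry.inner_map_map (permute μ σ) F, permute_permute, mul_inv_cancel, permute_one]

theorem coeFn_tensorLeft {k : ℕ} (f : Lp ℂ 2 μ) (F : TensorL2 μ k) :
    tensorLeft μ k f F =ᵐ[Measure.pi fun _ : Fin (k + 1) => μ]
      fun p => f (p 0) * F (fun i => p i.succ) :=
  (memLp_tensorLeft μ f F).coeFn_toLp

theorem ae_tail {k : ℕ} {Q : (Fin k → α) → Prop}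
    (h : ∀ᵐ p ∂(Measure.pi fun _ : Fin k => μ), Q p) :
    ∀ᵐ p ∂(Measure.pi fun _ : Fin (k + 1) => μ), Q (fun i => p i.succ) :=
  (quasiMeasurePreserving_tail μ k).ae h

theorem ae_eval {k : ℕ} (i : Fin k) {Q : α → Prop} (h : ∀ᵐ p ∂μ, Q p) :
    ∀ᵐ p ∂(Measure.pi fun _ : Fin k => μ), Q (p i) :=
  (Measure.quasiMeasurePreserving_eval (fun _ : Fin k => μ) i).ae h

/-- Fubini, after splitting off the coordinate of particle `0`. -/
theorem inner_tensorLeft {k : ℕ} (f g : Lp ℂ 2 μ) (F G : TensorL2 μ k) :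
    inner ℂ (tensorLeft μ k f F) (tensorLeft μ k g G) = inner ℂ f g * inner ℂ F G := by
  simp only [L2.inner_def]
  rw [← integral_prod_mul (fun x => inner ℂ (f x) (g x)) (fun x => inner ℂ (F x) (G x)),
    ← (measurePreserving_piFinSuccAbove (fun _ : Fin (k + 1) => μ) 0).integral_comp'
      (g := fun z : α × (Fin k → α) => inner ℂ (f z.1) (g z.1) * inner ℂ (F z.2) (G z.2))]
  apply integral_congr_ae
  filter_upwards [coeFn_tensorLeft f F, coeFn_tensorLeft g G] with p h1 h2
  rw [h1, h2]
  have e : MeasurableEquiv.piFinSuccAbove (fun _ : Fin (k + 1) => α) 0 p =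
      (p 0, fun i => p i.succ) := rfl
  simp only [RCLike.inner_apply, map_mul, e]
  ring

theorem tensor_eq_tensorLeft {k : ℕ} (f : Fin (k + 1) → Lp ℂ 2 μ) :
    tensor μ f = tensorLeft μ k (f 0) (tensor μ fun i => f i.succ) := by
  apply Lp.ext
  filter_upwards [(memLp_tensor μ (k + 1) f).coeFn_toLp,
    coeFn_tensorLeft (f 0) (tensor μ fun i => f i.succ),
    ae_tail (memLp_tensor μ k fun i => f i.succ).coeFn_toLp] with p h1 h2 h3
  rw [tensor, h1, h2, tensor, h3, Fin.prod_univ_succ]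

/-! ### Twisted tensor multiplication -/

/-- The phase `s(p₀, p₁) + ⋯ + s(p₀, p_k)`. -/
def twist (s : α → α → ℝ) (k : ℕ) (p : Fin (k + 1) → α) : ℝ := ∑ j : Fin k, s (p 0) (p j.succ)

theorem measurable_twist {s : α → α → ℝ} (hs : Measurable (Function.uncurry s)) (k : ℕ) :
    Measurable (twist s k) :=
  Finset.measurable_fun_sum _ fun j _ =>
    Measurable.comp (f := fun p : Fin (k + 1) → α => (p 0, p j.succ)) hs
      ((measurable_pi_apply 0).prodMk (measurable_pi_apply j.succ))

/-- The map `F ↦ e^{i ∑ⱼ s(p₀, pⱼ)} (f ⊗ F)`. -/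
def twistedTensor {s : α → α → ℝ} (hs : Measurable (Function.uncurry s)) (k : ℕ) (f : Lp ℂ 2 μ) :
    TensorL2 μ k →L[ℂ] TensorL2 μ (k + 1) :=
  (phaseMul (Measure.pi fun _ : Fin (k + 1) => μ) (twist s k)
    (measurable_twist hs k)).toContinuousLinearMap ∘L tensorLeft μ k f

variable {s : α → α → ℝ} (hs : Measurable (Function.uncurry s))

theorem coeFn_twistedTensor {k : ℕ} (f : Lp ℂ 2 μ) (F : TensorL2 μ k) :
    twistedTensor hs k f F =ᵐ[Measure.pi fun _ : Fin (k + 1) => μ]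
      fun p => Complex.exp (twist s k p * Complex.I) * (f (p 0) * F (fun i => p i.succ)) := by
  filter_upwards [coeFn_phaseMul (twist s k) (measurable_twist hs k) (tensorLeft μ k f F),
    coeFn_tensorLeft f F] with p h1 h2
  rw [← h2]
  exact h1

/-- The extension of a permutation of `{1, …, k}` to `{0, …, k}` fixing `0`. -/
def liftPerm {k : ℕ} (σ : Equiv.Perm (Fin k)) : Equiv.Perm (Fin (k + 1)) :=
  Equiv.Perm.decomposeFin.symm (0, σ)

@[simp] theorem liftPerm_zero {k : ℕ} (σ : Equiv.Perm (Fin k)) : liftPerm σ 0 = 0 := by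
  simp [liftPerm]

@[simp] theorem liftPerm_succ {k : ℕ} (σ : Equiv.Perm (Fin k)) (j : Fin k) :
    liftPerm σ j.succ = (σ j).succ := by
  simp [liftPerm]

theorem liftPerm_inv {k : ℕ} (σ : Equiv.Perm (Fin k)) : (liftPerm σ)⁻¹ = liftPerm σ⁻¹ := by
  rw [inv_eq_iff_mul_eq_one]
  ext j
  refine Fin.cases ?_ (fun j => ?_) j <;> simp

theorem exists_liftPerm {k : ℕ} (σ : Equiv.Perm (Fin (k + 1))) (h : σ 0 = 0) :
    ∃ τ, σ = liftPerm τ := by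
  obtain ⟨⟨p, τ⟩, rfl⟩ := Equiv.Perm.decomposeFin.symm.surjective σ
  rw [Equiv.Perm.decomposeFin_symm_apply_zero] at h
  exact ⟨τ, by rw [h]; rfl⟩

/-- A permutation that fixes particle `0` merely reorders the summands of the twist. -/
theorem permute_twistedTensor {k : ℕ} (σ : Equiv.Perm (Fin k)) (f : Lp ℂ 2 μ)
    (F : TensorL2 μ k) :
    permute μ (liftPerm σ) (twistedTensor hs k f F) = twistedTensor hs k f (permute μ σ F) := by
  apply Lp.ext
  filter_upwards [coeFn_permute (liftPerm σ) (twistedTensor hs k f F),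
    ae_comp_permute (liftPerm σ) (coeFn_twistedTensor hs f F),
    coeFn_twistedTensor hs f (permute μ σ F), ae_tail (coeFn_permute σ F)] with p h1 h2 h3 h4
  rw [h1, h2, h3, h4]
  have : twist s k (p ∘ liftPerm σ) = twist s k p := by
    simp only [twist, Function.comp_apply, liftPerm_zero, liftPerm_succ]
    exact Equiv.sum_comp σ fun j => s (p 0) (p j.succ)
  rw [this]
  simp only [Function.comp_apply, liftPerm_zero, liftPerm_succ]
  rfl

/-- The exchange relation behind all commutators. The only phase coupling the two new particles is
`s(p₀, p₁)` in one order and `s'(p₀, p₁)` in the other; the swap turns the first into `s(p₁, p₀)`,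
so the orders agree when `s'` is the transpose of `s`. -/
theorem permute_twistedTensor_twistedTensor {s' : α → α → ℝ}
    (hs' : Measurable (Function.uncurry s')) (h : ∀ p q, s' p q = s q p) {k : ℕ}
    (f g : Lp ℂ 2 μ) (F : TensorL2 μ k) :
    permute μ (Equiv.swap 0 1) (twistedTensor hs (k + 1) f (twistedTensor hs' k g F)) =
      twistedTensor hs' (k + 1) g (twistedTensor hs k f F) := by
  apply Lp.ext
  have ht : ∀ p : Fin (k + 2) → α, (fun i : Fin k => (p ∘ Equiv.swap 0 1) i.succ.succ) =
      fun i => p i.succ.succ := fun p => by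
    funext i
    rw [Function.comp_apply, Equiv.swap_apply_of_ne_of_ne (Fin.succ_ne_zero _)]
    exact fun h => Fin.succ_ne_zero i (Fin.succ_injective _ h)
  filter_upwards [coeFn_permute (Equiv.swap 0 1)
      (twistedTensor hs (k + 1) f (twistedTensor hs' k g F)),
    ae_comp_permute (Equiv.swap 0 1)
      (coeFn_twistedTensor hs f (twistedTensor hs' k g F)),
    ae_comp_permute (Equiv.swap 0 1) (ae_tail (coeFn_twistedTensor hs' g F)),
    coeFn_twistedTensor hs' g (twistedTensor hs k f F),
    ae_tail (coeFn_twistedTensor hs f F)] with p h1 h2 h3 h4 h5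
  rw [h1, h2, h3, h4, h5]
  have e0 : (p ∘ Equiv.swap 0 1) 0 = p 1 := by simp
  have e1 : (p ∘ Equiv.swap 0 1) 1 = p 0 := by simp
  have e2 : ∀ i : Fin k, (p ∘ Equiv.swap 0 1) i.succ.succ = p i.succ.succ := congrFun (ht p)
  simp only [twist, Fin.sum_univ_succ (n := k), Fin.succ_zero_eq_one, e0, e1, e2, h]
  simp only [Complex.ofReal_add, add_mul, Complex.exp_add]
  ring

/-! ### Adjoints of twisted tensor multiplication -/

open ContinuousLinearMap (adjoint)

/-- Both factors carry the same phase, which is unitary and drops out of the inner product. -/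
theorem adjoint_twistedTensor_twistedTensor {k : ℕ} (f g : Lp ℂ 2 μ) (F : TensorL2 μ k) :
    adjoint (twistedTensor hs k f) (twistedTensor hs k g F) = (inner ℂ f g : ℂ) • F := by
  refine ext_inner_left ℂ fun G => ?_
  rw [ContinuousLinearMap.adjoint_inner_right, inner_smul_right, ← inner_tensorLeft]
  exact LinearIsometry.inner_map_map (phaseMul _ _ (measurable_twist hs k)) _ _

/-- Totality of the twisted products: moving the phase to the other side reduces the claim to the
totality of elementary tensors. -/
theorem eq_zero_of_inner_twistedTensor {k : ℕ} (G : TensorL2 μ (k + 1))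
    (h : ∀ f F, inner ℂ G (twistedTensor hs k f F) = 0) : G = 0 := by
  have h0 : phaseMul _ (fun p => -twist s k p) (measurable_twist hs k).neg G = 0 := by
    refine eq_zero_of_inner_tensor μ _ fun f => ?_
    rw [tensor_eq_tensorLeft, ← inner_conj_symm,
      ← inner_phaseMul_right _ (measurable_twist hs k)]
    exact (map_eq_zero _).2 (h _ _)
  exact (LinearIsometry.map_eq_iff _).1 (h0.trans (map_zero _).symm)

theorem ext_twistedTensor {E : Type*} [NormedAddCommGroup E] [InnerProductSpace ℂ E]
    [CompleteSpace E] {k : ℕ} (A B : TensorL2 μ (k + 1) →L[ℂ] E)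
    (h : ∀ f F, A (twistedTensor hs k f F) = B (twistedTensor hs k f F)) : A = B := by
  refine sub_eq_zero.1 ((LinearIsometryEquiv.map_eq_zero_iff _).1 (?_ : adjoint (A - B) = 0))
  ext1 x
  refine eq_zero_of_inner_twistedTensor hs _ fun f F => ?_
  rw [ContinuousLinearMap.adjoint_inner_left, sub_apply, h, sub_self,
    inner_zero_right]

theorem adjoint_twistedTensor_permute {k : ℕ} (σ : Equiv.Perm (Fin k)) (f : Lp ℂ 2 μ)
    (G : TensorL2 μ (k + 1)) :
    adjoint (twistedTensor hs k f) (permute μ (liftPerm σ) G) =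
      permute μ σ (adjoint (twistedTensor hs k f) G) := by
  refine ext_inner_left ℂ fun F => ?_
  rw [ContinuousLinearMap.adjoint_inner_right, ← inv_inv (liftPerm σ), ← inner_permute_left,
    liftPerm_inv, permute_twistedTensor, ← ContinuousLinearMap.adjoint_inner_right,
    inner_permute_left, inv_inv]

theorem adjoint_twistedTensor_mem_bosons {k : ℕ} (f : Lp ℂ 2 μ) {G : TensorL2 μ (k + 1)}
    (hG : G ∈ bosons μ (k + 1)) : adjoint (twistedTensor hs k f) G ∈ bosons μ k := fun σ => by
  rw [← adjoint_twistedTensor_permute, hG]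

/-- After the swap the particle removed by `f` is the old particle `0` of `F`, not the new one. On a
twisted product `u ⊗ G` the exchange relation brings `u` to the front, where removal by `f` gives
the scalar `⟨f, u⟩`; totality extends this to all `F`. -/
theorem adjoint_twistedTensor_permute_zero_one {s' : α → α → ℝ}
    (hs' : Measurable (Function.uncurry s')) (h : ∀ p q, s' p q = s q p) {k : ℕ}
    (f g : Lp ℂ 2 μ) (F : TensorL2 μ (k + 1)) :
    adjoint (twistedTensor hs (k + 1) f)
        (permute μ (Equiv.swap 0 1) (twistedTensor hs' (k + 1) g F)) =
      twistedTensor hs' k g (adjoint (twistedTensor hs k f) F) := by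
  have := ext_twistedTensor hs
    (adjoint (twistedTensor hs (k + 1) f) ∘L
      (permute μ (Equiv.swap 0 1)).toContinuousLinearMap ∘L twistedTensor hs' (k + 1) g)
    (twistedTensor hs' k g ∘L adjoint (twistedTensor hs k f)) fun u G => by
      simp only [ContinuousLinearMap.comp_apply, LinearIsometry.coe_toContinuousLinearMap]
      rw [permute_twistedTensor_twistedTensor hs' hs (fun p q => (h q p).symm),
        adjoint_twistedTensor_twistedTensor, adjoint_twistedTensor_twistedTensor, map_smul]
  exact DFunLike.congr_fun this F

theorem adjoint_twistedTensor_swap {s' : α → α → ℝ}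
    (hs' : Measurable (Function.uncurry s')) (h : ∀ p q, s' p q = s q p) {k : ℕ}
    (f g : Lp ℂ 2 μ) {F : TensorL2 μ (k + 1)} (hF : F ∈ bosons μ (k + 1)) (j : Fin (k + 1)) :
    adjoint (twistedTensor hs (k + 1) f)
        (permute μ (Equiv.swap 0 j.succ) (twistedTensor hs' (k + 1) g F)) =
      permute μ (Equiv.swap 0 j) (twistedTensor hs' k g (adjoint (twistedTensor hs k f) F)) := by
  -- The transposition is conjugate to `(0 1)` by a permutation fixing `0`. The right factor is
  -- absorbed by the symmetric `F`, the left one passes through the adjoint.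
  have hσ : (Equiv.swap 0 j.succ : Equiv.Perm (Fin (k + 2))) =
      liftPerm (Equiv.swap 0 j) * Equiv.swap 0 1 * liftPerm (Equiv.swap 0 j) := by
    have h1 := Equiv.mul_swap_eq_swap_mul (liftPerm (Equiv.swap 0 j)) 0 1
    have h2 : liftPerm (Equiv.swap 0 j) * liftPerm (Equiv.swap 0 j) = 1 := by
      rw [mul_eq_one_iff_eq_inv, liftPerm_inv, Equiv.swap_inv]
    rw [h1, liftPerm_zero, ← Fin.succ_zero_eq_one, liftPerm_succ, Equiv.swap_apply_left, mul_assoc,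
      h2, mul_one]
  rw [hσ, ← permute_permute, ← permute_permute, permute_twistedTensor, hF,
    adjoint_twistedTensor_permute, adjoint_twistedTensor_permute_zero_one hs hs' h]

/-! ### The projection onto symmetric functions -/

theorem orthogonalProjectionOnto_permute {k : ℕ} (σ : Equiv.Perm (Fin k)) (F : TensorL2 μ k) :
    (bosons μ k).orthogonalProjectionOnto (permute μ σ F) =
      (bosons μ k).orthogonalProjectionOnto F := by
  refine ext_inner_left ℂ fun B => ?_
  rw [Submodule.inner_orthogonalProjectionOnto_eq_of_mem_left,
    Submodule.inner_orthogonalProjectionOnto_eq_of_mem_left, ← inv_inv σ, ← inner_permute_left,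
    B.2]

/-- The transpositions `(0 j)` represent the cosets of the stabiliser of `0`. For a function already
symmetric in the last `k` variables the average over these `k + 1` elements is therefore the full
symmetrisation. -/
theorem sum_swap_eq_orthogonalProjectionOnto {k : ℕ} (F : TensorL2 μ (k + 1))
    (hF : ∀ σ : Equiv.Perm (Fin k), permute μ (liftPerm σ) F = F) :
    ∑ j, permute μ (Equiv.swap 0 j) F =
      ((k : ℂ) + 1) • ((bosons μ (k + 1)).orthogonalProjectionOnto F : TensorL2 μ (k + 1)) := by
  have hmem : ∑ j, permute μ (Equiv.swap 0 j) F ∈ bosons μ (k + 1) := by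
    intro σ
    rw [map_sum]
    refine Fintype.sum_equiv σ _ _ fun j => ?_
    -- Left multiplication by `σ` carries the coset of `(0 j)` to that of `(0 σ(j))`; the error `τ`
    -- fixes `0` and does not change `F`.
    obtain ⟨τ, hτ⟩ := exists_liftPerm (Equiv.swap 0 (σ j) * σ * Equiv.swap 0 j) (by simp)
    have : σ * Equiv.swap 0 j = Equiv.swap 0 (σ j) * liftPerm τ := by
      rw [← hτ, ← mul_assoc, ← mul_assoc, Equiv.swap_mul_self, one_mul]
    rw [permute_permute, this, ← permute_permute, hF]
  -- The sum is symmetric, hence equal to its own projection, and each of its `k + 1` terms has the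
  -- same projection as `F`.
  rw [← Submodule.starProjection_eq_self_iff.2 hmem, Submodule.starProjection_apply, map_sum]
  simp [orthogonalProjectionOnto_permute, ← Nat.cast_smul_eq_nsmul ℂ]

/-- The inner symmetrisation is redundant, because the adjoint of the twisted product maps symmetric
functions to symmetric functions. -/
theorem orthogonalProjectionOnto_twistedTensor {k : ℕ} (f : Lp ℂ 2 μ) (F : TensorL2 μ k) :
    (bosons μ (k + 1)).orthogonalProjectionOnto
        (twistedTensor hs k f ((bosons μ k).orthogonalProjectionOnto F : TensorL2 μ k)) =
      (bosons μ (k + 1)).orthogonalProjectionOnto (twistedTensor hs k f F) := by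
  refine ext_inner_left ℂ fun B => ?_
  have h := adjoint_twistedTensor_mem_bosons hs f B.2
  rw [Submodule.inner_orthogonalProjectionOnto_eq_of_mem_left,
    Submodule.inner_orthogonalProjectionOnto_eq_of_mem_left,
    ← ContinuousLinearMap.adjoint_inner_left, ← ContinuousLinearMap.adjoint_inner_left]
  have := Submodule.inner_orthogonalProjectionOnto_eq_of_mem_left
    (⟨_, h⟩ : bosons μ k) F
  rw [← this]; rfl

/-! ### Twisted creation operators between boson spaces -/

/-- The twisted creation operator `Ψ ↦ √(k+1) Sym (e^{i ∑ⱼ s(p₀, pⱼ)} f ⊗ Ψ)`. -/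
def twistedPart {s : α → α → ℝ} (hs : Measurable (Function.uncurry s)) (k : ℕ) (f : Lp ℂ 2 μ) :
    bosons μ k →L[ℂ] bosons μ (k + 1) :=
  (Real.sqrt (k + 1) : ℂ) •
    ((bosons μ (k + 1)).orthogonalProjectionOnto ∘L twistedTensor hs k f ∘L (bosons μ k).subtypeL)

theorem twistedPart_apply {k : ℕ} (f : Lp ℂ 2 μ) (F : bosons μ k) :
    twistedPart hs k f F = (Real.sqrt (k + 1) : ℂ) •
      (bosons μ (k + 1)).orthogonalProjectionOnto (twistedTensor hs k f F) := rfl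

/-- Removing a particle preserves symmetry, so no projection survives in the adjoint. -/
theorem coe_adjoint_twistedPart {k : ℕ} (f : Lp ℂ 2 μ) (F : bosons μ (k + 1)) :
    (adjoint (twistedPart hs k f) F : TensorL2 μ k) =
      (Real.sqrt (k + 1) : ℂ) • adjoint (twistedTensor hs k f) F := by
  have h := adjoint_twistedTensor_mem_bosons hs f F.2
  have : adjoint (twistedPart hs k f) F = (Real.sqrt (k + 1) : ℂ) • (⟨_, h⟩ : bosons μ k) := by
    refine ext_inner_left ℂ fun B => ?_
    rw [ContinuousLinearMap.adjoint_inner_right, twistedPart_apply]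
    change inner ℂ ((Real.sqrt (k + 1) : ℂ) • ((bosons μ (k + 1)).orthogonalProjectionOnto
      (twistedTensor hs k f B) : TensorL2 μ (k + 1))) (F : TensorL2 μ (k + 1)) =
      inner ℂ (B : TensorL2 μ k) ((Real.sqrt (k + 1) : ℂ) • adjoint (twistedTensor hs k f) F)
    rw [inner_smul_left, inner_smul_right, Complex.conj_ofReal,
      ContinuousLinearMap.adjoint_inner_right, ← Submodule.coe_inner,
      Submodule.inner_orthogonalProjectionOnto_eq_of_mem_right]
  rw [this]; rfl

theorem sqrt_mul_sqrt_succ (k : ℕ) :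
    (Real.sqrt (k + 1) : ℂ) * (Real.sqrt (k + 1) : ℂ) = (k : ℂ) + 1 := by
  rw [← Complex.ofReal_mul, Real.mul_self_sqrt (by positivity)]
  push_cast; rfl

/-- Once the inner projections are dropped, the two orders differ by the transposition `(0 1)`,
which the outer projection does not see. -/
theorem twistedPart_comm {s' : α → α → ℝ} (hs' : Measurable (Function.uncurry s'))
    (h : ∀ p q, s' p q = s q p) {k : ℕ} (f g : Lp ℂ 2 μ) (F : bosons μ k) :
    twistedPart hs (k + 1) f (twistedPart hs' k g F) =
      twistedPart hs' (k + 1) g (twistedPart hs k f F) := by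
  simp only [twistedPart_apply, map_smul, orthogonalProjectionOnto_twistedTensor]
  rw [← permute_twistedTensor_twistedTensor hs hs' h, orthogonalProjectionOnto_permute]

theorem adjoint_twistedPart_comm {s' : α → α → ℝ} (hs' : Measurable (Function.uncurry s'))
    (h : ∀ p q, s' p q = s q p) {k : ℕ} (f g : Lp ℂ 2 μ) (F : bosons μ (k + 2)) :
    adjoint (twistedPart hs k f) (adjoint (twistedPart hs' (k + 1) g) F) =
      adjoint (twistedPart hs' k g) (adjoint (twistedPart hs (k + 1) f) F) := by
  refine ext_inner_left ℂ fun B => ?_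
  simp only [ContinuousLinearMap.adjoint_inner_right]
  rw [twistedPart_comm hs hs' h]

theorem coe_adjoint_twistedPart_twistedPart_zero {s' : α → α → ℝ}
    (hs' : Measurable (Function.uncurry s')) (f g : Lp ℂ 2 μ) (F : bosons μ 0) :
    (adjoint (twistedPart hs 0 f) (twistedPart hs' 0 g F) : TensorL2 μ 0) =
      adjoint (twistedTensor hs 0 f) (twistedTensor hs' 0 g F) := by
  have h := sum_swap_eq_orthogonalProjectionOnto (twistedTensor hs' 0 g (F : TensorL2 μ 0))
    (fun σ => by rw [permute_twistedTensor, F.2])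
  rw [coe_adjoint_twistedPart, twistedPart_apply, Submodule.coe_smul, map_smul, smul_smul,
    sqrt_mul_sqrt_succ, ← map_smul, ← h]
  simp only [Fin.sum_univ_succ, Finset.univ_eq_empty, Finset.sum_empty, add_zero,
    Equiv.swap_self]
  exact congrArg _ (permute_one _)

/-- Normal ordering. The square roots cancel the normalisation of the sum over transpositions `(0
j)`. Its term `j = 0` is the contraction; the others reassemble, by `adjoint_twistedTensor_swap`,
into the symmetrisation that defines creation after annihilation. -/
theorem coe_adjoint_twistedPart_twistedPart_succ {s' : α → α → ℝ}
    (hs' : Measurable (Function.uncurry s')) (h : ∀ p q, s' p q = s q p) {k : ℕ}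
    (f g : Lp ℂ 2 μ) (F : bosons μ (k + 1)) :
    (adjoint (twistedPart hs (k + 1) f) (twistedPart hs' (k + 1) g F) : TensorL2 μ (k + 1)) =
      adjoint (twistedTensor hs (k + 1) f) (twistedTensor hs' (k + 1) g F) +
        (twistedPart hs' k g (adjoint (twistedPart hs k f) F) : TensorL2 μ (k + 1)) := by
  have h1 := sum_swap_eq_orthogonalProjectionOnto
    (twistedTensor hs' (k + 1) g (F : TensorL2 μ (k + 1)))
    (fun σ => by rw [permute_twistedTensor, F.2])
  have h2 := sum_swap_eq_orthogonalProjectionOnto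
    (twistedTensor hs' k g (adjoint (twistedTensor hs k f) (F : TensorL2 μ (k + 1))))
    (fun σ => by rw [permute_twistedTensor, adjoint_twistedTensor_mem_bosons hs f F.2])
  rw [coe_adjoint_twistedPart, twistedPart_apply, twistedPart_apply, Submodule.coe_smul, map_smul,
    smul_smul, sqrt_mul_sqrt_succ, ← map_smul, ← h1, Fin.sum_univ_succ, map_add, map_sum,
    coe_adjoint_twistedPart, map_smul, map_smul, Submodule.coe_smul, Submodule.coe_smul, smul_smul,
    sqrt_mul_sqrt_succ, ← h2, Equiv.swap_self]
  refine congrArg₂ _ ?_ ?_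
  · exact congrArg _ (permute_one _)
  · exact Finset.sum_congr rfl fun j _ => adjoint_twistedTensor_swap hs hs' h f g F.2 j

end Algebra


/-! ### Operators changing the particle number by one -/

section Fields

open ContinuousLinearMap (adjoint)

variable {α : Type*} [MeasurableSpace α] {μ : Measure α} [SigmaFinite μ]

/-- The components of the operator with matrix elements `c k` from `k` to `k + 1` bosons. -/
def raiseComponent (c : ∀ k, bosons μ k →L[ℂ] bosons μ (k + 1)) (Ψ : Fock μ) :
    ∀ k : ℕ, bosons μ k
  | 0 => 0
  | k + 1 => c k (Ψ k)

/-- The operator with matrix elements `c k` from `k` to `k + 1` bosons. -/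
def raiseOp (c : ∀ k, bosons μ k →L[ℂ] bosons μ (k + 1)) :
    finiteParticle μ →ₗ[ℂ] finiteParticle μ where
  toFun Ψ := ofComponents μ (raiseComponent c Ψ) (by
    obtain ⟨N, hN⟩ := Ψ.2
    refine ⟨N + 1, fun k hk => ?_⟩
    obtain ⟨k, rfl⟩ : ∃ j, k = j + 1 := ⟨k - 1, by omega⟩
    change c k _ = 0
    rw [hN k (by omega), map_zero])
  map_add' Ψ Φ := by
    ext1; ext1; funext k
    cases k with
    | zero => exact (add_zero _).symm
    | succ k => exact map_add (c k) _ _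
  map_smul' a Ψ := by
    ext1; ext1; funext k
    cases k with
    | zero => exact (smul_zero a).symm
    | succ k => exact map_smul (c k) _ _

/-- The operator with matrix elements `(c k)*` from `k + 1` to `k` bosons. -/
def lowerOp (c : ∀ k, bosons μ k →L[ℂ] bosons μ (k + 1)) :
    finiteParticle μ →ₗ[ℂ] finiteParticle μ where
  toFun Ψ := ofComponents μ (fun k => adjoint (c k) ((Ψ : Fock μ) (k + 1))) (by
      obtain ⟨N, hN⟩ := Ψ.2
      exact ⟨N, fun k hk => by rw [hN (k + 1) (by omega), map_zero]⟩)
  map_add' Ψ Φ := by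
    ext1; ext1; funext k
    exact map_add (adjoint (c k)) _ _
  map_smul' a Ψ := by
    ext1; ext1; funext k
    exact map_smul (adjoint (c k)) _ _

theorem finiteParticle_ext {Ψ Φ : finiteParticle μ} (h : ∀ k, (Ψ : Fock μ) k = (Φ : Fock μ) k) :
    Ψ = Φ := by
  ext1; ext1; funext k; exact h k

section
variable (c : ∀ k, bosons μ k →L[ℂ] bosons μ (k + 1)) (Ψ : finiteParticle μ) (k : ℕ)

theorem raiseOp_zero : (raiseOp c Ψ : Fock μ) 0 = 0 := rfl

theorem raiseOp_succ : (raiseOp c Ψ : Fock μ) (k + 1) = c k ((Ψ : Fock μ) k) := rfl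

theorem lowerOp_apply : (lowerOp c Ψ : Fock μ) k = adjoint (c k) ((Ψ : Fock μ) (k + 1)) := rfl

end

theorem inner_raiseOp (c : ∀ k, bosons μ k →L[ℂ] bosons μ (k + 1)) (Ψ Φ : finiteParticle μ) :
    inner ℂ (raiseOp c Ψ : Fock μ) (Φ : Fock μ) = inner ℂ (Ψ : Fock μ) (lowerOp c Φ : Fock μ) := by
  have h := lp.hasSum_inner (𝕜 := ℂ) (raiseOp c Ψ : Fock μ) (Φ : Fock μ)
  have h' := lp.hasSum_inner (𝕜 := ℂ) (Ψ : Fock μ) (lowerOp c Φ : Fock μ)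
  have h0 : inner ℂ ((raiseOp c Ψ : Fock μ) 0) ((Φ : Fock μ) 0) = 0 := inner_zero_left _
  have hk : ∀ k, inner ℂ ((raiseOp c Ψ : Fock μ) (k + 1)) ((Φ : Fock μ) (k + 1)) =
      inner ℂ ((Ψ : Fock μ) k) ((lowerOp c Φ : Fock μ) k) := fun k =>
    (ContinuousLinearMap.adjoint_inner_right (c k) _ _).symm
  -- The raised vector has no vacuum component, so its series may start at `1`, where it matches the
  -- other series shifted by one.
  rw [← hasSum_nat_add_iff' 1] at h
  simp only [Finset.range_one, Finset.sum_singleton, h0, sub_zero, hk] at h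
  exact h.unique h'

theorem inner_lowerOp (c : ∀ k, bosons μ k →L[ℂ] bosons μ (k + 1)) (Ψ Φ : finiteParticle μ) :
    inner ℂ (lowerOp c Ψ : Fock μ) (Φ : Fock μ) = inner ℂ (Ψ : Fock μ) (raiseOp c Φ : Fock μ) := by
  rw [← inner_conj_symm, ← inner_raiseOp, inner_conj_symm]

theorem creation_eq (f : Lp ℂ 2 μ) : creation μ f = raiseOp fun k => creationPart μ k f := by
  ext1 Ψ
  refine finiteParticle_ext fun k => ?_
  cases k <;> rfl

theorem annihilation_eq (f : Lp ℂ 2 μ) :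
    annihilation μ f = lowerOp fun k => creationPart μ k f := rfl

/-! ### Twisted field operators -/

/-- The twisted field operator `a_s(g) + a_s*(f)`. -/
def twistedField {s : α → α → ℝ} (hs : Measurable (Function.uncurry s)) (g f : Lp ℂ 2 μ) :
    finiteParticle μ →ₗ[ℂ] finiteParticle μ :=
  lowerOp (fun k => twistedPart hs k g) + raiseOp fun k => twistedPart hs k f

variable {s : α → α → ℝ} (hs : Measurable (Function.uncurry s))

theorem inner_twistedField (g f : Lp ℂ 2 μ) (Ψ Φ : finiteParticle μ) :
    inner ℂ (twistedField hs g f Ψ : Fock μ) (Φ : Fock μ) =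
      inner ℂ (Ψ : Fock μ) (twistedField hs f g Φ : Fock μ) := by
  simp only [twistedField, LinearMap.add_apply, Submodule.coe_add, inner_add_left, inner_add_right,
    inner_raiseOp, inner_lowerOp]
  rw [add_comm]

theorem raiseOp_comm {c d : ∀ k, bosons μ k →L[ℂ] bosons μ (k + 1)}
    (h : ∀ k F, c (k + 1) (d k F) = d (k + 1) (c k F)) (Ψ : finiteParticle μ) :
    raiseOp c (raiseOp d Ψ) = raiseOp d (raiseOp c Ψ) := by
  refine finiteParticle_ext fun k => ?_
  match k with
  | 0 => rfl
  | 1 => exact (map_zero (c 0)).trans (map_zero (d 0)).symm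
  | k + 2 => exact h k ((Ψ : Fock μ) k)

theorem lowerOp_comm {c d : ∀ k, bosons μ k →L[ℂ] bosons μ (k + 1)}
    (h : ∀ k F, adjoint (c k) (adjoint (d (k + 1)) F) = adjoint (d k) (adjoint (c (k + 1)) F))
    (Ψ : finiteParticle μ) :
    lowerOp c (lowerOp d Ψ) = lowerOp d (lowerOp c Ψ) :=
  finiteParticle_ext fun k => h k ((Ψ : Fock μ) (k + 2))

theorem lowerOp_raiseOp_comm {a b c d : ∀ k, bosons μ k →L[ℂ] bosons μ (k + 1)}
    (h0 : ∀ F, adjoint (a 0) (d 0 F) = adjoint (c 0) (b 0 F))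
    (h : ∀ k F, adjoint (a (k + 1)) (d (k + 1) F) + b k (adjoint (c k) F) =
      adjoint (c (k + 1)) (b (k + 1) F) + d k (adjoint (a k) F)) (Ψ : finiteParticle μ) :
    lowerOp a (raiseOp d Ψ) + raiseOp b (lowerOp c Ψ) =
      lowerOp c (raiseOp b Ψ) + raiseOp d (lowerOp a Ψ) := by
  refine finiteParticle_ext fun k => ?_
  cases k with
  | zero => exact congrArg₂ (· + ·) (h0 ((Ψ : Fock μ) 0)) rfl
  | succ k => exact h k ((Ψ : Fock μ) (k + 1))

theorem add_comm_of_comm {M : Type*} [AddCommGroup M] [Module ℂ M] {a b c d : M →ₗ[ℂ] M} {x : M}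
    (hac : a (c x) = c (a x)) (hbd : b (d x) = d (b x))
    (h : a (d x) + b (c x) = c (b x) + d (a x)) : (a + b) ((c + d) x) = (c + d) ((a + b) x) := by
  simp only [LinearMap.add_apply, map_add, hac, hbd]
  calc c (a x) + b (c x) + (a (d x) + d (b x))
      = c (a x) + (a (d x) + b (c x)) + d (b x) := by abel
    _ = _ := by rw [h]; abel

/-- Normal ordering both products leaves the same creation-annihilation terms on either side, by the
exchange relation. What remains is the pair of contractions, whose equality is the hypothesis
`hmix`. -/
theorem twistedField_comm {s' : α → α → ℝ} (hs' : Measurable (Function.uncurry s'))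
    (h : ∀ p q, s' p q = s q p) (g f g' f' : Lp ℂ 2 μ)
    (hmix : ∀ k (F : TensorL2 μ k),
      adjoint (twistedTensor hs k g) (twistedTensor hs' k f' F) =
        adjoint (twistedTensor hs' k g') (twistedTensor hs k f F)) (Ψ : finiteParticle μ) :
    twistedField hs g f (twistedField hs' g' f' Ψ) =
      twistedField hs' g' f' (twistedField hs g f Ψ) := by
  have h1 := lowerOp_comm (c := fun k => twistedPart hs k g) (d := fun k => twistedPart hs' k g')
    (fun k F => adjoint_twistedPart_comm hs hs' h g g' F) Ψ
  have h2 := raiseOp_comm (c := fun k => twistedPart hs k f) (d := fun k => twistedPart hs' k f')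
    (fun k F => twistedPart_comm hs hs' h f f' F) Ψ
  refine add_comm_of_comm h1 h2 (lowerOp_raiseOp_comm (a := fun k => twistedPart hs k g)
    (b := fun k => twistedPart hs k f) (c := fun k => twistedPart hs' k g')
    (d := fun k => twistedPart hs' k f') (fun F => Subtype.ext ?_) (fun k F => Subtype.ext ?_) Ψ)
  · rw [coe_adjoint_twistedPart_twistedPart_zero, coe_adjoint_twistedPart_twistedPart_zero, hmix]
  · rw [Submodule.coe_add, Submodule.coe_add,
      coe_adjoint_twistedPart_twistedPart_succ hs hs' h,
      coe_adjoint_twistedPart_twistedPart_succ hs' hs fun p q => (h q p).symm, hmix]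
    abel

theorem integrable_inner_Lp {β : Type*} [MeasurableSpace β] {ν : Measure β} (F G : Lp ℂ 2 ν) :
    Integrable (fun p => inner ℂ (F p) (G p)) ν :=
  L2.integrable_inner F G

/-- Integrating out particle `0` shows that the contraction is a multiplication operator in the
remaining momenta `q`. This reduces `hmix` to a scalar identity for each `q`. -/
theorem inner_twistedTensor {s' : α → α → ℝ} (hs' : Measurable (Function.uncurry s')) {k : ℕ}
    (g f : Lp ℂ 2 μ) (F G : TensorL2 μ k) :
    inner ℂ (twistedTensor hs k g F) (twistedTensor hs' k f G) =
      ∫ q, (∫ p, conj (g p) * f p *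
        Complex.exp (Complex.I * (∑ j, s' p (q j) - ∑ j, s p (q j) : ℝ)) ∂μ) *
          inner ℂ (F q) (G q) ∂(Measure.pi fun _ : Fin k => μ) := by
  set ν := Measure.pi fun _ : Fin k => μ
  let D : α × (Fin k → α) → ℝ := fun z => ∑ j, s' z.1 (z.2 j) - ∑ j, s z.1 (z.2 j)
  have hD : Measurable D := by
    have : ∀ {t : α → α → ℝ}, Measurable (Function.uncurry t) →
        Measurable fun z : α × (Fin k → α) => ∑ j, t z.1 (z.2 j) := fun {t} ht =>
      Finset.measurable_fun_sum _ fun j _ =>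
        Measurable.comp (f := fun z : α × (Fin k → α) => (z.1, z.2 j)) ht
          (measurable_fst.prodMk ((measurable_pi_apply j).comp measurable_snd))
    exact (this hs').sub (this hs)
  let H : α × (Fin k → α) → ℂ := fun z =>
    conj (g z.1) * f z.1 * Complex.exp (Complex.I * (D z : ℝ)) * inner ℂ (F z.2) (G z.2)
  have hH : Integrable H (μ.prod ν) := by
    have h1 := (integrable_inner_Lp g f).mul_prod (integrable_inner_Lp F G)
    refine (h1.bdd_mul (f := fun z => Complex.exp (Complex.I * (D z : ℝ))) (c := 1) ?_ ?_).congr ?_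
    · exact (by fun_prop : Measurable fun z => Complex.exp (Complex.I * (D z : ℝ)))
        |>.aestronglyMeasurable
    · exact Eventually.of_forall fun z => by
        rw [mul_comm, Complex.norm_exp_ofReal_mul_I]
    · exact Eventually.of_forall fun z => by
        simp only [H, RCLike.inner_apply]; ring
  have h2 : inner ℂ (twistedTensor hs k g F) (twistedTensor hs' k f G) =
      ∫ z, H z ∂(μ.prod ν) := by
    rw [L2.inner_def, ← (measurePreserving_piFinSuccAbove
      (fun _ : Fin (k + 1) => μ) 0).integral_comp' (g := H)]
    apply integral_congr_ae
    filter_upwards [coeFn_twistedTensor hs g F, coeFn_twistedTensor hs' f G] with p h1 h2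
    have e : MeasurableEquiv.piFinSuccAbove (fun _ : Fin (k + 1) => α) 0 p =
      (p 0, fun i => p i.succ) := rfl
    rw [h1, h2, e]
    have e2 : Complex.exp (Complex.I *
        (∑ j : Fin k, s' (p 0) (p j.succ) - ∑ j : Fin k, s (p 0) (p j.succ) : ℝ)) =
        Complex.exp (twist s' k p * Complex.I) * conj (Complex.exp (twist s k p * Complex.I)) := by
      rw [← Complex.exp_conj, ← Complex.exp_add]
      congr 1
      simp only [twist, map_mul, Complex.conj_ofReal, Complex.conj_I, Complex.ofReal_sub]
      ring
    simp only [H, D, RCLike.inner_apply, map_mul, e2]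
    ring
  rw [h2, integral_prod_symm _ hH]
  refine integral_congr_ae (Eventually.of_forall fun q => ?_)
  simp only [H, D]
  rw [integral_mul_const]

theorem adjoint_twistedTensor_mixed {s' : α → α → ℝ} (hs' : Measurable (Function.uncurry s'))
    (g f g' f' : Lp ℂ 2 μ) (k : ℕ)
    (hmix : ∀ q : Fin k → α,
      ∫ p, conj (g p) * f' p *
        Complex.exp (Complex.I * (∑ j, s' p (q j) - ∑ j, s p (q j) : ℝ)) ∂μ =
      ∫ p, conj (g' p) * f p *
        Complex.exp (Complex.I * (∑ j, s p (q j) - ∑ j, s' p (q j) : ℝ)) ∂μ)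
    (F : TensorL2 μ k) :
    adjoint (twistedTensor hs k g) (twistedTensor hs' k f' F) =
      adjoint (twistedTensor hs' k g') (twistedTensor hs k f F) := by
  refine ext_inner_left ℂ fun G => ?_
  rw [ContinuousLinearMap.adjoint_inner_right, ContinuousLinearMap.adjoint_inner_right,
    inner_twistedTensor, inner_twistedTensor]
  simp only [hmix]

/-! ### Second quantization -/

theorem ext_tensor {E : Type*} [NormedAddCommGroup E] [InnerProductSpace ℂ E]
    [CompleteSpace E] {k : ℕ} (A B : TensorL2 μ k →L[ℂ] E)
    (h : ∀ f, A (tensor μ f) = B (tensor μ f)) : A = B := by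
  refine sub_eq_zero.1 ((LinearIsometryEquiv.map_eq_zero_iff _).1 (?_ : adjoint (A - B) = 0))
  ext1 x
  refine eq_zero_of_inner_tensor μ _ fun f => ?_
  rw [ContinuousLinearMap.adjoint_inner_right, sub_apply, h, sub_self, inner_zero_left]

variable (V : Lp ℂ 2 μ ≃ₗᵢ[ℂ] Lp ℂ 2 μ)

theorem tensorPower_symm_apply_apply (k : ℕ) (F : TensorL2 μ k) :
    tensorPower μ V.symm k (tensorPower μ V k F) = F := by
  have := ext_tensor
    ((tensorPower μ V.symm k).toLinearIsometry.toContinuousLinearMap ∘L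
      (tensorPower μ V k).toLinearIsometry.toContinuousLinearMap)
    (ContinuousLinearMap.id ℂ _) fun f => by
      simp [tensorPower_tensor]
  exact DFunLike.congr_fun this F

theorem tensorPower_tensorLeft (k : ℕ) (f : Lp ℂ 2 μ) (F : TensorL2 μ k) :
    tensorPower μ V (k + 1) (tensorLeft μ k f F) =
      tensorLeft μ k (V f) (tensorPower μ V k F) := by
  have := ext_tensor
    ((tensorPower μ V (k + 1)).toLinearIsometry.toContinuousLinearMap ∘L tensorLeft μ k f)
    (tensorLeft μ k (V f) ∘L (tensorPower μ V k).toLinearIsometry.toContinuousLinearMap)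
    fun u => by
      have h := tensor_eq_tensorLeft (μ := μ) (Fin.cons f u : Fin (k + 1) → Lp ℂ 2 μ)
      have h' := tensor_eq_tensorLeft (μ := μ)
        (Fin.cons (V f) fun i => V (u i) : Fin (k + 1) → Lp ℂ 2 μ)
      simp only [Fin.cons_zero, Fin.cons_succ] at h h'
      simp only [ContinuousLinearMap.comp_apply, LinearIsometry.coe_toContinuousLinearMap,
        LinearIsometryEquiv.coe_toLinearIsometry]
      rw [← h, tensorPower_tensor, tensorPower_tensor, ← h']
      congr 1
      funext i
      refine Fin.cases ?_ (fun i => ?_) i <;> simp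
  exact DFunLike.congr_fun this F

/-- An isometry that preserves the symmetric functions, together with its adjoint, commutes with
the projection onto the symmetric functions. -/
theorem restrictBosons_orthogonalProjectionOnto {k : ℕ} (T T' : TensorL2 μ k →ₗᵢ[ℂ] TensorL2 μ k)
    (hT : ∀ F ∈ bosons μ k, T F ∈ bosons μ k) (hT' : ∀ F ∈ bosons μ k, T' F ∈ bosons μ k)
    (h : ∀ F G, inner ℂ F (T G) = inner ℂ (T' F) G) (F : TensorL2 μ k) :
    restrictBosons T hT ((bosons μ k).orthogonalProjectionOnto F) =
      (bosons μ k).orthogonalProjectionOnto (T F) := by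
  refine ext_inner_left ℂ fun B => ?_
  rw [Submodule.inner_orthogonalProjectionOnto_eq_of_mem_left, h, Submodule.coe_inner]
  change inner ℂ (B : TensorL2 μ k) (T _) = _
  rw [h]
  exact Submodule.inner_orthogonalProjectionOnto_eq_of_mem_left (⟨_, hT' _ B.2⟩ : bosons μ k) F

theorem inner_tensorPower_right {k : ℕ} (F G : TensorL2 μ k) :
    inner ℂ F (tensorPower μ V k G) = inner ℂ (tensorPower μ V.symm k F) G := by
  rw [← LinearIsometryEquiv.inner_map_map (tensorPower μ V k) (tensorPower μ V.symm k F) G]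
  congr 1
  exact (tensorPower_symm_apply_apply V.symm k F).symm

/-- The second quantization of a unitary on the `k`-boson space. -/
def bosonPower (k : ℕ) : bosons μ k →ₗᵢ[ℂ] bosons μ k :=
  restrictBosons (tensorPower μ V k).toLinearIsometry (tensorPower_mem_bosons μ V k)

theorem bosonPower_symm_apply_apply (k : ℕ) (F : bosons μ k) :
    bosonPower V.symm k (bosonPower V k F) = F :=
  Subtype.ext (tensorPower_symm_apply_apply V k F)

theorem inner_bosonPower_right {k : ℕ} (F G : bosons μ k) :
    inner ℂ F (bosonPower V k G) = inner ℂ (bosonPower V.symm k F) G :=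
  inner_tensorPower_right V (F : TensorL2 μ k) G

/-- The covariance `Γ(V) a*(f) = a*(Vf) Γ(V)`: the tensor power acts factorwise on `f ⊗ F` and
commutes with symmetrisation. -/
theorem bosonPower_creationPart (k : ℕ) (f : Lp ℂ 2 μ) (F : bosons μ k) :
    bosonPower V (k + 1) (creationPart μ k f F) = creationPart μ k (V f) (bosonPower V k F) := by
  have := restrictBosons_orthogonalProjectionOnto (tensorPower μ V (k + 1)).toLinearIsometry
    (tensorPower μ V.symm (k + 1)).toLinearIsometry (tensorPower_mem_bosons μ V (k + 1))
    (tensorPower_mem_bosons μ V.symm (k + 1)) (inner_tensorPower_right V) (tensorLeft μ k f F)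
  change bosonPower V (k + 1) ((Real.sqrt (k + 1) : ℂ) •
    (bosons μ (k + 1)).orthogonalProjectionOnto (tensorLeft μ k f F)) =
    (Real.sqrt (k + 1) : ℂ) • (bosons μ (k + 1)).orthogonalProjectionOnto
      (tensorLeft μ k (V f) (tensorPower μ V k F))
  rw [map_smul, ← tensorPower_tensorLeft]
  exact congrArg _ this

theorem bosonPower_adjoint_creationPart (k : ℕ) (f : Lp ℂ 2 μ) (F : bosons μ (k + 1)) :
    bosonPower V k (adjoint (creationPart μ k f) F) =
      adjoint (creationPart μ k (V f)) (bosonPower V (k + 1) F) := by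
  refine ext_inner_left ℂ fun B => ?_
  have := bosonPower_creationPart V.symm k (V f) B
  rw [LinearIsometryEquiv.symm_apply_apply] at this
  rw [inner_bosonPower_right, ContinuousLinearMap.adjoint_inner_right,
    ContinuousLinearMap.adjoint_inner_right, inner_bosonPower_right, this]

/-- Second quantization on finite particle vectors. -/
def secondQuantFinite : finiteParticle μ →ₗ[ℂ] finiteParticle μ :=
  (secondQuant V).toLinearMap.restrict (diagonal_mem _)

theorem coe_secondQuantFinite (Ψ : finiteParticle μ) :
    (secondQuantFinite V Ψ : Fock μ) = secondQuant V (Ψ : Fock μ) := rfl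

theorem secondQuantFinite_symm_apply_apply (Ψ : finiteParticle μ) :
    secondQuantFinite V.symm (secondQuantFinite V Ψ) = Ψ :=
  finiteParticle_ext fun k => bosonPower_symm_apply_apply V k _

theorem secondQuantFinite_apply_symm_apply (Ψ : finiteParticle μ) :
    secondQuantFinite V (secondQuantFinite V.symm Ψ) = Ψ :=
  secondQuantFinite_symm_apply_apply V.symm Ψ

theorem secondQuantFinite_raiseOp (f : Lp ℂ 2 μ) (Ψ : finiteParticle μ) :
    secondQuantFinite V (raiseOp (fun k => creationPart μ k f) Ψ) =
      raiseOp (fun k => creationPart μ k (V f)) (secondQuantFinite V Ψ) :=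
  finiteParticle_ext fun k => by
    cases k with
    | zero => exact map_zero _
    | succ k => exact bosonPower_creationPart V k f _

theorem secondQuantFinite_lowerOp (f : Lp ℂ 2 μ) (Ψ : finiteParticle μ) :
    secondQuantFinite V (lowerOp (fun k => creationPart μ k f) Ψ) =
      lowerOp (fun k => creationPart μ k (V f)) (secondQuantFinite V Ψ) :=
  finiteParticle_ext fun k => bosonPower_adjoint_creationPart V k f _

theorem inner_secondQuantFinite (Ψ Φ : finiteParticle μ) :
    inner ℂ (secondQuantFinite V.symm Ψ : Fock μ) (Φ : Fock μ) =
      inner ℂ (Ψ : Fock μ) (secondQuantFinite V Φ : Fock μ) := by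
  conv_rhs => rw [← secondQuantFinite_apply_symm_apply V Ψ]
  exact (LinearIsometry.inner_map_map (secondQuant V) _ _).symm

end Fields


/-! ### An oscillatory integral with a Schwartz cutoff -/

section Oscillatory

open scoped FourierTransform

variable {E : Type*} [NormedAddCommGroup E] [InnerProductSpace ℝ E]

/-- The Schwartz function `v ↦ χ(x, v)`. -/
def slice (χ : 𝓢(E × E, ℂ)) (x : E) : 𝓢(E, ℂ) :=
  SchwartzMap.compCLMOfAntilipschitz ℂ (K := 1) (g := fun v => (x, v))
    (by
      have e : (fun v : E => (x, v)) =
          (fun _ => ((x, 0) : E × E)) + ⇑(ContinuousLinearMap.inr ℝ E E) := by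
        funext v; simp
      rw [e]
      exact (Function.HasTemperateGrowth.const ((x, 0) : E × E)).add
        (ContinuousLinearMap.inr ℝ E E).hasTemperateGrowth)
    (AntilipschitzWith.of_le_mul_dist fun v w => by
      rw [NNReal.coe_one, one_mul, Prod.dist_eq]; exact le_max_right _ _) χ

theorem slice_apply (χ : 𝓢(E × E, ℂ)) (x v : E) : slice χ x v = χ (x, v) := rfl

theorem seminorm_slice_le (χ : 𝓢(E × E, ℂ)) (x : E) (k l : ℕ) :
    SchwartzMap.seminorm ℂ k l (slice χ x) ≤ SchwartzMap.seminorm ℂ k l χ := by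
  refine SchwartzMap.seminorm_le_bound ℂ k l _ (apply_nonneg _ _) fun v => ?_
  have h : iteratedFDeriv ℝ l (slice χ x) v =
      (iteratedFDeriv ℝ l χ (x, v)).compContinuousLinearMap
        fun _ => ContinuousLinearMap.inr ℝ E E := by
    have e : (slice χ x : E → ℂ) =
        (fun z => χ (z + (x, 0))) ∘ (ContinuousLinearMap.inr ℝ E E) := by
      funext v; simp [slice_apply]
    have hs : ContDiff ℝ l fun z => χ (z + (x, 0)) :=
      (χ.smooth l).comp (contDiff_id.add contDiff_const)
    rw [e, ContinuousLinearMap.iteratedFDeriv_comp_right _ hs _ le_rfl,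
      iteratedFDeriv_comp_add_right]
    simp
  have h1 : ‖iteratedFDeriv ℝ l (slice χ x) v‖ ≤ ‖iteratedFDeriv ℝ l χ (x, v)‖ := by
    rw [h]
    refine (ContinuousMultilinearMap.norm_compContinuousLinearMap_le _ _).trans ?_
    refine mul_le_of_le_one_right (norm_nonneg _) (Finset.prod_le_one (fun _ _ => norm_nonneg _)
      fun _ _ => ContinuousLinearMap.norm_inr_le_one ℝ E E)
  have h2 : ‖v‖ ≤ ‖(x, v)‖ := le_max_right _ _
  calc ‖v‖ ^ k * ‖iteratedFDeriv ℝ l (slice χ x) v‖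
      ≤ ‖(x, v)‖ ^ k * ‖iteratedFDeriv ℝ l χ (x, v)‖ := by gcongr
    _ ≤ _ := SchwartzMap.le_seminorm ℂ k l χ (x, v)

variable [FiniteDimensional ℝ E] [MeasurableSpace E] [BorelSpace E]

theorem exists_fourier_slice_le (χ : 𝓢(E × E, ℂ)) (N : ℕ) :
    ∃ C, ∀ x w, ‖𝓕 (slice χ x) w‖ ≤ C * (1 + ‖w‖) ^ (-(N : ℝ)) := by
  have hn : ∀ n : ℕ, ∃ C, ∀ x w, ‖w‖ ^ n * ‖𝓕 (slice χ x) w‖ ≤ C := by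
    intro n
    set l := (volume : Measure E).integrablePower
    refine ⟨(2 * Real.pi) ^ 0 * (2 * (0 : ℕ) + 2) ^ n *
      ∑ p ∈ Finset.range (0 + 1) ×ˢ Finset.range (n + 1),
        2 ^ l * (∫ x : E, (1 + ‖x‖) ^ (-(l : ℝ))) *
          (SchwartzMap.seminorm ℂ 0 p.2 χ + SchwartzMap.seminorm ℂ (p.1 + l) p.2 χ),
      fun x w => ?_⟩
    have h := Real.pow_mul_norm_iteratedFDeriv_fourier_le (f := slice χ x) (K := ⊤) (N := ⊤)
      ((slice χ x).smooth ⊤)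
      (fun k n _ _ => SchwartzMap.integrable_pow_mul_iteratedFDeriv volume (slice χ x) k n)
      (k := 0) (n := n) le_top le_top w
    rw [norm_iteratedFDeriv_zero] at h
    rw [SchwartzMap.fourier_coe]
    refine h.trans ?_
    gcongr with p hp
    refine (SchwartzMap.integral_pow_mul_iteratedFDeriv_le ℂ volume (slice χ x) p.1 p.2).trans ?_
    gcongr <;> exact seminorm_slice_le _ _ _ _
  obtain ⟨C₀, h0⟩ := hn 0
  obtain ⟨C₁, h1⟩ := hn N
  -- The factor comes from `(1 + t)^N ≤ 2^(N-1) (1 + t^N)`, with `C₀` and `C₁` the bounds for the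
  -- powers `0` and `N`.
  refine ⟨2 ^ (N - 1) * (C₀ + C₁), fun x w => ?_⟩
  rw [Real.rpow_neg (by positivity), Real.rpow_natCast, ← div_eq_mul_inv,
    le_div_iff₀ (by positivity), mul_comm]
  calc (1 + ‖w‖) ^ N * ‖𝓕 (slice χ x) w‖
      ≤ (2 ^ (N - 1) * (1 ^ N + ‖w‖ ^ N)) * ‖𝓕 (slice χ x) w‖ := by
        gcongr
        exact add_pow_le zero_le_one (norm_nonneg _) N
    _ = 2 ^ (N - 1) * (‖w‖ ^ 0 * ‖𝓕 (slice χ x) w‖ + ‖w‖ ^ N * ‖𝓕 (slice χ x) w‖) := by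
        rw [one_pow, pow_zero]; ring
    _ ≤ _ := by gcongr; exacts [h0 x w, h1 x w]

theorem continuous_fourier_slice (χ : 𝓢(E × E, ℂ)) :
    Continuous fun z : E × E => 𝓕 (slice χ z.1) z.2 := by
  simp only [SchwartzMap.fourier_coe, Real.fourier_eq', slice_apply]
  obtain ⟨C, hC⟩ : ∃ C : ℝ, ∀ z, (1 + ‖z‖) ^ (Module.finrank ℝ E + 1) * ‖χ z‖ ≤ C :=
    ⟨_, fun z => by
      simpa using SchwartzMap.one_add_le_sup_seminorm_apply (𝕜 := ℂ)
        (m := (Module.finrank ℝ E + 1, 0)) (n := 0) le_rfl le_rfl χ z⟩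
  refine continuous_of_dominated
    (bound := fun v => C * (1 + ‖v‖) ^ (-((Module.finrank ℝ E + 1 : ℕ) : ℝ)))
    (fun z => ?_) (fun z => Eventually.of_forall fun v => ?_) ?_
    (Eventually.of_forall fun v => ?_)
  · exact Continuous.aestronglyMeasurable (by fun_prop)
  · have h1 : ‖v‖ ≤ ‖(z.1, v)‖ := le_max_right _ _
    rw [norm_smul, Complex.norm_exp_ofReal_mul_I, one_mul, Real.rpow_neg (by positivity),
      Real.rpow_natCast, ← div_eq_mul_inv, le_div_iff₀ (by positivity), mul_comm]
    refine le_trans ?_ (hC (z.1, v))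
    gcongr
  · exact (integrable_one_add_norm (by push_cast; linarith)).const_mul C
  · fun_prop

/-- Fourier inversion at the origin. -/
theorem integral_fourier_slice (χ : 𝓢(E × E, ℂ)) (x : E) :
    ∫ w, 𝓕 (slice χ x) w = χ (x, 0) := by
  have h : 𝓕⁻ (𝓕 (slice χ x)) = slice χ x := FourierTransform.fourierInv_fourier_eq _
  have h2 := DFunLike.congr_fun h 0
  rw [SchwartzMap.fourierInv_coe, Real.fourierInv_eq', slice_apply] at h2
  simpa using h2

theorem integrable_cutoff (χ : 𝓢(E × E, ℂ)) {ε : ℝ} (hε : 0 < ε) :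
    Integrable (fun z : E × E => χ (ε • z)) :=
  haveI : (volume : Measure (E × E)).IsAddHaarMeasure :=
    inferInstanceAs ((volume : Measure E).prod volume).IsAddHaarMeasure
  (χ.integrable (μ := volume)).comp_smul hε.ne'

/-- The `y`-integral is a Fourier transform of a slice of the cutoff, concentrated near `x = b` on
the scale `ε`. Rescaling `x` around `b` extracts the phase `e^{ia·b}`, and the remaining integral
depends on `ε` only through bounded phases and the position of the slice. -/
theorem oscillatory_integral_eq (χ : 𝓢(E × E, ℂ)) {ε : ℝ} (hε : 0 < ε) (a b : E) :
    ∫ z : E × E, Complex.exp (-(Complex.I * (inner ℝ z.1 z.2 : ℝ))) * χ (ε • z) *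
        Complex.exp (Complex.I * (inner ℝ z.1 a + inner ℝ z.2 b : ℝ)) =
      (2 * Real.pi) ^ Module.finrank ℝ E * (Complex.exp (Complex.I * (inner ℝ a b : ℝ)) *
        ∫ w, Complex.exp (Complex.I * (2 * Real.pi * ε * inner ℝ w a : ℝ)) *
          𝓕 (slice χ ((2 * Real.pi * ε ^ 2) • w + ε • b)) w) := by
  set d := Module.finrank ℝ E
  have hpi := Real.pi_pos
  have hint : Integrable fun z : E × E =>
      Complex.exp (-(Complex.I * (inner ℝ z.1 z.2 : ℝ))) * χ (ε • z) *
        Complex.exp (Complex.I * (inner ℝ z.1 a + inner ℝ z.2 b : ℝ)) := by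
    refine (integrable_cutoff χ hε).norm.mono' (Continuous.aestronglyMeasurable (by fun_prop))
      (Eventually.of_forall fun z => ?_)
    rw [norm_mul, norm_mul, mul_comm Complex.I, mul_comm Complex.I, ← neg_mul, ← Complex.ofReal_neg,
      Complex.norm_exp_ofReal_mul_I, Complex.norm_exp_ofReal_mul_I, one_mul, mul_one]
  rw [Measure.volume_eq_prod] at hint ⊢
  rw [integral_prod _ hint]
  -- The value of the `y`-integral after `v = εy`: the Jacobian is `ε^{-d}` and the frequency `(x -
  -- b)/(2πε)`.
  let G : E → ℂ := fun x => Complex.exp (Complex.I * (inner ℝ x a : ℝ)) *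
    (((ε ^ d)⁻¹ : ℝ) * 𝓕 (slice χ (ε • x)) ((2 * Real.pi * ε)⁻¹ • (x - b)))
  have hG : ∀ x, ∫ y, Complex.exp (-(Complex.I * (inner ℝ x y : ℝ))) * χ (ε • (x, y)) *
      Complex.exp (Complex.I * (inner ℝ x a + inner ℝ y b : ℝ)) = G x := by
    intro x
    have h := Measure.integral_comp_smul volume
      (fun v => Complex.exp ((-2 * Real.pi * inner ℝ v ((2 * Real.pi * ε)⁻¹ • (x - b)) : ℝ) *
        Complex.I) • slice χ (ε • x) v) ε
    rw [← Real.fourier_eq', ← SchwartzMap.fourier_coe, abs_of_pos (by positivity),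
      Complex.real_smul] at h
    simp only [G]
    rw [← h, ← integral_const_mul]
    refine integral_congr_ae (Eventually.of_forall fun y => ?_)
    simp only [slice_apply, smul_eq_mul, Prod.smul_mk, inner_smul_left, inner_smul_right,
      inner_sub_right, conj_trivial]
    have e1 : -2 * Real.pi * ((2 * Real.pi * ε)⁻¹ * (ε * inner ℝ y x - ε * inner ℝ y b)) =
        inner ℝ y b - inner ℝ y x := by
      field_simp
      ring
    rw [e1, mul_right_comm, ← Complex.exp_add, ← mul_assoc, ← Complex.exp_add,
      real_inner_comm x y]
    congr 2
    push_cast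
    ring
  simp only [hG]
  -- Substitution `x = 2πεw + b`. Its Jacobian `(2πε)^d` cancels `ε^{-d}` and leaves `(2π)^d`; the
  -- slice is then taken at `εx = 2πε²w + εb`.
  have h1 : ∫ x, G x = ∫ x, G (x + b) := (integral_add_right_eq_self G b).symm
  have h2 := Measure.integral_comp_smul volume (fun x => G (x + b)) (2 * Real.pi * ε)
  rw [abs_of_pos (by positivity), ← h1, Complex.real_smul] at h2
  have h3 : ∫ x, G x = (((2 * Real.pi * ε) ^ d : ℝ) : ℂ) * ∫ w, G ((2 * Real.pi * ε) • w + b) := by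
    rw [h2, ← mul_assoc, ← Complex.ofReal_mul, mul_inv_cancel₀ (by positivity), Complex.ofReal_one,
      one_mul]
  rw [h3, ← integral_const_mul, ← integral_const_mul, ← integral_const_mul]
  refine integral_congr_ae (Eventually.of_forall fun w => ?_)
  simp only [G, add_sub_cancel_right, smul_smul, inv_mul_cancel₀ (by positivity : 2 * Real.pi * ε ≠ 0),
    one_smul, inner_add_left, inner_smul_left, conj_trivial, smul_add]
  rw [show ε * (2 * Real.pi * ε) = 2 * Real.pi * ε ^ 2 by ring, real_inner_comm a b]
  push_cast
  rw [mul_add, Complex.exp_add, mul_pow]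
  have : (ε : ℂ) ^ d ≠ 0 := pow_ne_zero _ (by exact_mod_cast hε.ne')
  field_simp

theorem exists_oscillatory_bound (χ : 𝓢(E × E, ℂ)) :
    ∃ C : ℝ, ∀ ε : ℝ, ∀ a b : E,
      ‖∫ w, Complex.exp (Complex.I * (2 * Real.pi * ε * inner ℝ w a : ℝ)) *
          𝓕 (slice χ ((2 * Real.pi * ε ^ 2) • w + ε • b)) w‖ ≤ C := by
  obtain ⟨C, hC⟩ := exists_fourier_slice_le χ (Module.finrank ℝ E + 1)
  refine ⟨∫ w : E, C * (1 + ‖w‖) ^ (-((Module.finrank ℝ E + 1 : ℕ) : ℝ)), fun ε a b =>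
    norm_integral_le_of_norm_le
      ((integrable_one_add_norm (by push_cast; linarith)).const_mul C)
      (Eventually.of_forall fun w => ?_)⟩
  rw [norm_mul, mul_comm Complex.I, Complex.norm_exp_ofReal_mul_I, one_mul]
  exact hC _ _

theorem tendsto_oscillatory (χ : 𝓢(E × E, ℂ)) (a b : E) :
    Tendsto (fun ε : ℝ => ∫ w, Complex.exp (Complex.I * (2 * Real.pi * ε * inner ℝ w a : ℝ)) *
      𝓕 (slice χ ((2 * Real.pi * ε ^ 2) • w + ε • b)) w) (𝓝[>] 0) (𝓝 (χ 0)) := by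
  obtain ⟨C, hC⟩ := exists_fourier_slice_le χ (Module.finrank ℝ E + 1)
  have hc := continuous_fourier_slice χ
  have hc' : Continuous fun z : ℝ × E =>
      Complex.exp (Complex.I * (2 * Real.pi * z.1 * inner ℝ z.2 a : ℝ)) *
        𝓕 (slice χ ((2 * Real.pi * z.1 ^ 2) • z.2 + z.1 • b)) z.2 := by
    refine Continuous.mul (by fun_prop) ?_
    exact hc.comp (f := fun z : ℝ × E => ((2 * Real.pi * z.1 ^ 2) • z.2 + z.1 • b, z.2))
      (by fun_prop)
  have h : Continuous fun ε : ℝ =>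
      ∫ w, Complex.exp (Complex.I * (2 * Real.pi * ε * inner ℝ w a : ℝ)) *
        𝓕 (slice χ ((2 * Real.pi * ε ^ 2) • w + ε • b)) w := by
    refine continuous_of_dominated
      (bound := fun w => C * (1 + ‖w‖) ^ (-((Module.finrank ℝ E + 1 : ℕ) : ℝ)))
      (fun ε => ?_) (fun ε => Eventually.of_forall fun w => ?_) ?_
      (Eventually.of_forall fun w => ?_)
    · exact (hc'.comp (Continuous.prodMk_right ε)).aestronglyMeasurable
    · rw [norm_mul, mul_comm Complex.I, Complex.norm_exp_ofReal_mul_I, one_mul]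
      exact hC _ _
    · exact (integrable_one_add_norm (by push_cast; linarith)).const_mul C
    · exact hc'.comp (Continuous.prodMk_left w)
  -- By domination the integral is continuous on all of `ℝ`. At `ε = 0` the phase is `1` and the
  -- slice is the one through the origin, so Fourier inversion evaluates it.
  have h0 := (h.tendsto 0).mono_left (nhdsWithin_le_nhds (s := Set.Ioi 0))
  rw [← Prod.mk_zero_zero]
  simpa [integral_fourier_slice] using h0

end Oscillatory


/-! ### The oscillatory integral with the Lorentzian pairing -/

/-- The reflection `(x₀, 𝐱) ↦ (x₀, -𝐱)`. -/
def spaceReflection (n : ℕ) : Spacetime n ≃ₗᵢ[ℝ] Spacetime n :=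
  LinearIsometryEquiv.piLpCongrRight 2
    (Fin.cons (LinearIsometryEquiv.refl ℝ ℝ) fun _ => LinearIsometryEquiv.neg ℝ)

theorem spaceReflection_zero {n : ℕ} (x : Spacetime n) : spaceReflection n x 0 = x 0 := by
  simp [spaceReflection]

theorem spaceReflection_succ {n : ℕ} (x : Spacetime n) (i : Fin (n + 1)) :
    spaceReflection n x i.succ = -x i.succ := by
  simp [spaceReflection]

theorem inner_spaceReflection {n : ℕ} (x y : Spacetime n) :
    inner ℝ x (spaceReflection n y) = minkowski x y := by
  simp only [PiLp.inner_apply, Fin.sum_univ_succ (n := n + 1), spaceReflection_zero,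
    spaceReflection_succ, minkowski, RCLike.inner_apply, conj_trivial, neg_mul,
    Finset.sum_neg_distrib]
  rw [mul_comm, sub_eq_add_neg]
  simp only [mul_comm]

theorem minkowski_comm {n : ℕ} (x y : Spacetime n) : minkowski x y = minkowski y x := by
  simp only [minkowski, mul_comm]

theorem spaceReflection_spaceReflection {n : ℕ} (x : Spacetime n) :
    spaceReflection n (spaceReflection n x) = x := by
  ext i
  refine Fin.cases ?_ (fun i => ?_) i
  · simp [spaceReflection_zero]
  · simp [spaceReflection_succ]

theorem continuous_minkowski_uncurry {n : ℕ} :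
    Continuous fun z : Spacetime n × Spacetime n => minkowski z.1 z.2 := by
  simp only [← inner_spaceReflection]
  fun_prop

/-- The regularised oscillatory integral divided by its limit. -/
def oscFactor {n : ℕ} (χ : 𝓢(Spacetime n × Spacetime n, ℂ)) (ε : ℝ) (a b : Spacetime n) : ℂ :=
  Complex.exp (-(Complex.I * minkowski a b)) * ((((2 * Real.pi) ^ (n + 2))⁻¹ : ℂ) *
    ∫ z : Spacetime n × Spacetime n, Complex.exp (-(Complex.I * minkowski z.1 z.2)) * χ (ε • z) *
      Complex.exp (Complex.I * (minkowski z.1 a + minkowski z.2 b : ℝ)))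

open scoped FourierTransform in
-- Reflecting the spatial part of `y` turns the Lorentzian pairings into Euclidean ones. The new
-- cutoff `χ'` is `χ` composed with this reflection, so its value at the origin is unchanged.
theorem exists_oscFactor_eq {n : ℕ} (χ : 𝓢(Spacetime n × Spacetime n, ℂ)) :
    ∃ χ' : 𝓢(Spacetime n × Spacetime n, ℂ), χ' 0 = χ 0 ∧ ∀ ε : ℝ, 0 < ε → ∀ a b,
      oscFactor χ ε a b = ∫ w, Complex.exp (Complex.I *
        (2 * Real.pi * ε * inner ℝ w (spaceReflection n a) : ℝ)) *
          𝓕 (slice χ' ((2 * Real.pi * ε ^ 2) • w + ε • b)) w := by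
  let J := spaceReflection n
  let e : (Spacetime n × Spacetime n) ≃L[ℝ] Spacetime n × Spacetime n :=
    (ContinuousLinearEquiv.refl ℝ _).prodCongr J.toContinuousLinearEquiv
  have he : ∀ z, e z = (z.1, J z.2) := fun z => rfl
  refine ⟨SchwartzMap.compCLMOfContinuousLinearEquiv ℂ e χ, ?_, fun ε hε a b => ?_⟩
  · simp
  · have hmp : MeasurePreserving e := by
      have h : MeasurePreserving (Prod.map id J : Spacetime n × Spacetime n → _)
        (volume.prod volume) (volume.prod volume) :=
        (MeasurePreserving.id volume).prod J.measurePreserving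
      exact h
    have h := oscillatory_integral_eq (SchwartzMap.compCLMOfContinuousLinearEquiv ℂ e χ) hε
      (J a) b
    have hint := hmp.integral_comp e.toHomeomorph.measurableEmbedding
      (fun z => Complex.exp (-(Complex.I * minkowski z.1 z.2)) * χ (ε • z) *
        Complex.exp (Complex.I * (minkowski z.1 a + minkowski z.2 b : ℝ)))
    rw [oscFactor, ← hint]
    have hz : ∀ z : Spacetime n × Spacetime n,
        Complex.exp (-(Complex.I * minkowski (e z).1 (e z).2)) * χ (ε • e z) *
          Complex.exp (Complex.I * (minkowski (e z).1 a + minkowski (e z).2 b : ℝ)) =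
        Complex.exp (-(Complex.I * (inner ℝ z.1 z.2 : ℝ))) *
          (SchwartzMap.compCLMOfContinuousLinearEquiv ℂ e χ) (ε • z) *
          Complex.exp (Complex.I * (inner ℝ z.1 (J a) + inner ℝ z.2 b : ℝ)) := by
      intro z
      have h1 : minkowski z.1 (J z.2) = inner ℝ z.1 z.2 := by
        rw [← inner_spaceReflection, spaceReflection_spaceReflection]
      have h2 : minkowski (J z.2) b = inner ℝ z.2 b := by
        rw [minkowski_comm, ← inner_spaceReflection, spaceReflection_spaceReflection,
          real_inner_comm]
      rw [SchwartzMap.compCLMOfContinuousLinearEquiv_apply, Function.comp_apply, map_smul e, he,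
        h1, h2, ← inner_spaceReflection]
    have hab : inner ℝ (J a) b = minkowski a b := by
      rw [real_inner_comm, inner_spaceReflection, minkowski_comm]
    simp only [hz]
    rw [h, finrank_euclideanSpace_fin, hab]
    have hpi : ((2 * Real.pi : ℂ)) ^ (n + 2) ≠ 0 := by
      exact pow_ne_zero _ (by exact_mod_cast Real.two_pi_pos.ne')
    rw [inv_mul_cancel_left₀ hpi, ← mul_assoc, ← Complex.exp_add]
    simp [J]

theorem exists_oscFactor_bound {n : ℕ} (χ : 𝓢(Spacetime n × Spacetime n, ℂ)) :
    ∃ C : ℝ, ∀ ε : ℝ, 0 < ε → ∀ a b, ‖oscFactor χ ε a b‖ ≤ C := by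
  obtain ⟨χ', -, h⟩ := exists_oscFactor_eq χ
  obtain ⟨C, hC⟩ := exists_oscillatory_bound χ'
  exact ⟨C, fun ε hε a b => (h ε hε a b) ▸ hC ε _ b⟩

theorem tendsto_oscFactor {n : ℕ} (χ : 𝓢(Spacetime n × Spacetime n, ℂ)) (a b : Spacetime n) :
    Tendsto (fun ε => oscFactor χ ε a b) (𝓝[>] 0) (𝓝 (χ 0)) := by
  obtain ⟨χ', h0, h⟩ := exists_oscFactor_eq χ
  rw [← h0]
  refine (tendsto_oscillatory χ' (spaceReflection n a) b).congr' ?_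
  filter_upwards [self_mem_nhdsWithin] with ε hε
  exact (h ε hε a b).symm

/-! ### Oscillatory integrals of multiplication operators -/

section Multiplication

variable {Ω : Type*} [MeasurableSpace Ω] {ν : Measure Ω} {n : ℕ}

/-- The phase `x · a(ω) + y · b(ω)`. -/
def warpPhase (a b : Ω → Spacetime n) (z : Spacetime n × Spacetime n) (ω : Ω) : ℝ :=
  minkowski z.1 (a ω) + minkowski z.2 (b ω)

theorem measurable_warpPhase_uncurry {a b : Ω → Spacetime n} (ha : Measurable a)
    (hb : Measurable b) :
    Measurable fun w : (Spacetime n × Spacetime n) × Ω => warpPhase a b w.1 w.2 :=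
  (continuous_minkowski_uncurry.measurable.comp
    ((measurable_fst.comp measurable_fst).prodMk (ha.comp measurable_snd))).add
  (continuous_minkowski_uncurry.measurable.comp
    ((measurable_snd.comp measurable_fst).prodMk (hb.comp measurable_snd)))

theorem measurable_warpPhase {a b : Ω → Spacetime n} (ha : Measurable a)
    (hb : Measurable b) (z : Spacetime n × Spacetime n) : Measurable (warpPhase a b z) :=
  (measurable_warpPhase_uncurry ha hb).comp measurable_prodMk_left

omit [MeasurableSpace Ω] in
theorem continuous_warpPhase (a b : Ω → Spacetime n) (ω : Ω) :
    Continuous fun z => warpPhase a b z ω :=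
  (continuous_minkowski_uncurry.comp (by fun_prop : Continuous
    fun z : Spacetime n × Spacetime n => (z.1, a ω))).add
  (continuous_minkowski_uncurry.comp (by fun_prop : Continuous
    fun z : Spacetime n × Spacetime n => (z.2, b ω)))

theorem norm_sq_sub_phaseMul {φ : Ω → ℝ} (hφ : Measurable φ) (G : Lp ℂ 2 ν) (F : Lp ℂ 2 ν)
    (k : Ω → ℂ) (hF : F =ᵐ[ν] fun ω => k ω * G ω) :
    ‖F - phaseMul ν φ hφ G‖ ^ 2 =
      ∫ ω, ‖k ω - Complex.exp (φ ω * Complex.I)‖ ^ 2 * ‖G ω‖ ^ 2 ∂ν := by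
  rw [norm_sq_eq_integral]
  refine integral_congr_ae ?_
  filter_upwards [Lp.coeFn_sub F (phaseMul ν φ hφ G), coeFn_phaseMul φ hφ G, hF] with ω h1 h2 h3
  rw [h1, Pi.sub_apply, h2, h3, ← sub_mul, norm_mul, mul_pow]

theorem integrable_norm_sq (G : Lp ℂ 2 ν) : Integrable (fun ω => ‖G ω‖ ^ 2) ν :=
  (memLp_two_iff_integrable_sq_norm (Lp.aestronglyMeasurable G)).1 (Lp.memLp G)

/-- Dominated convergence for multiplication operators on `L²`. -/
theorem tendsto_phaseMul {ι : Type*} {l : Filter ι} [l.IsCountablyGenerated] {φ : Ω → ℝ}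
    (hφ : Measurable φ) (G : Lp ℂ 2 ν) (F : ι → Lp ℂ 2 ν) (k : ι → Ω → ℂ) (C : ℝ)
    (hk : ∀ᶠ i in l, AEStronglyMeasurable (k i) ν) (hF : ∀ᶠ i in l, F i =ᵐ[ν] fun ω => k i ω * G ω)
    (hC : ∀ᶠ i in l, ∀ ω, ‖k i ω‖ ≤ C)
    (hlim : ∀ ω, Tendsto (fun i => k i ω) l (𝓝 (Complex.exp (φ ω * Complex.I)))) :
    Tendsto F l (𝓝 (phaseMul ν φ hφ G)) := by
  rw [tendsto_iff_norm_sub_tendsto_zero]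
  have h : Tendsto (fun i => ‖F i - phaseMul ν φ hφ G‖ ^ 2) l (𝓝 0) := by
    have h0 : (0 : ℝ) = ∫ ω, 0 * ‖G ω‖ ^ 2 ∂ν := by simp
    rw [h0]
    refine Tendsto.congr' (f₁ := fun i =>
      ∫ ω, ‖k i ω - Complex.exp (φ ω * Complex.I)‖ ^ 2 * ‖G ω‖ ^ 2 ∂ν) ?_ ?_
    · filter_upwards [hF] with i hi
      exact (norm_sq_sub_phaseMul hφ G (F i) (k i) hi).symm
    · refine tendsto_integral_filter_of_dominated_convergence
        (fun ω => (C + 1) ^ 2 * ‖G ω‖ ^ 2) ?_ ?_ ((integrable_norm_sq G).const_mul _) ?_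
      · filter_upwards [hk] with i hi
        have : Measurable fun ω => Complex.exp (φ ω * Complex.I) := by fun_prop
        exact ((hi.sub this.aestronglyMeasurable).norm.pow 2).mul
          ((Lp.aestronglyMeasurable G).norm.pow 2)
      · filter_upwards [hC] with i hi
        refine Eventually.of_forall fun ω => ?_
        rw [Real.norm_of_nonneg (by positivity)]
        gcongr
        refine (norm_sub_le _ _).trans ?_
        rw [Complex.norm_exp_ofReal_mul_I]
        gcongr
        exact hi ω
      · refine Eventually.of_forall fun ω => ?_
        refine Tendsto.mul_const _ ?_
        have := ((hlim ω).sub_const (Complex.exp (φ ω * Complex.I))).norm.pow 2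
        simpa using this
  have h2 := h.sqrt
  simpa [Real.sqrt_sq (norm_nonneg _)] using h2

theorem continuous_phaseMul_warpPhase {a b : Ω → Spacetime n} (ha : Measurable a)
    (hb : Measurable b) (G : Lp ℂ 2 ν) :
    Continuous fun z => phaseMul ν (warpPhase a b z) (measurable_warpPhase ha hb z) G := by
  refine continuous_iff_continuousAt.2 fun z₀ => ?_
  refine tendsto_phaseMul (measurable_warpPhase ha hb z₀) G _
    (fun z ω => Complex.exp (warpPhase a b z ω * Complex.I)) 1 ?_ ?_ ?_ ?_
  · refine Eventually.of_forall fun z => ?_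
    have := measurable_warpPhase ha hb z
    exact (by fun_prop : Measurable fun ω => Complex.exp (warpPhase a b z ω * Complex.I))
      |>.aestronglyMeasurable
  · exact Eventually.of_forall fun z => coeFn_phaseMul _ _ G
  · exact Eventually.of_forall fun z ω => (Complex.norm_exp_ofReal_mul_I _).le
  · intro ω
    have := continuous_warpPhase a b ω
    exact (by fun_prop : Continuous fun z =>
      Complex.exp (warpPhase a b z ω * Complex.I)).continuousAt

variable [SigmaFinite ν]

/-- The vector-valued integral is identified weakly: paired with a fixed vector, Fubini exchanges
the integrals over `z` and over `ω`. -/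
theorem integral_smul_phaseMul {a b : Ω → Spacetime n} (ha : Measurable a)
    (hb : Measurable b) (G : Lp ℂ 2 ν) (c : Spacetime n × Spacetime n → ℂ) (hc : Integrable c) :
    (∫ z, c z • phaseMul ν (warpPhase a b z) (measurable_warpPhase ha hb z) G : Lp ℂ 2 ν) =ᵐ[ν]
      fun ω => (∫ z, c z * Complex.exp (warpPhase a b z ω * Complex.I)) * G ω := by
  set k : Ω → ℂ := fun ω => ∫ z, c z * Complex.exp (warpPhase a b z ω * Complex.I) with hk
  have hexp : Measurable fun w : (Spacetime n × Spacetime n) × Ω =>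
      Complex.exp (warpPhase a b w.1 w.2 * Complex.I) := by
    have := measurable_warpPhase_uncurry ha hb
    fun_prop
  have hkm : AEStronglyMeasurable k ν := by
    have h : AEStronglyMeasurable (fun w : Ω × (Spacetime n × Spacetime n) =>
        c w.2 * Complex.exp (warpPhase a b w.2 w.1 * Complex.I)) (ν.prod volume) :=
      hc.aestronglyMeasurable.comp_snd.mul (hexp.comp measurable_swap).aestronglyMeasurable
    exact h.integral_prod_right'
  have hkb : ∀ ω, ‖k ω‖ ≤ ∫ z, ‖c z‖ := fun ω => by
    refine (norm_integral_le_integral_norm _).trans_eq ?_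
    simp [Complex.norm_exp_ofReal_mul_I]
  have hmem : MemLp (fun ω => k ω * G ω) 2 ν := by
    refine MemLp.of_le_mul (Lp.memLp G) (hkm.mul (Lp.aestronglyMeasurable G))
      (c := ∫ z, ‖c z‖) (Eventually.of_forall fun ω => ?_)
    rw [norm_mul]
    gcongr
    exact hkb ω
  have hint : Integrable fun z =>
      c z • phaseMul ν (warpPhase a b z) (measurable_warpPhase ha hb z) G := by
    refine (hc.norm.mul_const ‖G‖).mono' (hc.aestronglyMeasurable.smul
      (continuous_phaseMul_warpPhase ha hb G).aestronglyMeasurable)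
      (Eventually.of_forall fun z => ?_)
    rw [norm_smul, LinearIsometry.norm_map]
  suffices h : ∫ z, c z • phaseMul ν (warpPhase a b z) (measurable_warpPhase ha hb z) G =
      hmem.toLp _ by
    rw [h]; exact hmem.coeFn_toLp
  refine ext_inner_left ℂ fun H => ?_
  rw [← integral_inner hint, L2.inner_def]
  have hprod : Integrable (fun w : (Spacetime n × Spacetime n) × Ω =>
      c w.1 * inner ℂ (H w.2) (G w.2) * Complex.exp (warpPhase a b w.1 w.2 * Complex.I))
      (volume.prod ν) := by
    have h1 := hc.mul_prod (L2.integrable_inner (𝕜 := ℂ) H G)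
    refine h1.norm.mono' (h1.aestronglyMeasurable.mul hexp.aestronglyMeasurable)
      (Eventually.of_forall fun w => ?_)
    rw [norm_mul, Complex.norm_exp_ofReal_mul_I, mul_one]
  calc ∫ z, inner ℂ H (c z • phaseMul ν (warpPhase a b z) (measurable_warpPhase ha hb z) G)
      = ∫ z, ∫ ω, c z * inner ℂ (H ω) (G ω) *
          Complex.exp (warpPhase a b z ω * Complex.I) ∂ν := by
        refine integral_congr_ae (Eventually.of_forall fun z => ?_)
        simp only
        rw [inner_smul_right, L2.inner_def, ← integral_const_mul]
        refine integral_congr_ae ?_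
        filter_upwards [coeFn_phaseMul (warpPhase a b z) (measurable_warpPhase ha hb z) G] with ω h
        rw [h]
        simp only [RCLike.inner_apply]
        ring
    _ = ∫ ω, ∫ z : Spacetime n × Spacetime n, c z * inner ℂ (H ω) (G ω) *
          Complex.exp (warpPhase a b z ω * Complex.I) ∂volume ∂ν := integral_integral_swap hprod
    _ = _ := by
        refine integral_congr_ae ?_
        filter_upwards [hmem.coeFn_toLp] with ω h
        rw [h, hk]
        simp only [RCLike.inner_apply]
        rw [mul_assoc, ← integral_mul_const]
        refine integral_congr_ae (Eventually.of_forall fun z => ?_)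
        simp only
        ring

/-- The scalar factor of the warped convolution integrand. -/
def warpCoeff (χ : 𝓢(Spacetime n × Spacetime n, ℂ)) (ε : ℝ) (z : Spacetime n × Spacetime n) : ℂ :=
  Complex.exp (-(Complex.I * minkowski z.1 z.2)) * χ (ε • z)

theorem integrable_warpCoeff (χ : 𝓢(Spacetime n × Spacetime n, ℂ)) {ε : ℝ} (hε : 0 < ε) :
    Integrable (warpCoeff χ ε) := by
  have hc := continuous_minkowski_uncurry (n := n)
  refine (integrable_cutoff χ hε).norm.mono' (Continuous.aestronglyMeasurable ?_)
    (Eventually.of_forall fun z => ?_)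
  · unfold warpCoeff; fun_prop
  · rw [warpCoeff, norm_mul, mul_comm Complex.I, ← neg_mul, ← Complex.ofReal_neg,
      Complex.norm_exp_ofReal_mul_I, one_mul]

omit [SigmaFinite ν] in
theorem integrable_warp_phaseMul {a b : Ω → Spacetime n} (ha : Measurable a)
    (hb : Measurable b) (G : Lp ℂ 2 ν) (χ : 𝓢(Spacetime n × Spacetime n, ℂ)) {ε : ℝ}
    (hε : 0 < ε) :
    Integrable fun z => warpCoeff χ ε z •
      phaseMul ν (warpPhase a b z) (measurable_warpPhase ha hb z) G := by
  have hc := integrable_warpCoeff χ hε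
  refine (hc.norm.mul_const ‖G‖).mono' (hc.aestronglyMeasurable.smul
    (continuous_phaseMul_warpPhase ha hb G).aestronglyMeasurable)
    (Eventually.of_forall fun z => ?_)
  rw [norm_smul, LinearIsometry.norm_map]

theorem tendsto_warp_phaseMul {a b : Ω → Spacetime n} (ha : Measurable a)
    (hb : Measurable b) (G : Lp ℂ 2 ν) (χ : 𝓢(Spacetime n × Spacetime n, ℂ)) (hχ : χ 0 = 1)
    {φ : Ω → ℝ} (hφ : Measurable φ) (h : ∀ ω, φ ω = minkowski (a ω) (b ω)) :
    Tendsto (fun ε : ℝ => (((2 * Real.pi) ^ (n + 2))⁻¹ : ℂ) • ∫ z, warpCoeff χ ε z •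
      phaseMul ν (warpPhase a b z) (measurable_warpPhase ha hb z) G) (𝓝[>] 0)
      (𝓝 (phaseMul ν φ hφ G)) := by
  obtain ⟨C, hC⟩ := exists_oscFactor_bound χ
  -- The multiplier is the limiting phase times `oscFactor`, which is bounded uniformly in `ω` and
  -- tends pointwise to `χ(0) = 1`; this is exactly the input of `tendsto_phaseMul`.
  have hk : ∀ (ε : ℝ) ω, (((2 * Real.pi) ^ (n + 2))⁻¹ : ℂ) *
      ∫ z, warpCoeff χ ε z * Complex.exp (warpPhase a b z ω * Complex.I) =
        Complex.exp (φ ω * Complex.I) * oscFactor χ ε (a ω) (b ω) := by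
    intro ε ω
    rw [oscFactor, ← mul_assoc (Complex.exp (φ ω * Complex.I)), ← Complex.exp_add, h,
      mul_comm Complex.I, add_neg_cancel, Complex.exp_zero, one_mul]
    simp only [warpCoeff, warpPhase, mul_comm Complex.I]
  refine tendsto_phaseMul hφ G _ (fun ε ω => (((2 * Real.pi) ^ (n + 2))⁻¹ : ℂ) *
      ∫ z, warpCoeff χ ε z * Complex.exp (warpPhase a b z ω * Complex.I)) C ?_ ?_ ?_ ?_
  · filter_upwards [self_mem_nhdsWithin] with ε hε
    have hexp : Measurable fun w : Ω × (Spacetime n × Spacetime n) =>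
        Complex.exp (warpPhase a b w.2 w.1 * Complex.I) := by
      have := (measurable_warpPhase_uncurry ha hb).comp
        (measurable_swap (α := Ω) (β := Spacetime n × Spacetime n))
      exact Complex.measurable_exp.comp
        ((Complex.measurable_ofReal.comp this).mul_const Complex.I)
    have h1 : AEStronglyMeasurable (fun w : Ω × (Spacetime n × Spacetime n) =>
        warpCoeff χ ε w.2 * Complex.exp (warpPhase a b w.2 w.1 * Complex.I)) (ν.prod volume) :=
      (integrable_warpCoeff χ hε).aestronglyMeasurable.comp_snd.mul hexp.aestronglyMeasurable
    exact h1.integral_prod_right'.const_mul _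
  · filter_upwards [self_mem_nhdsWithin] with ε hε
    filter_upwards [Lp.coeFn_smul (((2 * Real.pi) ^ (n + 2))⁻¹ : ℂ) (∫ z, warpCoeff χ ε z •
      phaseMul ν (warpPhase a b z) (measurable_warpPhase ha hb z) G),
      integral_smul_phaseMul ha hb G (warpCoeff χ ε) (integrable_warpCoeff χ hε)] with ω h1 h2
    rw [h1, Pi.smul_apply, h2, smul_eq_mul, mul_assoc]
  · filter_upwards [self_mem_nhdsWithin] with ε hε ω
    rw [hk, norm_mul, Complex.norm_exp_ofReal_mul_I, one_mul]
    exact hC ε hε _ _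
  · intro ω
    simp only [hk]
    have := (tendsto_oscFactor χ (a ω) (b ω)).const_mul (Complex.exp (φ ω * Complex.I))
    rwa [hχ, mul_one] at this

end Multiplication


/-! ### The warped convolution of the free field -/

section Warped

open ContinuousLinearMap (adjoint)

variable {n : ℕ} {m : ℝ}

theorem minkowski_neg_left (x y : Spacetime n) : minkowski (-x) y = -minkowski x y := by
  simp only [← inner_spaceReflection, inner_neg_left]

theorem minkowski_neg_right (x y : Spacetime n) : minkowski x (-y) = -minkowski x y := by
  rw [minkowski_comm, minkowski_neg_left, minkowski_comm]

theorem minkowski_add_right (x y z : Spacetime n) :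
    minkowski x (y + z) = minkowski x y + minkowski x z := by
  simp only [← inner_spaceReflection, map_add, inner_add_right]

theorem minkowski_sum_right {ι : Type*} (s : Finset ι) (x : Spacetime n) (f : ι → Spacetime n) :
    minkowski x (∑ i ∈ s, f i) = ∑ i ∈ s, minkowski x (f i) := by
  simp only [← inner_spaceReflection, map_sum, inner_sum]

theorem continuous_act (M : Matrix (Fin (n + 2)) (Fin (n + 2)) ℝ) : Continuous (act M) := by
  unfold act
  fun_prop

theorem act_sum {ι : Type*} (s : Finset ι) (M : Matrix (Fin (n + 2)) (Fin (n + 2)) ℝ)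
    (f : ι → Spacetime n) : act M (∑ i ∈ s, f i) = ∑ i ∈ s, act M (f i) :=
  map_sum (Matrix.toLpLin 2 2 M) f s

/-- `M` is antisymmetric with respect to the Lorentzian scalar product. -/
def IsSkew (M : Matrix (Fin (n + 2)) (Fin (n + 2)) ℝ) : Prop :=
  ∀ x y : Spacetime n, minkowski (act M x) y = -minkowski x (act M y)

theorem IsSkew.minkowski_self {M : Matrix (Fin (n + 2)) (Fin (n + 2)) ℝ} (hM : IsSkew M)
    (x : Spacetime n) : minkowski (act M x) x = 0 := by
  have := hM x x
  rw [minkowski_comm x] at this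
  linarith

/-- The twist `(p, q) ↦ p · M q` on the mass shell. -/
def shellTwist (m : ℝ) (M : Matrix (Fin (n + 2)) (Fin (n + 2)) ℝ) (p q : Momentum n) : ℝ :=
  minkowski (onShell m p) (act M (onShell m q))

theorem measurable_shellTwist (m : ℝ) (M : Matrix (Fin (n + 2)) (Fin (n + 2)) ℝ) :
    Measurable (Function.uncurry (shellTwist m M)) := by
  have h1 := continuous_onShell (n := n) m
  have h2 := continuous_act M
  exact (continuous_minkowski_uncurry.comp (f := fun z : Momentum n × Momentum n =>
    (onShell m z.1, act M (onShell m z.2))) (by fun_prop)).measurable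

/-- The translations on the `k`-boson space. -/
def bosonTranslation (m : ℝ) (y : Spacetime n) (k : ℕ) :
    bosons (shellMeasure n m) k →ₗᵢ[ℂ] bosons (shellMeasure n m) k :=
  restrictBosons
    (phaseMul (Measure.pi fun _ : Fin k => shellMeasure n m) (totalPhase m y k)
      (measurable_totalPhase m y k))
    (phaseMul_mem_bosons m y k)

theorem coe_bosonTranslation (y : Spacetime n) (k : ℕ) (F : bosons (shellMeasure n m) k) :
    (bosonTranslation m y k F : TensorL2 (shellMeasure n m) k) =
      phaseMul _ (totalPhase m y k) (measurable_totalPhase m y k) F := rfl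

theorem totalPhase_neg (y : Spacetime n) (k : ℕ) (p : Fin k → Momentum n) :
    totalPhase m (-y) k p = -totalPhase m y k p := by
  simp only [totalPhase, minkowski_neg_left, Finset.sum_neg_distrib]

theorem inner_totalPhase_right (y : Spacetime n) (k : ℕ) (F G : TensorL2 (shellMeasure n m) k) :
    inner ℂ F (phaseMul _ (totalPhase m y k) (measurable_totalPhase m y k) G) =
      inner ℂ (phaseMul _ (totalPhase m (-y) k) (measurable_totalPhase m (-y) k) F) G := by
  rw [inner_phaseMul_right]
  simp only [← totalPhase_neg]

theorem bosonTranslation_orthogonalProjectionOnto (y : Spacetime n) (k : ℕ)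
    (F : TensorL2 (shellMeasure n m) k) :
    bosonTranslation m y k ((bosons (shellMeasure n m) k).orthogonalProjectionOnto F) =
      (bosons (shellMeasure n m) k).orthogonalProjectionOnto
        (phaseMul _ (totalPhase m y k) (measurable_totalPhase m y k) F) :=
  restrictBosons_orthogonalProjectionOnto _ _ _ (phaseMul_mem_bosons m (-y) k)
    (inner_totalPhase_right y k) F

theorem phaseMul_tensorLeft_phaseMul {α : Type*} [MeasurableSpace α] {μ : Measure α}
    [SigmaFinite μ] {k : ℕ} {φ χ : (Fin (k + 1) → α) → ℝ} {ψ : (Fin k → α) → ℝ}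
    (hφ : Measurable φ) (hψ : Measurable ψ) (hχ : Measurable χ)
    (h : ∀ p, φ p + ψ (fun i => p i.succ) = χ p) (f : Lp ℂ 2 μ) (F : TensorL2 μ k) :
    phaseMul _ φ hφ (tensorLeft μ k f (phaseMul _ ψ hψ F)) =
      phaseMul _ χ hχ (tensorLeft μ k f F) := by
  apply Lp.ext
  filter_upwards [coeFn_phaseMul φ hφ (tensorLeft μ k f (phaseMul _ ψ hψ F)),
    coeFn_tensorLeft f (phaseMul _ ψ hψ F), ae_tail (coeFn_phaseMul ψ hψ F),
    coeFn_phaseMul χ hχ (tensorLeft μ k f F), coeFn_tensorLeft f F] with p h1 h2 h3 h4 h5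
  rw [h1, h2, h3, h4, h5, ← h, Complex.ofReal_add, add_mul, Complex.exp_add]
  ring

theorem creationPart_apply {α : Type*} [MeasurableSpace α] {μ : Measure α} [SigmaFinite μ]
    (k : ℕ) (f : Lp ℂ 2 μ) (F : bosons μ k) :
    creationPart μ k f F = (Real.sqrt (k + 1) : ℂ) •
      (bosons μ (k + 1)).orthogonalProjectionOnto (tensorLeft μ k f F) := rfl

/-- The map `G ↦ √(k+1) Sym (f ⊗ · )* G`. -/
def annihilationPart {α : Type*} [MeasurableSpace α] (μ : Measure α) [SigmaFinite μ] (k : ℕ)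
    (f : Lp ℂ 2 μ) : TensorL2 μ (k + 1) →L[ℂ] bosons μ k :=
  (Real.sqrt (k + 1) : ℂ) •
    ((bosons μ k).orthogonalProjectionOnto ∘L adjoint (tensorLeft μ k f))

theorem inner_sqrt_smul_projection {α : Type*} [MeasurableSpace α] {μ : Measure α} [SigmaFinite μ]
    {k : ℕ} (r : ℝ) (X : TensorL2 μ k) (G : bosons μ k) :
    inner ℂ ((r : ℂ) • (bosons μ k).orthogonalProjectionOnto X) G =
      (r : ℂ) * inner ℂ X (G : TensorL2 μ k) := by
  rw [inner_smul_left, Complex.conj_ofReal,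
    Submodule.inner_orthogonalProjectionOnto_eq_of_mem_right]

theorem inner_projection_smul {α : Type*} [MeasurableSpace α] {μ : Measure α} [SigmaFinite μ]
    {k : ℕ} (r : ℝ) (B : bosons μ k) (X : TensorL2 μ k) :
    inner ℂ B ((r : ℂ) • (bosons μ k).orthogonalProjectionOnto X) =
      (r : ℂ) * inner ℂ (B : TensorL2 μ k) X := by
  have h := congrArg conj (inner_sqrt_smul_projection r X B)
  rwa [inner_conj_symm, map_mul, Complex.conj_ofReal, inner_conj_symm] at h

theorem inner_annihilationPart {α : Type*} [MeasurableSpace α] {μ : Measure α} [SigmaFinite μ]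
    {k : ℕ} (f : Lp ℂ 2 μ) (B : bosons μ k) (G : TensorL2 μ (k + 1)) :
    inner ℂ B (annihilationPart μ k f G) =
      (Real.sqrt (k + 1) : ℂ) * inner ℂ (tensorLeft μ k f B) G := by
  rw [← ContinuousLinearMap.adjoint_inner_right]
  exact inner_projection_smul _ B _

/-- The twisted creation part as a multiple of the phase of `f ⊗ F`. -/
theorem twistedPart_apply' {α : Type*} [MeasurableSpace α] {μ : Measure α} [SigmaFinite μ]
    {s : α → α → ℝ} (hs : Measurable (Function.uncurry s)) (k : ℕ) (f : Lp ℂ 2 μ)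
    (F : bosons μ k) :
    twistedPart hs k f F = (Real.sqrt (k + 1) : ℂ) •
      (bosons μ (k + 1)).orthogonalProjectionOnto
        (phaseMul _ (twist s k) (measurable_twist hs k) (tensorLeft μ k f F)) := rfl

/-- The twist singles out particle `0` and destroys the symmetry of `G`; this is why
`annihilationPart` is defined on all of `L²` and projects afterwards. -/
theorem adjoint_twistedPart_apply {α : Type*} [MeasurableSpace α] {μ : Measure α} [SigmaFinite μ]
    {s : α → α → ℝ} (hs : Measurable (Function.uncurry s)) (k : ℕ) (f : Lp ℂ 2 μ)
    (G : bosons μ (k + 1)) {φ : (Fin (k + 1) → α) → ℝ} (hφ : Measurable φ)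
    (h : ∀ p, φ p = -twist s k p) :
    adjoint (twistedPart hs k f) G = annihilationPart μ k f (phaseMul _ φ hφ G) := by
  refine ext_inner_left ℂ fun B => ?_
  have h' : (fun p => -φ p) = twist s k := by funext p; rw [h, neg_neg]
  rw [ContinuousLinearMap.adjoint_inner_right, inner_annihilationPart, twistedPart_apply',
    inner_sqrt_smul_projection, inner_phaseMul_right]
  simp only [h']

/-! ### Translated creation and annihilation operators as multiplication by phases. -/

section Parts

variable (M : Matrix (Fin (n + 2)) (Fin (n + 2)) ℝ)

/-- The energy-momentum of particle `0`, transformed by `M`. -/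
def headMomentum (m : ℝ) (k : ℕ) (p : Fin (k + 1) → Momentum n) : Spacetime n :=
  act M (onShell m (p 0))

theorem measurable_headMomentum (m : ℝ) (k : ℕ) : Measurable (headMomentum M m k) :=
  ((continuous_act M).comp ((continuous_onShell m).comp (continuous_apply 0))).measurable

/-- The total energy-momentum. -/
def totalMomentum (m : ℝ) (k : ℕ) (p : Fin k → Momentum n) : Spacetime n := ∑ j, onShell m (p j)

theorem measurable_totalMomentum (m : ℝ) (k : ℕ) :
    Measurable (totalMomentum m k : (Fin k → Momentum n) → Spacetime n) :=
  (continuous_finsetSum _ fun j _ =>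
    (continuous_onShell m).comp (continuous_apply j)).measurable

/-- The total energy-momentum of all particles but particle `0`. -/
def tailMomentum (m : ℝ) (k : ℕ) (p : Fin (k + 1) → Momentum n) : Spacetime n :=
  totalMomentum m k fun i => p i.succ

theorem measurable_tailMomentum (m : ℝ) (k : ℕ) :
    Measurable (tailMomentum m k : (Fin (k + 1) → Momentum n) → Spacetime n) :=
  (measurable_totalMomentum m k).comp (measurable_pi_lambda _ fun i => measurable_pi_apply i.succ)

theorem totalPhase_eq (y : Spacetime n) (k : ℕ) (p : Fin k → Momentum n) :
    totalPhase m y k p = minkowski y (totalMomentum m k p) := by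
  rw [totalPhase, totalMomentum, minkowski_sum_right]

theorem totalMomentum_succ (k : ℕ) (p : Fin (k + 1) → Momentum n) :
    totalMomentum m (k + 1) p = onShell m (p 0) + tailMomentum m k p := by
  rw [totalMomentum, Fin.sum_univ_succ]; rfl

theorem twist_shellTwist (k : ℕ) (p : Fin (k + 1) → Momentum n) :
    twist (shellTwist m M) k p = minkowski (onShell m (p 0)) (act M (tailMomentum m k p)) := by
  rw [tailMomentum, totalMomentum, act_sum, minkowski_sum_right]; rfl

variable {M}

/-- In the conjugation by `e^{iMx·P}` the contributions of the old particles cancel, leaving `Mx·p₀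
= -x·Mp₀`. The factor `e^{iy·P}` acts before creation and sees only the old particles. Hence `a =
-Mp₀`, and `b` is the momentum of the tail. -/
theorem translated_creationPart (hM : IsSkew M) (k : ℕ) (f : OneParticle n m)
    (z : Spacetime n × Spacetime n) (F : bosons (shellMeasure n m) k) :
    bosonTranslation m (act M z.1) (k + 1) (creationPart (shellMeasure n m) k f
        (bosonTranslation m (-act M z.1) k (bosonTranslation m z.2 k F))) =
      (Real.sqrt (k + 1) : ℂ) • (bosons (shellMeasure n m) (k + 1)).orthogonalProjectionOnto
        (phaseMul _ (warpPhase (fun p => -headMomentum M m k p) (tailMomentum m k) z)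
          (measurable_warpPhase (measurable_headMomentum M m k).neg
            (measurable_tailMomentum m k) z)
          (tensorLeft (shellMeasure n m) k f F)) := by
  rw [creationPart_apply, map_smul, bosonTranslation_orthogonalProjectionOnto,
    coe_bosonTranslation, coe_bosonTranslation]
  congr 2
  rw [phaseMul_phaseMul _ _ (fun p => totalPhase m (-act M z.1) k p + totalPhase m z.2 k p)
    (measurable_totalPhase m (-act M z.1) k) (measurable_totalPhase m z.2 k)
    ((measurable_totalPhase m (-act M z.1) k).add (measurable_totalPhase m z.2 k))
    (fun _ => rfl)]
  refine phaseMul_tensorLeft_phaseMul _ _ _ (fun p => ?_) f _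
  have hx : minkowski z.1 (headMomentum M m k p) =
      -minkowski (act M z.1) (onShell m (p 0)) := by
    rw [hM, neg_neg]; rfl
  have ht : totalMomentum m k (fun i => p i.succ) = tailMomentum m k p := rfl
  simp only [totalPhase_eq, totalMomentum_succ, warpPhase, minkowski_add_right, minkowski_neg_left,
    minkowski_neg_right, hx, ht]
  ring

/-- Here `e^{-iMx·P}` and `e^{iy·P}` act while particle `0` is still present, so `b` is the total
momentum; after the partial cancellation `-Mx·p₀ = x·Mp₀` remains. All phases are moved to the
creation side of an inner product, where they can be combined. -/
theorem translated_adjoint_creationPart (hM : IsSkew M) (k : ℕ) (f : OneParticle n m)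
    (z : Spacetime n × Spacetime n) (G : bosons (shellMeasure n m) (k + 1)) :
    bosonTranslation m (act M z.1) k (adjoint (creationPart (shellMeasure n m) k f)
        (bosonTranslation m (-act M z.1) (k + 1) (bosonTranslation m z.2 (k + 1) G))) =
      annihilationPart (shellMeasure n m) k f
        (phaseMul _ (warpPhase (headMomentum M m k) (totalMomentum m (k + 1)) z)
          (measurable_warpPhase (measurable_headMomentum M m k)
            (measurable_totalMomentum m (k + 1)) z) G) := by
  refine ext_inner_left ℂ fun B => ?_
  have h1 : ∀ F : bosons (shellMeasure n m) k, inner ℂ B (bosonTranslation m (act M z.1) k F) =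
      inner ℂ (bosonTranslation m (-act M z.1) k B) F := fun F =>
    inner_totalPhase_right (act M z.1) k (B : TensorL2 (shellMeasure n m) k) F
  rw [inner_annihilationPart, h1, ContinuousLinearMap.adjoint_inner_right, creationPart_apply,
    inner_sqrt_smul_projection, coe_bosonTranslation, coe_bosonTranslation, coe_bosonTranslation]
  congr 1
  rw [inner_phaseMul_right, inner_phaseMul_right, inner_phaseMul_right,
    phaseMul_phaseMul (fun p => -totalPhase m z.2 (k + 1) p)
    (fun p => -totalPhase m (-act M z.1) (k + 1) p) (fun p => -totalPhase m z.2 (k + 1) p +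
      -totalPhase m (-act M z.1) (k + 1) p)
    (measurable_totalPhase m z.2 (k + 1)).neg (measurable_totalPhase m (-act M z.1) (k + 1)).neg
    ((measurable_totalPhase m z.2 (k + 1)).neg.add
      (measurable_totalPhase m (-act M z.1) (k + 1)).neg)
    (fun _ => rfl)]
  congr 1
  refine phaseMul_tensorLeft_phaseMul _ _ _ (fun p => ?_) f _
  have hx : minkowski z.1 (headMomentum M m k p) =
      -minkowski (act M z.1) (onShell m (p 0)) := by
    rw [hM, neg_neg]; rfl
  have ht : totalMomentum m k (fun i => p i.succ) = tailMomentum m k p := rfl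
  simp only [totalPhase_eq, totalMomentum_succ, warpPhase, minkowski_add_right, minkowski_neg_left,
    hx, ht]
  ring

theorem twist_eq_minkowski (hM : IsSkew M) (k : ℕ) (p : Fin (k + 1) → Momentum n) :
    twist (shellTwist m M) k p =
      minkowski (-headMomentum M m k p) (tailMomentum m k p) := by
  rw [twist_shellTwist, minkowski_neg_left, headMomentum, hM, neg_neg]

/-- By antisymmetry `Mp₀·p₀ = 0`, so the total momentum may be replaced by that of the tail. The
annihilation phase is thus opposite to the creation phase, as an adjoint requires. -/
theorem neg_twist_eq_minkowski (hM : IsSkew M) (k : ℕ) (p : Fin (k + 1) → Momentum n) :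
    -twist (shellTwist m M) k p =
      minkowski (headMomentum M m k p) (totalMomentum m (k + 1) p) := by
  rw [twist_eq_minkowski hM, minkowski_neg_left, neg_neg, totalMomentum_succ, minkowski_add_right,
    headMomentum, hM.minkowski_self, zero_add]

end Parts

/-! ### Assembling components -/

/-- The regularised warped convolutions of `F` converge to `Φ`. -/
def HasWarpLimit {E : Type*} [NormedAddCommGroup E] [NormedSpace ℂ E]
    (F : Spacetime n × Spacetime n → E) (Φ : E) : Prop :=
  ∀ χ : 𝓢(Spacetime n × Spacetime n, ℂ), χ 0 = 1 →
    (∀ ε : ℝ, 0 < ε → Integrable fun z => warpCoeff χ ε z • F z) ∧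
    Tendsto (fun ε : ℝ => (((2 * Real.pi) ^ (n + 2))⁻¹ : ℂ) • ∫ z, warpCoeff χ ε z • F z)
      (𝓝[>] 0) (𝓝 Φ)

section HasWarpLimit

variable {E E' : Type*} [NormedAddCommGroup E] [NormedSpace ℂ E] [CompleteSpace E]
  [NormedAddCommGroup E'] [NormedSpace ℂ E'] [CompleteSpace E']
  {F F' : Spacetime n × Spacetime n → E} {Φ Φ' : E}

theorem HasWarpLimit.map (h : HasWarpLimit F Φ) (L : E →L[ℂ] E') :
    HasWarpLimit (fun z => L (F z)) (L Φ) := by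
  intro χ hχ
  obtain ⟨h1, h2⟩ := h χ hχ
  have e : ∀ ε, (fun z => warpCoeff χ ε z • L (F z)) = fun z => L (warpCoeff χ ε z • F z) :=
    fun ε => by funext z; rw [map_smul]
  refine ⟨fun ε hε => by rw [e]; exact L.integrable_comp (h1 ε hε), ?_⟩
  refine ((L.continuous.tendsto Φ).comp h2).congr' ?_
  filter_upwards [self_mem_nhdsWithin] with ε hε
  rw [e, L.integral_comp_comm (h1 ε hε), Function.comp_apply, map_smul]

omit [CompleteSpace E] in
theorem HasWarpLimit.add (h : HasWarpLimit F Φ) (h' : HasWarpLimit F' Φ') :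
    HasWarpLimit (fun z => F z + F' z) (Φ + Φ') := by
  intro χ hχ
  obtain ⟨h1, h2⟩ := h χ hχ
  obtain ⟨h1', h2'⟩ := h' χ hχ
  simp only [smul_add]
  refine ⟨fun ε hε => (h1 ε hε).add (h1' ε hε), (h2.add h2').congr' ?_⟩
  filter_upwards [self_mem_nhdsWithin] with ε hε
  rw [integral_add (h1 ε hε) (h1' ε hε), smul_add]

omit [CompleteSpace E] in
theorem HasWarpLimit.zero : HasWarpLimit (fun _ : Spacetime n × Spacetime n => (0 : E)) 0 := by
  intro χ _
  simp

omit [CompleteSpace E] in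
theorem HasWarpLimit.sum {ι : Type*} (s : Finset ι) {G : ι → Spacetime n × Spacetime n → E}
    {Ξ : ι → E} (h : ∀ i ∈ s, HasWarpLimit (G i) (Ξ i)) :
    HasWarpLimit (fun z => ∑ i ∈ s, G i z) (∑ i ∈ s, Ξ i) := by
  classical
  induction s using Finset.induction_on with
  | empty => simpa using HasWarpLimit.zero
  | insert i s hi ih =>
    simp only [Finset.sum_insert hi]
    exact (h i (by simp)).add (ih fun j hj => h j (by simp [hj]))

end HasWarpLimit

theorem hasWarpLimit_phaseMul {Ω : Type*} [MeasurableSpace Ω] {ν : Measure Ω} [SigmaFinite ν]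
    {a b : Ω → Spacetime n} (ha : Measurable a) (hb : Measurable b) (G : Lp ℂ 2 ν)
    {φ : Ω → ℝ} (hφ : Measurable φ) (h : ∀ ω, φ ω = minkowski (a ω) (b ω)) :
    HasWarpLimit (fun z => phaseMul ν (warpPhase a b z) (measurable_warpPhase ha hb z) G)
      (phaseMul ν φ hφ G) := fun χ hχ =>
  ⟨fun _ hε => integrable_warp_phaseMul ha hb G χ hε, tendsto_warp_phaseMul ha hb G χ hχ hφ h⟩

theorem fock_eq_sum_single {α : Type*} [MeasurableSpace α] {μ : Measure α} [SigmaFinite μ]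
    (Ψ : Fock μ) {N : ℕ} (hN : ∀ k, N ≤ k → Ψ k = 0) :
    Ψ = ∑ k ∈ Finset.range N, lp.singleContinuousLinearMap ℂ (fun k => bosons μ k) 2 k (Ψ k) := by
  ext1
  funext k
  rw [lp.coeFn_sum, Finset.sum_apply]
  simp only [lp.singleContinuousLinearMap_apply]
  by_cases hk : k < N
  · rw [Finset.sum_eq_single k (fun j _ hj => lp.single_apply_ne _ _ _ hj.symm)
      (fun h => absurd (Finset.mem_range.2 hk) h), lp.single_apply_self]
  · rw [hN k (not_lt.1 hk)]
    refine (Finset.sum_eq_zero fun j hj => lp.single_apply_ne _ _ _ ?_).symm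
    rintro rfl
    exact hk (Finset.mem_range.1 hj)

/-- The bound `N` on the particle number is the same for all `z`, so the Fock space integrand is a
finite sum of its embedded components and the limits can be taken separately. -/
theorem hasWarpLimit_of_components {α : Type*} [MeasurableSpace α] {μ : Measure α} [SigmaFinite μ]
    {F : Spacetime n × Spacetime n → Fock μ} {Φ : Fock μ} (N : ℕ)
    (hF : ∀ z k, N ≤ k → F z k = 0) (hΦ : ∀ k, N ≤ k → Φ k = 0)
    (h : ∀ k, HasWarpLimit (fun z => F z k) (Φ k)) : HasWarpLimit F Φ := by
  have e : F = fun z => ∑ k ∈ Finset.range N,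
      lp.singleContinuousLinearMap ℂ (fun k => bosons μ k) 2 k (F z k) :=
    funext fun z => fock_eq_sum_single (F z) (hF z)
  rw [e, fock_eq_sum_single Φ hΦ]
  exact HasWarpLimit.sum _ fun k _ => (h k).map _

/-- The translations on finite particle vectors. -/
def translationFinite (m : ℝ) (y : Spacetime n) :
    finiteParticle (shellMeasure n m) →ₗ[ℂ] finiteParticle (shellMeasure n m) :=
  (translation m y).toLinearMap.restrict (diagonal_mem _)

theorem translationFinite_apply (y : Spacetime n) (Ψ : finiteParticle (shellMeasure n m)) (k : ℕ) :
    (translationFinite m y Ψ : Fock (shellMeasure n m)) k =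
      bosonTranslation m y k ((Ψ : Fock (shellMeasure n m)) k) := rfl

theorem hasWarpLimit_raiseOp {M : Matrix (Fin (n + 2)) (Fin (n + 2)) ℝ} (hM : IsSkew M)
    (f : OneParticle n m) (Ψ : finiteParticle (shellMeasure n m)) :
    HasWarpLimit (fun z => ((translationFinite m (act M z.1)
      (raiseOp (fun k => creationPart (shellMeasure n m) k f) (translationFinite m (-act M z.1)
        (translationFinite m z.2 Ψ))) : finiteParticle (shellMeasure n m)) :
          Fock (shellMeasure n m)))
      (raiseOp (fun k => twistedPart (measurable_shellTwist m M) k f) Ψ :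
        finiteParticle (shellMeasure n m)) := by
  obtain ⟨N, hN⟩ := Ψ.2
  -- Creation raises the cutoff in particle number by one.
  refine hasWarpLimit_of_components (N + 1) (fun z k hk => ?_) (fun k hk => ?_) fun k => ?_
  · obtain ⟨k, rfl⟩ : ∃ j, k = j + 1 := ⟨k - 1, by omega⟩
    rw [translationFinite_apply, raiseOp_succ, translationFinite_apply, translationFinite_apply,
      hN k (by omega), map_zero, map_zero, map_zero, map_zero]
  · obtain ⟨k, rfl⟩ : ∃ j, k = j + 1 := ⟨k - 1, by omega⟩
    rw [raiseOp_succ, hN k (by omega), map_zero]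
  · cases k with
    | zero =>
      simp only [translationFinite_apply, raiseOp_zero, map_zero]
      exact HasWarpLimit.zero
    | succ k =>
      simp only [translationFinite_apply, raiseOp_succ, translated_creationPart hM]
      rw [twistedPart_apply']
      exact (hasWarpLimit_phaseMul (measurable_headMomentum M m k).neg
        (measurable_tailMomentum m k) _ (measurable_twist (measurable_shellTwist m M) k)
        (twist_eq_minkowski hM k)).map
        ((Real.sqrt (k + 1) : ℂ) •
          (bosons (shellMeasure n m) (k + 1)).orthogonalProjectionOnto)

theorem hasWarpLimit_lowerOp {M : Matrix (Fin (n + 2)) (Fin (n + 2)) ℝ} (hM : IsSkew M)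
    (f : OneParticle n m) (Ψ : finiteParticle (shellMeasure n m)) :
    HasWarpLimit (fun z => ((translationFinite m (act M z.1)
      (lowerOp (fun k => creationPart (shellMeasure n m) k f) (translationFinite m (-act M z.1)
        (translationFinite m z.2 Ψ))) : finiteParticle (shellMeasure n m)) :
          Fock (shellMeasure n m)))
      (lowerOp (fun k => twistedPart (measurable_shellTwist m M) k f) Ψ :
        finiteParticle (shellMeasure n m)) := by
  obtain ⟨N, hN⟩ := Ψ.2
  refine hasWarpLimit_of_components N (fun z k hk => ?_) (fun k hk => ?_) fun k => ?_
  · rw [translationFinite_apply, lowerOp_apply, translationFinite_apply, translationFinite_apply,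
      hN (k + 1) (by omega), map_zero, map_zero, map_zero, map_zero]
  · rw [lowerOp_apply, hN (k + 1) (by omega), map_zero]
  · simp only [translationFinite_apply, lowerOp_apply, translated_adjoint_creationPart hM]
    rw [adjoint_twistedPart_apply (measurable_shellTwist m M) k f _
      (measurable_twist (measurable_shellTwist m M) k).neg fun _ => rfl]
    exact (hasWarpLimit_phaseMul (measurable_headMomentum M m k)
      (measurable_totalMomentum m (k + 1)) _
      (measurable_twist (measurable_shellTwist m M) k).neg
      (neg_twist_eq_minkowski hM k)).map (annihilationPart (shellMeasure n m) k f)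

/-- The deformed field `φ_{M,X}(f) = Γ(V⁻¹) (a_M(V conj f⁻) + a_M*(V f⁺)) Γ(V)`. -/
def warpedField (hm : 0 < m) (V : OneParticle n m ≃ₗᵢ[ℂ] OneParticle n m)
    (M : Matrix (Fin (n + 2)) (Fin (n + 2)) ℝ) (f : 𝓢(Spacetime n, ℂ)) :
    finiteParticle (shellMeasure n m) →ₗ[ℂ] finiteParticle (shellMeasure n m) :=
  secondQuantFinite V.symm ∘ₗ
    twistedField (measurable_shellTwist m M) (V (conjMinusVector hm f)) (V (plusVector hm f)) ∘ₗ
      secondQuantFinite V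

theorem expXFinite_apply (V : OneParticle n m ≃ₗᵢ[ℂ] OneParticle n m) (y : Spacetime n)
    (Ψ : finiteParticle (shellMeasure n m)) :
    expXFinite V y Ψ =
      secondQuantFinite V.symm (translationFinite m y (secondQuantFinite V Ψ)) := rfl

theorem secondQuantFinite_freeField (hm : 0 < m) (V : OneParticle n m ≃ₗᵢ[ℂ] OneParticle n m)
    (f : 𝓢(Spacetime n, ℂ)) (Ψ : finiteParticle (shellMeasure n m)) :
    secondQuantFinite V (freeField hm f (secondQuantFinite V.symm Ψ)) =
      lowerOp (fun k => creationPart (shellMeasure n m) k (V (conjMinusVector hm f))) Ψ +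
        raiseOp (fun k => creationPart (shellMeasure n m) k (V (plusVector hm f))) Ψ := by
  rw [freeField, LinearMap.add_apply, map_add, creation_eq, annihilation_eq,
    secondQuantFinite_raiseOp, secondQuantFinite_lowerOp, secondQuantFinite_apply_symm_apply]

/-- The inner pairs `Γ(V)Γ(V⁻¹)` cancel, and the one around the free field replaces its vectors by
their images under `V`. One outer factor `Γ(V⁻¹)` and one `Γ(V)` on `Ψ` remain. -/
theorem warpIntegrand_eq (hm : 0 < m) (V : OneParticle n m ≃ₗᵢ[ℂ] OneParticle n m)
    (M : Matrix (Fin (n + 2)) (Fin (n + 2)) ℝ) (f : 𝓢(Spacetime n, ℂ))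
    (χ : 𝓢(Spacetime n × Spacetime n, ℂ)) (ε : ℝ) (Ψ : finiteParticle (shellMeasure n m))
    (z : Spacetime n × Spacetime n) :
    warpIntegrand hm V M f χ ε Ψ z = warpCoeff χ ε z • secondQuant V.symm
      (((translationFinite m (act M z.1)
        (lowerOp (fun k => creationPart (shellMeasure n m) k (V (conjMinusVector hm f)))
          (translationFinite m (-act M z.1) (translationFinite m z.2 (secondQuantFinite V Ψ)))) :
          finiteParticle (shellMeasure n m)) : Fock (shellMeasure n m)) +
        ((translationFinite m (act M z.1)
        (raiseOp (fun k => creationPart (shellMeasure n m) k (V (plusVector hm f)))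
          (translationFinite m (-act M z.1) (translationFinite m z.2 (secondQuantFinite V Ψ)))) :
          finiteParticle (shellMeasure n m)) : Fock (shellMeasure n m))) := by
  have key : expXFinite V (act M z.1) (freeField hm f
      (expXFinite V (-act M z.1) (expXFinite V z.2 Ψ))) = secondQuantFinite V.symm
      (translationFinite m (act M z.1)
        (lowerOp (fun k => creationPart (shellMeasure n m) k (V (conjMinusVector hm f)))
          (translationFinite m (-act M z.1) (translationFinite m z.2 (secondQuantFinite V Ψ)))) +
        translationFinite m (act M z.1)
        (raiseOp (fun k => creationPart (shellMeasure n m) k (V (plusVector hm f)))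
          (translationFinite m (-act M z.1)
            (translationFinite m z.2 (secondQuantFinite V Ψ))))) := by
    simp only [expXFinite_apply, secondQuantFinite_freeField, secondQuantFinite_apply_symm_apply]
    rw [map_add (translationFinite m (act M z.1))]
  rw [warpIntegrand, key, coe_secondQuantFinite, Submodule.coe_add]
  rfl

theorem isWarpedValue_warpedField (hm : 0 < m) (V : OneParticle n m ≃ₗᵢ[ℂ] OneParticle n m)
    {M : Matrix (Fin (n + 2)) (Fin (n + 2)) ℝ} (hM : IsSkew M) (f : 𝓢(Spacetime n, ℂ))
    (Ψ : finiteParticle (shellMeasure n m)) :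
    IsWarpedValue hm V M f Ψ (warpedField hm V M f Ψ : finiteParticle (shellMeasure n m)) := by
  intro χ hχ
  have h := (((hasWarpLimit_lowerOp hM (V (conjMinusVector hm f)) (secondQuantFinite V Ψ)).add
    (hasWarpLimit_raiseOp hM (V (plusVector hm f)) (secondQuantFinite V Ψ))).map
      (secondQuant V.symm).toContinuousLinearMap) χ hχ
  have e : ∀ ε, warpIntegrand hm V M f χ ε Ψ = _ := fun ε =>
    funext fun z => warpIntegrand_eq hm V M f χ ε Ψ z
  simp only [e]
  exact h

end Warped


/-! ### Lorentz transformations and wedges -/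

section Lorentz

variable {n : ℕ} {Λ Λ' N θ : Matrix (Fin (n + 2)) (Fin (n + 2)) ℝ}

theorem act_apply (A : Matrix (Fin (n + 2)) (Fin (n + 2)) ℝ) (x : Spacetime n) (i : Fin (n + 2)) :
    act A x i = ∑ j, A i j * x j := rfl

theorem act_mul (A B : Matrix (Fin (n + 2)) (Fin (n + 2)) ℝ) (x : Spacetime n) :
    act (A * B) x = act A (act B x) := by
  simp [act, Matrix.mulVec_mulVec]

theorem act_one (x : Spacetime n) : act 1 x = x := by
  simp [act]

theorem act_neg (A : Matrix (Fin (n + 2)) (Fin (n + 2)) ℝ) (x : Spacetime n) :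
    act (-A) x = -act A x := by
  ext i; simp [act_apply]

theorem act_single (A : Matrix (Fin (n + 2)) (Fin (n + 2)) ℝ) (i j : Fin (n + 2)) :
    act A (EuclideanSpace.single j 1) i = A i j := by
  simp [act_apply]

/-- The diagonal entries of the Lorentzian metric. -/
def metricSign (i : Fin (n + 2)) : ℝ := if i = 0 then 1 else -1

theorem metricSign_mul_self (i : Fin (n + 2)) : metricSign i * metricSign i = 1 := by
  unfold metricSign; split_ifs <;> norm_num

theorem metricSign_zero : metricSign (0 : Fin (n + 2)) = 1 := rfl

theorem metricSign_succ (i : Fin (n + 1)) : metricSign i.succ = -1 := by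
  simp [metricSign, Fin.succ_ne_zero]

theorem minkowski_eq_sum (x y : Spacetime n) :
    minkowski x y = ∑ i, metricSign i * (x i * y i) := by
  rw [Fin.sum_univ_succ, minkowski, metricSign_zero, one_mul, sub_eq_add_neg,
    ← Finset.sum_neg_distrib]
  simp [metricSign_succ]

theorem minkowski_single (x : Spacetime n) (i : Fin (n + 2)) :
    minkowski x (EuclideanSpace.single i 1) = metricSign i * x i := by
  rw [minkowski_eq_sum]
  simp

theorem IsProperLorentz.isUnit (h : IsProperLorentz Λ) : IsUnit Λ.det := by
  rw [h.2]; exact isUnit_one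

theorem IsProperLorentz.inv_mul (h : IsProperLorentz Λ) : Λ⁻¹ * Λ = 1 :=
  Matrix.nonsing_inv_mul _ h.isUnit

theorem IsProperLorentz.mul_inv (h : IsProperLorentz Λ) : Λ * Λ⁻¹ = 1 :=
  Matrix.mul_nonsing_inv _ h.isUnit

theorem IsProperLorentz.act_inv_act (h : IsProperLorentz Λ) (x : Spacetime n) :
    act Λ⁻¹ (act Λ x) = x := by
  rw [← act_mul, h.inv_mul, act_one]

theorem IsProperLorentz.act_act_inv (h : IsProperLorentz Λ) (x : Spacetime n) :
    act Λ (act Λ⁻¹ x) = x := by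
  rw [← act_mul, h.mul_inv, act_one]

theorem IsProperLorentz.inv (h : IsProperLorentz Λ) : IsProperLorentz Λ⁻¹ := by
  refine ⟨fun x y => ?_, ?_⟩
  · rw [← h.1, h.act_act_inv, h.act_act_inv]
  · rw [Matrix.det_nonsing_inv, h.2, Ring.inverse_one]

theorem IsProperLorentz.mul (h : IsProperLorentz Λ) (h' : IsProperLorentz Λ') :
    IsProperLorentz (Λ * Λ') :=
  ⟨fun x y => by rw [act_mul, act_mul, h.1, h'.1], by rw [Matrix.det_mul, h.2, h'.2, mul_one]⟩

theorem isProperLorentz_one : IsProperLorentz (1 : Matrix (Fin (n + 2)) (Fin (n + 2)) ℝ) :=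
  ⟨fun x y => by rw [act_one, act_one], Matrix.det_one⟩

/-- Invariance of the metric on basis vectors gives `Λ⁻¹ = gΛᵀg`. -/
theorem IsProperLorentz.inv_apply (h : IsProperLorentz Λ) (i j : Fin (n + 2)) :
    Λ⁻¹ i j = metricSign i * metricSign j * Λ j i := by
  have h1 := h.1 (EuclideanSpace.single i 1) (act Λ⁻¹ (EuclideanSpace.single j 1))
  rw [h.act_act_inv, minkowski_single, minkowski_comm, minkowski_single, act_single,
    act_single] at h1
  have h2 := metricSign_mul_self i
  linear_combination (-metricSign i) * h1 + (-Λ⁻¹ i j) * h2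

theorem IsProperLorentz.row_orthogonal (h : IsProperLorentz Λ) (i j : Fin (n + 2)) :
    ∑ k, metricSign k * (Λ i k * Λ j k) = if i = j then metricSign j else 0 := by
  have h1 := congrFun (congrFun h.mul_inv i) j
  rw [Matrix.mul_apply, Matrix.one_apply] at h1
  simp only [h.inv_apply] at h1
  have h2 := metricSign_mul_self j
  have h3 : ∑ k, metricSign k * (Λ i k * Λ j k) =
      metricSign j * ∑ k, Λ i k * (metricSign k * metricSign j * Λ j k) := by
    rw [Finset.mul_sum]
    refine Finset.sum_congr rfl fun k _ => ?_
    linear_combination (-metricSign k * (Λ i k * Λ j k)) * h2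
  rw [h3, h1]
  split_ifs <;> simp

theorem IsSkew.gammaAct (hθ : IsSkew θ) (h : IsProperLorentz Λ) : IsSkew (gammaAct Λ θ) := by
  have key : IsSkew (Λ * θ * Λ⁻¹) := fun x y => by
    simp only [act_mul]
    rw [← h.act_act_inv y, h.1, h.act_act_inv, hθ, ← h.1, h.act_act_inv]
  unfold WarpedField.gammaAct
  split_ifs
  · exact key
  · intro x y
    rw [act_neg, act_neg, minkowski_neg_left, minkowski_neg_right, key]

/-- The `λ` block is symmetric, but its two indices have opposite metric signs; the `η` block is
antisymmetric with equal signs. Either way lowering an index gives an antisymmetric matrix. -/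
theorem IsAdmissible.metricSign_mul (hθ : IsAdmissible θ) (i j : Fin (n + 2)) :
    metricSign j * θ j i = -(metricSign i * θ i j) := by
  obtain ⟨lam, η, -, -, h⟩ := hθ
  have hs : ∀ i : Fin (n + 2), metricSign i = if i.val = 0 then 1 else -1 := fun i => by
    unfold metricSign
    exact if_congr Fin.ext_iff rfl rfl
  rw [h, h, hs, hs]
  split_ifs <;> first | omega | simp

theorem IsAdmissible.isSkew (hθ : IsAdmissible θ) : IsSkew θ := by
  intro x y
  simp only [minkowski_eq_sum, act_apply, Finset.sum_mul, Finset.mul_sum]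
  rw [Finset.sum_comm, ← Finset.sum_neg_distrib]
  refine Finset.sum_congr rfl fun j _ => ?_
  rw [← Finset.sum_neg_distrib]
  refine Finset.sum_congr rfl fun i _ => ?_
  linear_combination x j * y i * hθ.metricSign_mul j i

/-! ### The stabiliser of the right wedge -/

theorem mem_rightWedge {x : Spacetime n} : x ∈ rightWedge n ↔ |x 0| < x 1 := Iff.rfl

/-- The wedge contains the whole line `e₁ + t eⱼ`. Coordinates `0` and `1` of its image are affine
in `t`, and the image stays in the wedge only if both slopes vanish. -/
theorem entries_eq_zero_of_mapsTo (hW : Set.MapsTo (act N) (rightWedge n) (rightWedge n))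
    {j : Fin (n + 2)} (h0 : j ≠ 0) (h1 : j ≠ 1) : N 0 j = 0 ∧ N 1 j = 0 := by
  have key : ∀ t : ℝ, |N 0 1 + t * N 0 j| < N 1 1 + t * N 1 j := by
    intro t
    have hx : (EuclideanSpace.single 1 1 + t • EuclideanSpace.single j 1 : Spacetime n) ∈
        rightWedge n := by
      rw [mem_rightWedge]
      simp [h0.symm, h1.symm]
    have h := hW hx
    rw [mem_rightWedge] at h
    have e : ∀ i, act N (EuclideanSpace.single 1 1 + t • EuclideanSpace.single j 1) i =
        N i 1 + t * N i j := fun i => by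
      simp [act_apply, mul_add, Finset.sum_add_distrib, mul_comm]
    rwa [e, e] at h
  have h2 : N 1 j = 0 := by
    by_contra hne
    -- At this `t` coordinate `1` of the image would vanish, which is impossible inside the wedge.
    have := key (-N 1 1 / N 1 j)
    rw [div_mul_cancel₀ _ hne, add_neg_cancel] at this
    exact absurd this (not_lt.2 (abs_nonneg _))
  refine ⟨?_, h2⟩
  by_contra hne
  -- At this `t` coordinate `0` of the image would equal coordinate `1`.
  have := key ((N 1 1 - N 0 1) / N 0 j)
  rw [div_mul_cancel₀ _ hne, h2, mul_zero, add_zero, add_sub_cancel] at this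
  exact absurd this (not_lt.2 (le_abs_self _))

theorem mapsTo_of_image_eq (hΛ' : IsProperLorentz Λ')
    (h : act Λ '' rightWedge n = act Λ' '' rightWedge n) :
    Set.MapsTo (act (Λ'⁻¹ * Λ)) (rightWedge n) (rightWedge n) := by
  intro x hx
  obtain ⟨y, hy, hyx⟩ : act Λ x ∈ act Λ' '' rightWedge n := h ▸ Set.mem_image_of_mem _ hx
  rw [act_mul, ← hyx, hΛ'.act_inv_act]
  exact hy

/-- The structure of proper Lorentz transformations that stabilise the right wedge. -/
theorem stabiliser_entries (hN : IsProperLorentz N)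
    (hW : Set.MapsTo (act N) (rightWedge n) (rightWedge n))
    (hW' : Set.MapsTo (act N⁻¹) (rightWedge n) (rightWedge n)) :
    (∀ j, j ≠ 0 → j ≠ 1 → N 0 j = 0 ∧ N 1 j = 0 ∧ N j 0 = 0 ∧ N j 1 = 0) ∧
    N 0 0 ^ 2 - N 0 1 ^ 2 = 1 ∧ ∃ s : ℝ, (0 < N 0 0 ∧ s = 1 ∨ N 0 0 < 0 ∧ s = -1) ∧
      N 1 0 = s * N 0 1 ∧ N 1 1 = s * N 0 0 := by
  -- The rows come from `N`, the columns from `N⁻¹`, whose entries are those of the transpose up to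
  -- sign.
  have hz : ∀ j, j ≠ 0 → j ≠ 1 → N 0 j = 0 ∧ N 1 j = 0 ∧ N j 0 = 0 ∧ N j 1 = 0 := by
    intro j h0 h1
    have h2 := entries_eq_zero_of_mapsTo hW h0 h1
    have h3 := entries_eq_zero_of_mapsTo hW' h0 h1
    rw [hN.inv_apply, hN.inv_apply] at h3
    simpa [h2, metricSign, h0] using h3
  have hrow : ∀ i j : Fin (n + 2), (i = 0 ∨ i = 1) →
      N i 0 * N j 0 - N i 1 * N j 1 = if i = j then metricSign j else 0 := by
    intro i j hi
    rw [← hN.row_orthogonal i j, Fin.sum_univ_succ, Fin.sum_univ_succ, metricSign_zero,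
      Finset.sum_eq_zero, add_zero]
    · rw [metricSign_succ, Fin.succ_zero_eq_one]; ring
    · intro k _
      have h0 : k.succ.succ ≠ 0 := Fin.succ_ne_zero _
      have h1 : k.succ.succ ≠ 1 := fun h => Fin.succ_ne_zero k (Fin.succ_injective _ h)
      obtain ⟨e0, e1, -, -⟩ := hz _ h0 h1
      rcases hi with rfl | rfl <;> simp [e0, e1]
  have h00 := hrow 0 0 (Or.inl rfl)
  have h11 := hrow 1 1 (Or.inr rfl)
  have h01 := hrow 0 1 (Or.inl rfl)
  -- The vector `e₁` lies in the wedge, hence so does its image. Positivity of `N₁₁` later forces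
  -- `s` to be the sign of `N₀₀`.
  have hpos : |N 0 1| < N 1 1 := by
    have h := hW (x := EuclideanSpace.single 1 1) (by rw [mem_rightWedge]; simp)
    rwa [mem_rightWedge, act_single, act_single] at h
  simp only [if_true, if_neg (Fin.zero_ne_one : (0 : Fin (n + 2)) ≠ 1), metricSign_zero] at h00 h01
  have hs1 : metricSign (1 : Fin (n + 2)) = -1 := by simp [metricSign]
  rw [if_pos rfl, hs1] at h11
  have hd : 0 < N 1 1 := (abs_nonneg _).trans_lt hpos
  refine ⟨hz, by linear_combination h00, ?_⟩
  -- The upper block preserves the metric of the plane spanned by `e₀` and `e₁`, so its diagonal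
  -- entries agree up to sign.
  have hsq : N 1 1 ^ 2 = N 0 0 ^ 2 := by
    linear_combination (-N 1 1 ^ 2) * h00 - (N 0 0 ^ 2) * h11 +
      (N 0 0 * N 1 0 + N 0 1 * N 1 1) * h01
  have hne : N 0 0 ≠ 0 := by
    intro h
    rw [h] at hsq
    nlinarith
  rcases lt_or_gt_of_ne hne with h | h
  · refine ⟨-1, Or.inr ⟨h, rfl⟩, ?_, ?_⟩
    · have : N 1 1 = -N 0 0 := by
        have : (N 1 1 - N 0 0) * (N 1 1 + N 0 0) = 0 := by linear_combination hsq
        rcases mul_eq_zero.1 this with h' | h' <;> linarith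
      refine mul_left_cancel₀ hne ?_
      linear_combination h01 + N 0 1 * this
    · have : (N 1 1 - N 0 0) * (N 1 1 + N 0 0) = 0 := by linear_combination hsq
      rcases mul_eq_zero.1 this with h' | h' <;> linarith
  · refine ⟨1, Or.inl ⟨h, rfl⟩, ?_, ?_⟩
    · have : N 1 1 = N 0 0 := by
        have : (N 1 1 - N 0 0) * (N 1 1 + N 0 0) = 0 := by linear_combination hsq
        rcases mul_eq_zero.1 this with h' | h' <;> linarith
      refine mul_left_cancel₀ hne ?_
      linear_combination h01 + N 0 1 * this
    · have : (N 1 1 - N 0 0) * (N 1 1 + N 0 0) = 0 := by linear_combination hsq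
      rcases mul_eq_zero.1 this with h' | h' <;> linarith

/-- The lower right block of a proper Lorentz transformation of `ℝ⁴` stabilising the wedge. -/
theorem stabiliser_block {N : Matrix (Fin 4) (Fin 4) ℝ} (hN : IsProperLorentz (n := 2) N)
    (hz : ∀ j, j ≠ 0 → j ≠ 1 → N 0 j = 0 ∧ N 1 j = 0 ∧ N j 0 = 0 ∧ N j 1 = 0)
    (h00 : N 0 0 ^ 2 - N 0 1 ^ 2 = 1) {s : ℝ} (hs : s * s = 1) (h10 : N 1 0 = s * N 0 1)
    (h11 : N 1 1 = s * N 0 0) : N 3 3 = s * N 2 2 ∧ N 3 2 = -s * N 2 3 := by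
  obtain ⟨a02, a12, a20, a21⟩ := hz 2 (by decide) (by decide)
  obtain ⟨a03, a13, a30, a31⟩ := hz 3 (by decide) (by decide)
  have r22 : ∑ k : Fin 4, metricSign (n := 2) k * (N 2 k * N 2 k) = -1 :=
    (hN.row_orthogonal 2 2).trans (by simp [metricSign])
  have r23 : ∑ k : Fin 4, metricSign (n := 2) k * (N 2 k * N 3 k) = 0 :=
    (hN.row_orthogonal 2 3).trans (by simp)
  have hm : metricSign (n := 2) 0 = 1 ∧ metricSign (n := 2) 1 = -1 ∧
      metricSign (n := 2) 2 = -1 ∧ metricSign (n := 2) 3 = -1 := by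
    simp [metricSign]
  simp only [Fin.sum_univ_four, hm.1, hm.2.1, hm.2.2.1, hm.2.2.2, a20, a21, a30, a31] at r22 r23
  -- The determinant factorises over the blocks. The upper block has determinant `s`, so the lower
  -- one does too, as `s² = 1`.
  have hdet : (N 0 0 * N 1 1 - N 0 1 * N 1 0) * (N 2 2 * N 3 3 - N 2 3 * N 3 2) = 1 := by
    have h : Matrix.det (n := Fin 4) N = 1 := hN.2
    rw [← h, Matrix.det_succ_row_zero]
    simp only [Fin.sum_univ_four, Matrix.det_fin_three, Matrix.submatrix_apply]
    simp [Fin.succAbove, a02, a03, a12, a13, a20, a21, a30, a31]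
    ring
  rw [h10, h11] at hdet
  have hb : N 2 2 * N 3 3 - N 2 3 * N 3 2 = s := by
    linear_combination s * hdet - (N 2 2 * N 3 3 - N 2 3 * N 3 2) * (s * s * h00 + hs)
  -- The row `(N₃₂, N₃₃)` is orthogonal to the unit row `(N₂₂, N₂₃)`, and the determinant of the
  -- block is `s`; this linear system determines it.
  constructor
  · linear_combination (N 3 3) * r22 - N 2 3 * r23 + N 2 2 * hb
  · linear_combination (N 3 2) * r22 - N 2 2 * r23 - N 2 3 * hb

/-- The relation holds blockwise. The `λ` block exchanges coordinates `0` and `1`, which produces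
`s` because the second row of `N` is `s` times the first with its entries exchanged. In dimension
four the `η` block generates rotations, and moving an orthogonal `2 × 2` matrix past it produces its
determinant, which is again `s`. -/
theorem mul_admissible (hθ : IsAdmissible θ) (hN : IsProperLorentz N)
    (hz : ∀ j, j ≠ 0 → j ≠ 1 → N 0 j = 0 ∧ N 1 j = 0 ∧ N j 0 = 0 ∧ N j 1 = 0)
    (h00 : N 0 0 ^ 2 - N 0 1 ^ 2 = 1) {s : ℝ} (hs : s * s = 1) (h10 : N 1 0 = s * N 0 1)
    (h11 : N 1 1 = s * N 0 0) : N * θ = s • (θ * N) := by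
  obtain ⟨lam, η, -, hη, h⟩ := hθ
  by_cases hn : n = 2
  · subst hn
    obtain ⟨b33, b32⟩ := stabiliser_block hN hz h00 hs h10 h11
    obtain ⟨a02, a12, a20, a21⟩ := hz 2 (by decide) (by decide)
    obtain ⟨a03, a13, a30, a31⟩ := hz 3 (by decide) (by decide)
    have key : ∀ i j : Fin 4, ∑ k : Fin 4, N i k * θ k j = s * ∑ k : Fin 4, θ i k * N k j := by
      intro i j
      simp only [h, Fin.sum_univ_four]
      fin_cases i <;> fin_cases j <;>
        simp [h10, h11, a02, a03, a12, a13, a20, a21, a30, a31, b32, b33] <;> grind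
    ext i j
    exact key i j
  · have hθ' : ∀ i j : Fin (n + 2), θ i j =
        if (i = 0 ∧ j = 1) ∨ (i = 1 ∧ j = 0) then lam else 0 := fun i j => by
      rw [h, hη hn]
      simp only [Fin.ext_iff, Fin.val_zero, Fin.val_one]
      simp
    have h0 : ∀ k : Fin n, k.succ.succ ≠ 0 := fun k => Fin.succ_ne_zero _
    have h1 : ∀ k : Fin n, k.succ.succ ≠ 1 := fun k h =>
      Fin.succ_ne_zero k (Fin.succ_injective _ h)
    have e1 : ∀ i j, (N * θ) i j = lam * (if j = 0 then N i 1 else if j = 1 then N i 0 else 0) := by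
      intro i j
      rw [Matrix.mul_apply, Fin.sum_univ_succ, Fin.sum_univ_succ, Finset.sum_eq_zero]
      · simp only [hθ', Fin.succ_zero_eq_one]
        by_cases j0 : j = 0
        · simp [j0, mul_comm]
        · by_cases j1 : j = 1 <;> simp [j0, j1, mul_comm]
      · intro k _
        simp [hθ', h0, h1]
    have e2 : ∀ i j, (θ * N) i j = lam * (if i = 0 then N 1 j else if i = 1 then N 0 j else 0) := by
      intro i j
      rw [Matrix.mul_apply, Fin.sum_univ_succ, Fin.sum_univ_succ, Finset.sum_eq_zero]
      · simp only [hθ', Fin.succ_zero_eq_one]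
        by_cases j0 : i = 0
        · simp [j0]
        · by_cases j1 : i = 1 <;> simp [j0, j1]
      · intro k _
        simp [hθ', h0, h1]
    ext i j
    rw [Matrix.smul_apply, smul_eq_mul, e1, e2]
    by_cases i0 : i = 0
    · subst i0
      by_cases j0 : j = 0
      · subst j0
        simp only [if_true, h10]
        linear_combination (-lam * N 0 1) * hs
      · by_cases j1 : j = 1
        · subst j1
          simp only [if_true, if_neg (one_ne_zero : (1 : Fin (n + 2)) ≠ 0), h11]
          linear_combination (-lam * N 0 0) * hs
        · simp [j0, j1, (hz j j0 j1).2.1]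
    · by_cases i1 : i = 1
      · subst i1
        by_cases j0 : j = 0
        · subst j0
          simp only [if_true, if_neg (one_ne_zero : (1 : Fin (n + 2)) ≠ 0), h11]
          ring
        · by_cases j1 : j = 1
          · subst j1
            simp only [if_true, if_neg (one_ne_zero : (1 : Fin (n + 2)) ≠ 0), h10]
            ring
          · simp [j0, j1, (hz j j0 j1).1]
      · simp [i0, i1, (hz i i0 i1).2.2.1, (hz i i0 i1).2.2.2]

theorem IsProperLorentz.abs_apply_zero_one_lt (h : IsProperLorentz Λ) : |Λ 0 1| < |Λ 0 0| := by
  have h1 := h.row_orthogonal 0 0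
  rw [Fin.sum_univ_succ, Fin.sum_univ_succ, if_pos rfl, metricSign_succ, metricSign_zero,
    Fin.succ_zero_eq_one] at h1
  have h2 : ∑ i : Fin n, metricSign i.succ.succ * (Λ 0 i.succ.succ * Λ 0 i.succ.succ) ≤ 0 :=
    Finset.sum_nonpos fun i _ => by
      rw [metricSign_succ]
      nlinarith [mul_self_nonneg (Λ 0 i.succ.succ)]
  exact sq_lt_sq.1 (by nlinarith)

/-- `Q(Λ W₁) = γ_Λ(θ)` depends on the wedge `Λ W₁` only. -/
theorem gammaAct_eq_of_image_eq (hθ : IsAdmissible θ) (hΛ : IsProperLorentz Λ)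
    (hΛ' : IsProperLorentz Λ') (h : act Λ '' rightWedge n = act Λ' '' rightWedge n) :
    gammaAct Λ θ = gammaAct Λ' θ := by
  -- `N` and its inverse both map the wedge into itself, so `stabiliser_entries` applies.
  set N := Λ'⁻¹ * Λ with hNdef
  have hN : IsProperLorentz N := hΛ'.inv.mul hΛ
  have hinv : N⁻¹ = Λ⁻¹ * Λ' := by
    rw [hNdef, Matrix.mul_inv_rev, Matrix.nonsing_inv_nonsing_inv _ hΛ'.isUnit]
  have hW' := mapsTo_of_image_eq hΛ h.symm
  rw [← hinv] at hW'
  obtain ⟨hz, h00, s, hsign, h10, h11⟩ := stabiliser_entries hN (mapsTo_of_image_eq hΛ' h) hW'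
  have hs : s * s = 1 := by
    rcases hsign with ⟨-, rfl⟩ | ⟨-, rfl⟩ <;> norm_num
  have hcomm := mul_admissible hθ hN hz h00 hs h10 h11
  have hΛN : Λ = Λ' * N := by
    rw [hNdef, ← mul_assoc, hΛ'.mul_inv, one_mul]
  have hconj : Λ * θ * Λ⁻¹ = s • (Λ' * θ * Λ'⁻¹) := by
    rw [hΛN, Matrix.mul_inv_rev, mul_assoc Λ' N θ, hcomm, Matrix.mul_smul, Matrix.smul_mul,
      ← mul_assoc Λ' θ N, mul_assoc (Λ' * θ) N, ← mul_assoc N, hN.mul_inv, one_mul]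
  have hentry : Λ 0 0 = Λ' 0 0 * N 0 0 + Λ' 0 1 * N 1 0 := by
    conv_lhs => rw [hΛN]
    rw [Matrix.mul_apply, Fin.sum_univ_succ, Fin.sum_univ_succ, Fin.succ_zero_eq_one,
      Finset.sum_eq_zero, add_zero]
    intro k _
    rw [(hz k.succ.succ (Fin.succ_ne_zero _)
      fun h => Fin.succ_ne_zero k (Fin.succ_injective _ h)).2.2.1, mul_zero]
  have ha := hΛ'.abs_apply_zero_one_lt
  have hb := hN.abs_apply_zero_one_lt
  -- The first summand of `Λ₀₀` dominates, so the time orientation of `Λ` is the product of those of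
  -- `Λ'` and `N`. Its change therefore compensates the sign `s` in `hconj`.
  have hlt : |Λ' 0 1 * N 1 0| < |Λ' 0 0 * N 0 0| := by
    have hs1 : |s| = 1 := by
      rcases hsign with ⟨-, rfl⟩ | ⟨-, rfl⟩ <;> simp
    rw [abs_mul, abs_mul, h10, abs_mul, hs1, one_mul]
    exact mul_lt_mul'' ha hb (abs_nonneg _) (abs_nonneg _)
  have hne : Λ' 0 0 ≠ 0 := abs_pos.1 ((abs_nonneg _).trans_lt ha)
  unfold WarpedField.gammaAct
  rw [hconj]
  rcases hsign with ⟨hpos, rfl⟩ | ⟨hneg, rfl⟩ <;> rcases lt_or_gt_of_ne hne with h' | h'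
  · have h1 : Λ' 0 0 * N 0 0 < 0 := mul_neg_of_neg_of_pos h' hpos
    rw [abs_of_neg h1] at hlt
    have h2 : Λ 0 0 < 0 := by linarith [le_abs_self (Λ' 0 1 * N 1 0)]
    rw [if_neg h2.not_gt, if_neg h'.not_gt, one_smul]
  · have h1 : 0 < Λ' 0 0 * N 0 0 := mul_pos h' hpos
    rw [abs_of_pos h1] at hlt
    have h2 : 0 < Λ 0 0 := by linarith [neg_abs_le (Λ' 0 1 * N 1 0)]
    rw [if_pos h2, if_pos h', one_smul]
  · have h1 : 0 < Λ' 0 0 * N 0 0 := mul_pos_of_neg_of_neg h' hneg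
    rw [abs_of_pos h1] at hlt
    have h2 : 0 < Λ 0 0 := by linarith [neg_abs_le (Λ' 0 1 * N 1 0)]
    rw [if_pos h2, if_neg h'.not_gt, neg_one_smul]
  · have h1 : Λ' 0 0 * N 0 0 < 0 := mul_neg_of_pos_of_neg h' hneg
    rw [abs_of_neg h1] at hlt
    have h2 : Λ 0 0 < 0 := by linarith [le_abs_self (Λ' 0 1 * N 1 0)]
    rw [if_neg h2.not_gt, if_pos h', neg_one_smul, neg_neg]

/-! ### The reflection exchanging the right and the left wedge. -/

theorem image_act_one : act 1 '' rightWedge n = rightWedge n := by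
  rw [Set.image_congr fun x _ => act_one x, Set.image_id']

theorem gammaAct_one : gammaAct 1 θ = θ := by
  simp [gammaAct]

/-- The reflection `x ↦ (-x₀, -x₁, x₂, …)`. -/
def wedgeReflection (n : ℕ) : Matrix (Fin (n + 2)) (Fin (n + 2)) ℝ :=
  Matrix.diagonal fun i => if i.val ≤ 1 then -1 else 1

theorem act_wedgeReflection (x : Spacetime n) (i : Fin (n + 2)) :
    act (wedgeReflection n) x i = (if i.val ≤ 1 then -1 else 1) * x i := by
  simp [act, wedgeReflection, Matrix.mulVec_diagonal]

theorem act_wedgeReflection_self (x : Spacetime n) :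
    act (wedgeReflection n) (act (wedgeReflection n) x) = x := by
  ext i
  rw [act_wedgeReflection, act_wedgeReflection]
  split_ifs <;> ring

theorem wedgeReflection_mul_self : wedgeReflection n * wedgeReflection n = 1 := by
  rw [wedgeReflection, Matrix.diagonal_mul_diagonal, ← Matrix.diagonal_one]
  congr 1
  ext i
  split_ifs <;> norm_num

theorem isProperLorentz_wedgeReflection : IsProperLorentz (wedgeReflection n) := by
  refine ⟨fun x y => ?_, ?_⟩
  · simp only [minkowski_eq_sum, act_wedgeReflection]
    refine Finset.sum_congr rfl fun i _ => ?_
    split_ifs <;> ring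
  · rw [wedgeReflection, Matrix.det_diagonal, Fin.prod_univ_succ, Fin.prod_univ_succ,
      Finset.prod_eq_one]
    · simp
    · intro i _
      simp

theorem image_act_wedgeReflection :
    act (wedgeReflection n) '' rightWedge n = leftWedge n := by
  have h : ∀ x : Spacetime n, x ∈ leftWedge n ↔ act (wedgeReflection n) x ∈ rightWedge n := by
    intro x
    rw [leftWedge, Set.mem_ofPred_eq, mem_rightWedge, mem_rightWedge, act_wedgeReflection,
      act_wedgeReflection]
    simp
  ext x
  rw [h]
  constructor
  · rintro ⟨y, hy, rfl⟩
    rwa [act_wedgeReflection_self]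
  · intro hx
    exact ⟨_, hx, act_wedgeReflection_self x⟩

/-- The reflection is constant on the indices of each block of `θ` and so commutes with it. The sign
comes only from the reversal of time. -/
theorem gammaAct_wedgeReflection (hθ : IsAdmissible θ) : gammaAct (wedgeReflection n) θ = -θ := by
  have h0 : ¬ 0 < wedgeReflection n 0 0 := by
    simp [wedgeReflection]
  have hinv : (wedgeReflection n)⁻¹ = wedgeReflection n :=
    Matrix.inv_eq_right_inv wedgeReflection_mul_self
  rw [gammaAct, if_neg h0, hinv, neg_inj]
  obtain ⟨lam, η, -, -, h⟩ := hθ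
  ext i j
  rw [wedgeReflection, Matrix.mul_diagonal, Matrix.diagonal_mul, h]
  split_ifs <;> first | omega | ring

end Lorentz


/-! ### Shifting a contour across a strip -/

/-- A function which is continuous on the closed strip `0 ≤ Im ζ ≤ a`, holomorphic inside and
of order `(Re ζ)⁻²` has the same integral over both boundary lines. -/
theorem integral_eq_integral_add_mul_I {F : ℂ → ℂ} {a C : ℝ} (ha : 0 ≤ a)
    (hc : ContinuousOn F {ζ | 0 ≤ ζ.im ∧ ζ.im ≤ a})
    (hd : DifferentiableOn ℂ F {ζ | 0 < ζ.im ∧ ζ.im < a})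
    (hb : ∀ ζ : ℂ, 0 ≤ ζ.im → ζ.im ≤ a → ‖F ζ‖ ≤ C * (1 + ζ.re ^ 2)⁻¹) :
    ∫ t : ℝ, F t = ∫ t : ℝ, F (t + a * Complex.I) := by
  have hint : ∀ b : ℝ, 0 ≤ b → b ≤ a → Integrable fun t : ℝ => F (t + b * Complex.I) := by
    intro b h0 h1
    have hcont : Continuous fun t : ℝ => F (t + b * Complex.I) :=
      hc.comp_continuous (by fun_prop) fun t => by simp [h0, h1]
    refine (integrable_inv_one_add_sq.const_mul C).mono' hcont.aestronglyMeasurable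
      (Eventually.of_forall fun t => ?_)
    have := hb (t + b * Complex.I) (by simpa using h0) (by simpa using h1)
    simpa using this
  have h0 := hint 0 le_rfl ha
  have h1 := hint a ha le_rfl
  simp only [Complex.ofReal_zero, zero_mul, add_zero] at h0
  have t0 := intervalIntegral_tendsto_integral h0 tendsto_neg_atTop_atBot tendsto_id
  have t1 := intervalIntegral_tendsto_integral h1 tendsto_neg_atTop_atBot tendsto_id
  -- One estimate for both vertical sides, with `s R = R` and `s R = -R`.
  have hside : ∀ s : ℝ → ℝ, (∀ R, s R ^ 2 = R ^ 2) →
      Tendsto (fun R : ℝ => ∫ y : ℝ in (0 : ℝ)..a, F (s R + y * Complex.I)) atTop (𝓝 0) := by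
    intro s hs
    have hlim : Tendsto (fun R : ℝ => C * (1 + R ^ 2)⁻¹ * |a - 0|) atTop (𝓝 0) := by
      have : Tendsto (fun R : ℝ => (1 + R ^ 2)⁻¹) atTop (𝓝 0) :=
        tendsto_inv_atTop_zero.comp
          (tendsto_atTop_add_const_left _ _ (tendsto_pow_atTop two_ne_zero))
      simpa using (this.const_mul C).mul_const |a - 0|
    refine squeeze_zero_norm (fun R => ?_) hlim
    refine intervalIntegral.norm_integral_le_of_norm_le_const fun y hy => ?_
    rw [Set.uIoc_of_le ha] at hy
    have := hb (s R + y * Complex.I) (by simpa using hy.1.le) (by simpa using hy.2)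
    simpa [hs] using this
  have hrect : ∀ R : ℝ, 0 ≤ R → (∫ t in -R..R, F t) - (∫ t in -R..R, F (t + a * Complex.I)) +
      Complex.I * (∫ y in (0 : ℝ)..a, F (R + y * Complex.I)) -
      Complex.I * (∫ y in (0 : ℝ)..a, F ((-R : ℝ) + y * Complex.I)) = 0 := by
    intro R hR
    have := Complex.integral_boundary_rect_eq_zero_of_continuousOn_of_differentiableOn F
      (-R : ℝ) (R + a * Complex.I) (hc.mono fun ζ hζ => ?_) (hd.mono fun ζ hζ => ?_)
    · simpa using this
    · have := hζ.2
      simpa [Set.uIcc_of_le ha] using this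
    · have := hζ.2
      simpa [ha] using this
  have hzero : (∫ t : ℝ, F t) - (∫ t : ℝ, F (t + a * Complex.I)) + Complex.I * 0 -
      Complex.I * 0 = 0 := by
    refine tendsto_nhds_unique (((t0.sub t1).add ((hside (fun R => R) fun R => rfl).const_mul
      Complex.I)).sub ((hside (fun R => -R) fun R => neg_sq R).const_mul Complex.I)) ?_
    refine tendsto_const_nhds.congr' ?_
    filter_upwards [eventually_ge_atTop 0] with R hR
    exact (hrect R hR).symm
  rw [mul_zero, add_zero, sub_zero] at hzero
  exact sub_eq_zero.1 hzero

/-! ### The mass shell in rapidity coordinates -/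

section Rapidity

variable {n : ℕ} {m : ℝ}

/-- The momentum with first component `t` and remaining components `P`. -/
def consMomentum (t : ℝ) (P : Fin n → ℝ) : Momentum n :=
  WithLp.toLp 2 (Fin.cons t P : Fin (n + 1) → ℝ)

theorem integral_momentum {G : Momentum n → ℂ} (hG : Integrable G) :
    ∫ p, G p = ∫ P : Fin n → ℝ, ∫ t : ℝ, G (consMomentum t P) := by
  have h1 := (volume_preserving_piFinSuccAbove (fun _ : Fin (n + 1) => ℝ) 0).symm
  have h2 := (PiLp.volume_preserving_toLp (Fin (n + 1))).comp h1
  have e : ∀ z : ℝ × (Fin n → ℝ), (WithLp.toLp 2 ∘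
      (MeasurableEquiv.piFinSuccAbove (fun _ : Fin (n + 1) => ℝ) 0).symm) z =
      consMomentum z.1 z.2 := fun z => by
    simp [consMomentum, MeasurableEquiv.piFinSuccAbove]
    rfl
  have hemb : MeasurableEmbedding (WithLp.toLp 2 ∘
      (MeasurableEquiv.piFinSuccAbove (fun _ : Fin (n + 1) => ℝ) 0).symm) :=
    (MeasurableEquiv.toLp 2 (Fin (n + 1) → ℝ)).measurableEmbedding.comp
      (MeasurableEquiv.measurableEmbedding _)
  have hi := (h2.integrable_comp_emb hemb).2 hG
  rw [← h2.integral_comp hemb, Measure.volume_eq_prod, integral_prod_symm]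
  · simp only [e]
  · exact hi

theorem integral_eq_integral_sinh {r : ℝ} (hr : 0 < r) (G : ℝ → ℂ) :
    ∫ t, G t = ∫ u, (r * Real.cosh u : ℝ) • G (r * Real.sinh u) := by
  have h := integral_image_eq_integral_abs_deriv_smul (s := Set.univ)
    (f := fun u => r * Real.sinh u) (f' := fun u => r * Real.cosh u) MeasurableSet.univ
    (fun u _ => ((Real.hasDerivAt_sinh u).const_mul r).hasDerivWithinAt)
    (fun u _ v _ huv => Real.sinh_injective (mul_left_cancel₀ hr.ne' huv)) G
  have hs : (fun u => r * Real.sinh u) '' Set.univ = Set.univ := by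
    rw [Set.image_univ]
    refine Set.range_eq_univ.2 fun t => ?_
    obtain ⟨u, hu⟩ := Real.sinh_surjective (t / r)
    exact ⟨u, by rw [hu, mul_div_cancel₀ _ hr.ne']⟩
  rw [hs, setIntegral_univ, setIntegral_univ] at h
  rw [h]
  refine integral_congr_ae (Eventually.of_forall fun u => ?_)
  simp only [abs_of_pos (mul_pos hr (Real.cosh_pos u))]

/-- The transversal mass `√(m² + P²)`. -/
def transversalMass (m : ℝ) (P : Fin n → ℝ) : ℝ := Real.sqrt (m ^ 2 + ∑ i, P i ^ 2)

theorem transversalMass_pos (hm : 0 < m) (P : Fin n → ℝ) : 0 < transversalMass m P :=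
  Real.sqrt_pos.2 (add_pos_of_pos_of_nonneg (by positivity)
    (Finset.sum_nonneg fun _ _ => sq_nonneg _))

theorem transversalMass_neg (P : Fin n → ℝ) : transversalMass m (-P) = transversalMass m P := by
  simp [transversalMass]

/-- The momentum on the mass shell with rapidity `u` and transversal momentum `P`. -/
def rapidityMomentum (m : ℝ) (u : ℝ) (P : Fin n → ℝ) : Momentum n :=
  consMomentum (transversalMass m P * Real.sinh u) P

theorem energy_rapidityMomentum (u : ℝ) (P : Fin n → ℝ) :
    energy m (rapidityMomentum m u P) = transversalMass m P * Real.cosh u := by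
  have h0 : 0 ≤ m ^ 2 + ∑ i, P i ^ 2 :=
    add_nonneg (sq_nonneg _) (Finset.sum_nonneg fun _ _ => sq_nonneg _)
  have hr : transversalMass m P * transversalMass m P = m ^ 2 + ∑ i, P i ^ 2 :=
    Real.mul_self_sqrt h0
  have hc : 0 ≤ transversalMass m P * Real.cosh u :=
    mul_nonneg (Real.sqrt_nonneg _) (Real.cosh_pos u).le
  rw [energy, Real.sqrt_eq_iff_mul_self_eq
    (add_nonneg (sq_nonneg _) (Finset.sum_nonneg fun _ _ => sq_nonneg _)) hc]
  simp only [rapidityMomentum, consMomentum, Fin.sum_univ_succ, Fin.cons_zero, Fin.cons_succ]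
  linear_combination (-transversalMass m P ^ 2) * Real.cosh_sq u - hr

/-- In rapidity coordinates the Jacobian `r cosh u` equals the energy, so the density `1/(2ω)`
becomes the constant `1/2`. -/
theorem integral_shellMeasure (hm : 0 < m) {G : Momentum n → ℂ}
    (hG : Integrable G (shellMeasure n m)) :
    ∫ p, G p ∂(shellMeasure n m) =
      ∫ P : Fin n → ℝ, ∫ u : ℝ, (2 : ℂ)⁻¹ * G (rapidityMomentum m u P) := by
  have hmeas : Measurable fun p : Momentum n => Real.toNNReal (1 / (2 * energy m p)) :=
    (measurable_const.div ((continuous_energy m).measurable.const_mul 2)).real_toNNReal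
  have hE : ∀ p : Momentum n, 0 ≤ 1 / (2 * energy m p) := fun p => by
    unfold energy; positivity
  have e1 : shellMeasure n m =
      volume.withDensity fun p => (Real.toNNReal (1 / (2 * energy m p)) : ℝ≥0∞) := rfl
  rw [e1, integrable_withDensity_iff_integrable_smul hmeas] at hG
  rw [e1, integral_withDensity_eq_integral_smul hmeas, integral_momentum hG]
  refine integral_congr_ae (Eventually.of_forall fun P => ?_)
  have hr := transversalMass_pos hm P
  simp only
  rw [integral_eq_integral_sinh hr]
  refine integral_congr_ae (Eventually.of_forall fun u => ?_)
  have h1 := energy_rapidityMomentum (m := m) u P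
  have hc := Real.cosh_pos u
  simp only [NNReal.smul_def, Real.coe_toNNReal _ (hE _)]
  rw [rapidityMomentum] at h1 ⊢
  rw [h1, smul_smul, Complex.real_smul]
  congr 1
  have h2 : (Complex.cosh u : ℂ) ≠ 0 := by
    rw [← Complex.ofReal_cosh]
    exact_mod_cast hc.ne'
  have h3 : (transversalMass m P : ℂ) ≠ 0 := by exact_mod_cast hr.ne'
  push_cast
  field_simp

end Rapidity

/-! ### Plane waves at complex rapidity -/

section Waves

open Complex (I)

variable {n : ℕ} {m c r : ℝ} {P : Fin n → ℝ} {f g : 𝓢(Spacetime n, ℂ)}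

/-- The Lorentzian product of `x` with the momentum of transversal mass `r`, transversal momentum
`P` and complex rapidity `ζ`. -/
def complexPairing (r : ℝ) (P : Fin n → ℝ) (ζ : ℂ) (x : Spacetime n) : ℂ :=
  r * (Complex.cosh ζ * x 0 - Complex.sinh ζ * x 1) - (∑ i : Fin n, P i * x i.succ.succ : ℝ)

theorem minkowski_rapidityMomentum (u : ℝ) (P : Fin n → ℝ) (x : Spacetime n) :
    (minkowski (onShell m (rapidityMomentum m u P)) x : ℂ) =
      complexPairing (transversalMass m P) P u x := by
  rw [minkowski, Fin.sum_univ_succ]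
  have h0 : onShell m (rapidityMomentum m u P) 0 = transversalMass m P * Real.cosh u :=
    energy_rapidityMomentum u P
  have h1 : onShell m (rapidityMomentum m u P) (0 : Fin (n + 1)).succ =
      transversalMass m P * Real.sinh u := rfl
  have h2 : ∀ i : Fin n, onShell m (rapidityMomentum m u P) i.succ.succ = P i := fun i => rfl
  simp only [h0, h1, h2, complexPairing]
  rw [Fin.succ_zero_eq_one]
  push_cast
  ring

/-- Crossing: the shift by `iπ` reverses the energy and the first spatial component but not the
transversal momentum. It therefore sends `p` to `-p` with `P` reflected. -/
theorem complexPairing_add_pi (r : ℝ) (P : Fin n → ℝ) (u : ℝ) (x : Spacetime n) :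
    complexPairing r P (u + Real.pi * I) x = -complexPairing r (-P) u x := by
  rw [complexPairing, complexPairing, Complex.cosh_add_pi_mul_I, Complex.sinh_add_pi_mul_I]
  simp only [Pi.neg_apply, neg_mul, Finset.sum_neg_distrib]
  push_cast
  ring

theorem complexPairing_add_smul (r : ℝ) (P : Fin n → ℝ) (ζ : ℂ) (x y : Spacetime n) (t : ℝ) :
    complexPairing r P ζ (x + t • y) = complexPairing r P ζ x + t * complexPairing r P ζ y := by
  have h : ∑ i : Fin n, P i * (x + t • y) i.succ.succ =
      ∑ i : Fin n, P i * x i.succ.succ + t * ∑ i : Fin n, P i * y i.succ.succ := by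
    rw [Finset.mul_sum, ← Finset.sum_add_distrib]
    refine Finset.sum_congr rfl fun i _ => ?_
    rw [PiLp.add_apply, PiLp.smul_apply, smul_eq_mul]
    ring
  unfold complexPairing
  rw [h]
  simp only [PiLp.add_apply, PiLp.smul_apply, smul_eq_mul, Complex.ofReal_add,
    Complex.ofReal_mul]
  ring

theorem complexPairing_im (r : ℝ) (P : Fin n → ℝ) (ζ : ℂ) (x : Spacetime n) :
    (complexPairing r P ζ x).im =
      r * Real.sin ζ.im * (Real.sinh ζ.re * x 0 - Real.cosh ζ.re * x 1) := by
  have h1 : Complex.cosh ζ = (Real.cosh ζ.re * Real.cos ζ.im : ℝ) +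
      (Real.sinh ζ.re * Real.sin ζ.im : ℝ) * I := by
    conv_lhs => rw [← Complex.re_add_im ζ, Complex.cosh_add, Complex.cosh_mul_I,
      Complex.sinh_mul_I]
    push_cast
    ring
  have h2 : Complex.sinh ζ = (Real.sinh ζ.re * Real.cos ζ.im : ℝ) +
      (Real.cosh ζ.re * Real.sin ζ.im : ℝ) * I := by
    conv_lhs => rw [← Complex.re_add_im ζ, Complex.sinh_add, Complex.cosh_mul_I,
      Complex.sinh_mul_I]
    push_cast
    ring
  rw [complexPairing, h1, h2]
  simp only [Complex.sub_im, Complex.mul_im, Complex.add_im, Complex.add_re, Complex.mul_re,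
    Complex.sub_re, Complex.ofReal_re, Complex.ofReal_im, Complex.I_re, Complex.I_im]
  ring

/-- Follows from `|cosh ζ|² = sinh²(Re ζ) + cos²(Im ζ)` and `|sinh t| ≥ |t|`. -/
theorem abs_le_norm_cosh (ζ : ℂ) : |ζ.re| ≤ ‖Complex.cosh ζ‖ := by
  have h1 : Complex.cosh ζ = (Real.cosh ζ.re * Real.cos ζ.im : ℝ) +
      (Real.sinh ζ.re * Real.sin ζ.im : ℝ) * I := by
    conv_lhs => rw [← Complex.re_add_im ζ, Complex.cosh_add, Complex.cosh_mul_I,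
      Complex.sinh_mul_I]
    push_cast
    ring
  have h2 : |ζ.re| ≤ |Real.sinh ζ.re| := by
    rcases le_total 0 ζ.re with h | h
    · exact abs_le_abs_of_nonneg h (Real.self_le_sinh_iff.2 h)
    · exact abs_le_abs_of_nonpos h (Real.sinh_le_self_iff.2 h)
  refine h2.trans (abs_le_of_sq_le_sq' ?_ (norm_nonneg _) |> abs_le.2)
  rw [Complex.sq_norm, h1, Complex.normSq_add_mul_I]
  have h3 := Real.cosh_sq ζ.re
  have h4 := Real.sin_sq_add_cos_sq ζ.im
  have : (Real.cosh ζ.re * Real.cos ζ.im) ^ 2 + (Real.sinh ζ.re * Real.sin ζ.im) ^ 2 =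
      Real.sinh ζ.re ^ 2 + Real.cos ζ.im ^ 2 := by
    linear_combination (Real.cos ζ.im ^ 2) * h3 + (Real.sinh ζ.re ^ 2) * h4
  rw [this]
  nlinarith [sq_nonneg (Real.cos ζ.im)]

/-- The plane wave `x ↦ e^{-i c p x}` at complex rapidity. -/
def wave (c r : ℝ) (P : Fin n → ℝ) (ζ : ℂ) (x : Spacetime n) : ℂ :=
  Complex.exp (-(I * (c * complexPairing r P ζ x)))

/-- The logarithm of the modulus is `r sin(Im ζ)` times `sinh(Re ζ) cx₀ - cosh(Re ζ) cx₁`. The first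
factor is nonnegative on the strip and the second nonpositive when `cx` is in the closed right
wedge. The sign of `c` thus selects the wedge. -/
theorem norm_wave_le_one (hr : 0 ≤ r) {ζ : ℂ} (h0 : 0 ≤ ζ.im) (h1 : ζ.im ≤ Real.pi)
    {x : Spacetime n} (hx : |c * x 0| ≤ c * x 1) : ‖wave c r P ζ x‖ ≤ 1 := by
  rw [wave, Complex.norm_exp, Real.exp_le_one_iff]
  have hs := Real.sin_nonneg_of_nonneg_of_le_pi h0 h1
  have e : (-(I * (c * complexPairing r P ζ x))).re =
      r * Real.sin ζ.im * (Real.sinh ζ.re * (c * x 0) - Real.cosh ζ.re * (c * x 1)) := by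
    rw [Complex.neg_re, Complex.I_mul_re, neg_neg, Complex.im_ofReal_mul, complexPairing_im]
    ring
  rw [e]
  refine mul_nonpos_of_nonneg_of_nonpos (mul_nonneg hr hs) ?_
  have h2 : |Real.sinh ζ.re| ≤ Real.cosh ζ.re := by
    rw [Real.abs_sinh, ← Real.cosh_abs]
    exact (Real.sinh_lt_cosh _).le
  have h3 : Real.sinh ζ.re * (c * x 0) ≤ |Real.sinh ζ.re| * |c * x 0| := by
    rw [← abs_mul]; exact le_abs_self _
  have h4 : |Real.sinh ζ.re| * |c * x 0| ≤ Real.cosh ζ.re * (c * x 1) :=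
    mul_le_mul h2 hx (abs_nonneg _) (Real.cosh_pos _).le
  linarith

theorem continuous_wave_uncurry (c r : ℝ) (P : Fin n → ℝ) :
    Continuous fun z : ℂ × Spacetime n => wave c r P z.1 z.2 := by
  unfold wave complexPairing
  fun_prop

theorem norm_mul_wave_le (hr : 0 ≤ r) {h : Spacetime n → ℂ}
    (hh : ∀ x, h x ≠ 0 → |c * x 0| ≤ c * x 1) {ζ : ℂ} (h0 : 0 ≤ ζ.im) (h1 : ζ.im ≤ Real.pi)
    (x : Spacetime n) : ‖h x * wave c r P ζ x‖ ≤ ‖h x‖ := by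
  by_cases hx : h x = 0
  · simp [hx]
  · rw [norm_mul]
    exact mul_le_of_le_one_right (norm_nonneg _) (norm_wave_le_one hr h0 h1 (hh x hx))

theorem integrable_mul_wave (hr : 0 ≤ r) {h : Spacetime n → ℂ} (hi : Integrable h)
    (hh : ∀ x, h x ≠ 0 → |c * x 0| ≤ c * x 1) {ζ : ℂ} (h0 : 0 ≤ ζ.im) (h1 : ζ.im ≤ Real.pi) :
    Integrable fun x => h x * wave c r P ζ x := by
  refine hi.norm.mono' (hi.aestronglyMeasurable.mul ?_)
    (Eventually.of_forall (norm_mul_wave_le hr hh h0 h1))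
  exact ((continuous_wave_uncurry c r P).comp (Continuous.prodMk_right ζ)).aestronglyMeasurable

/-- The pairing of a test function with a plane wave at complex rapidity. -/
def waveTransform (c r : ℝ) (P : Fin n → ℝ) (h : Spacetime n → ℂ) (ζ : ℂ) : ℂ :=
  ∫ x, h x * wave c r P ζ x

theorem norm_waveTransform_le (hr : 0 ≤ r) {h : Spacetime n → ℂ} (hi : Integrable h)
    (hh : ∀ x, h x ≠ 0 → |c * x 0| ≤ c * x 1) {ζ : ℂ} (h0 : 0 ≤ ζ.im) (h1 : ζ.im ≤ Real.pi) :
    ‖waveTransform c r P h ζ‖ ≤ ∫ x, ‖h x‖ :=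
  norm_integral_le_of_norm_le hi.norm (Eventually.of_forall (norm_mul_wave_le hr hh h0 h1))

theorem continuousOn_waveTransform (hr : 0 ≤ r) {h : Spacetime n → ℂ} (hi : Integrable h)
    (hh : ∀ x, h x ≠ 0 → |c * x 0| ≤ c * x 1) :
    ContinuousOn (waveTransform c r P h) {ζ | 0 ≤ ζ.im ∧ ζ.im ≤ Real.pi} := by
  refine continuousOn_of_dominated (bound := fun x => ‖h x‖) (fun ζ hζ => ?_)
    (fun ζ hζ => Eventually.of_forall (norm_mul_wave_le hr hh hζ.1 hζ.2)) hi.norm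
    (Eventually.of_forall fun x => ?_)
  · exact (integrable_mul_wave hr hi hh hζ.1 hζ.2).aestronglyMeasurable
  · exact (continuous_const.mul
      ((continuous_wave_uncurry c r P).comp (Continuous.prodMk_left x))).continuousOn

theorem hasDerivAt_wave (c r : ℝ) (P : Fin n → ℝ) (ζ : ℂ) (x : Spacetime n) :
    HasDerivAt (fun ζ => wave c r P ζ x)
      (wave c r P ζ x * -(I * (c * (r * (Complex.sinh ζ * x 0 - Complex.cosh ζ * x 1))))) ζ := by
  unfold wave complexPairing
  refine HasDerivAt.cexp ?_
  refine (HasDerivAt.const_mul I (HasDerivAt.const_mul (c : ℂ) ?_)).neg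
  refine HasDerivAt.sub_const _ (HasDerivAt.const_mul (r : ℂ) ?_)
  exact ((Complex.hasDerivAt_cosh ζ).mul_const _).sub ((Complex.hasDerivAt_sinh ζ).mul_const _)

theorem differentiableOn_waveTransform (hr : 0 ≤ r) {h : Spacetime n → ℂ} (hi : Integrable h)
    (hi' : Integrable fun x => ‖x‖ * ‖h x‖)
    (hh : ∀ x, h x ≠ 0 → |c * x 0| ≤ c * x 1) :
    DifferentiableOn ℂ (waveTransform c r P h) {ζ | 0 < ζ.im ∧ ζ.im < Real.pi} := by
  intro ζ₀ hζ₀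
  have hopen : IsOpen {ζ : ℂ | 0 < ζ.im ∧ ζ.im < Real.pi} :=
    (isOpen_lt continuous_const Complex.continuous_im).inter
      (isOpen_lt Complex.continuous_im continuous_const)
  have hcont : Continuous fun ζ : ℂ => |c| * (r * (‖Complex.sinh ζ‖ + ‖Complex.cosh ζ‖)) := by
    fun_prop
  -- Bounds the logarithmic derivative of the wave by `K‖x‖` near `ζ₀`; the summand `1` leaves room
  -- for a neighbourhood.
  set K : ℝ := |c| * (r * (‖Complex.sinh ζ₀‖ + ‖Complex.cosh ζ₀‖)) + 1 with hK
  have hs : {ζ : ℂ | 0 < ζ.im ∧ ζ.im < Real.pi} ∩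
      {ζ | |c| * (r * (‖Complex.sinh ζ‖ + ‖Complex.cosh ζ‖)) < K} ∈ 𝓝 ζ₀ :=
    inter_mem (hopen.mem_nhds hζ₀)
      ((isOpen_lt hcont continuous_const).mem_nhds (by simp [hK]))
  have hmeas : ∀ ζ, AEStronglyMeasurable (fun x => wave c r P ζ x) volume := fun ζ =>
    ((continuous_wave_uncurry c r P).comp (Continuous.prodMk_right ζ)).aestronglyMeasurable
  refine (hasDerivAt_integral_of_dominated_loc_of_deriv_le
    (F := fun ζ x => h x * wave c r P ζ x) (F' := fun ζ x => h x * (wave c r P ζ x *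
      -(I * (c * (r * (Complex.sinh ζ * x 0 - Complex.cosh ζ * x 1))))))
    (bound := fun x => K * (‖x‖ * ‖h x‖)) hs
    (Eventually.of_forall fun ζ => hi.aestronglyMeasurable.mul (hmeas ζ))
    (integrable_mul_wave hr hi hh hζ₀.1.le hζ₀.2.le) ?_ ?_ (hi'.const_mul K)
    (Eventually.of_forall fun x ζ _ => (hasDerivAt_wave c r P ζ x).const_mul (h x))
    ).2.differentiableAt.differentiableWithinAt
  · refine hi.aestronglyMeasurable.mul ((hmeas ζ₀).mul ?_)
    exact Continuous.aestronglyMeasurable (by fun_prop)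
  · refine Eventually.of_forall fun x ζ hζ => ?_
    have h1 := norm_mul_wave_le (P := P) hr hh hζ.1.1.le hζ.1.2.le x
    rw [← mul_assoc, norm_mul, mul_comm K, mul_comm ‖x‖, mul_assoc]
    refine mul_le_mul h1 ?_ (norm_nonneg _) (norm_nonneg _)
    have hx0 : ‖(x 0 : ℂ)‖ ≤ ‖x‖ := by
      rw [Complex.norm_real]; exact PiLp.norm_apply_le x 0
    have hx1 : ‖(x 1 : ℂ)‖ ≤ ‖x‖ := by
      rw [Complex.norm_real]; exact PiLp.norm_apply_le x 1
    have h2 : ‖Complex.sinh ζ * x 0 - Complex.cosh ζ * x 1‖ ≤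
        (‖Complex.sinh ζ‖ + ‖Complex.cosh ζ‖) * ‖x‖ := by
      refine (norm_sub_le _ _).trans ?_
      rw [norm_mul, norm_mul, add_mul]
      gcongr
    rw [norm_neg, norm_mul, Complex.norm_I, one_mul, norm_mul, norm_mul, Complex.norm_real,
      Complex.norm_real, Real.norm_eq_abs, Real.norm_of_nonneg hr]
    calc |c| * (r * ‖Complex.sinh ζ * x 0 - Complex.cosh ζ * x 1‖)
        ≤ |c| * (r * ((‖Complex.sinh ζ‖ + ‖Complex.cosh ζ‖) * ‖x‖)) := by gcongr
      _ = |c| * (r * (‖Complex.sinh ζ‖ + ‖Complex.cosh ζ‖)) * ‖x‖ := by ring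
      _ ≤ K * ‖x‖ := by
        have : |c| * (r * (‖Complex.sinh ζ‖ + ‖Complex.cosh ζ‖)) < K := hζ.2
        gcongr
      _ = ‖x‖ * K := mul_comm _ _

/-- The time derivative of a test function. -/
def timeDeriv (f : 𝓢(Spacetime n, ℂ)) : 𝓢(Spacetime n, ℂ) :=
  LineDeriv.lineDerivOp (EuclideanSpace.single 0 1 : Spacetime n) f

theorem apply_ne_zero_of_tsupport (hf : ∀ x ∈ tsupport f, |c * x 0| ≤ c * x 1) (x : Spacetime n)
    (hx : f x ≠ 0) : |c * x 0| ≤ c * x 1 :=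
  hf x (subset_tsupport _ hx)

theorem timeDeriv_ne_zero_of_tsupport (hf : ∀ x ∈ tsupport f, |c * x 0| ≤ c * x 1)
    (x : Spacetime n) (hx : timeDeriv f x ≠ 0) : |c * x 0| ≤ c * x 1 :=
  hf x (SchwartzMap.tsupport_lineDerivOp_subset _ _ (subset_tsupport _ hx))

/-- Integration by parts in the time variable. -/
theorem waveTransform_timeDeriv (hr : 0 ≤ r)
    (hf : ∀ x ∈ tsupport f, |c * x 0| ≤ c * x 1) {ζ : ℂ} (h0 : 0 ≤ ζ.im) (h1 : ζ.im ≤ Real.pi) :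
    waveTransform c r P (timeDeriv f) ζ =
      I * (c * (r * Complex.cosh ζ)) * waveTransform c r P f ζ := by
  set v : Spacetime n := EuclideanSpace.single 0 1 with hv
  have hfd := apply_ne_zero_of_tsupport hf
  have hfd' := timeDeriv_ne_zero_of_tsupport hf
  -- Differentiating the wave in time multiplies it by `-icr cosh ζ`, which yields the factor of the
  -- statement after integration by parts.
  have hv0 : complexPairing r P ζ v = r * Complex.cosh ζ := by
    simp [complexPairing, hv]
  have hg : ∀ x, HasLineDerivAt ℝ (wave c r P ζ)
      (-(I * (c * (r * Complex.cosh ζ))) * wave c r P ζ x) x v := by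
    intro x
    unfold HasLineDerivAt wave
    simp only [complexPairing_add_smul, hv0]
    have h : HasDerivAt (fun t : ℝ => (t : ℂ)) 1 0 := Complex.ofRealCLM.hasDerivAt
    have := ((((h.mul_const (r * Complex.cosh ζ)).const_add
      (complexPairing r P ζ x)).const_mul (c : ℂ)).const_mul I).neg.cexp
    refine this.congr_deriv ?_
    simp only [Pi.neg_apply, Complex.ofReal_zero, zero_mul, add_zero, one_mul]
    ring
  have key := integral_bilinear_hasLineDerivAt_right_eq_neg_left_of_integrable
    (μ := volume) (B := ContinuousLinearMap.mul ℝ ℂ) (f := f) (f' := timeDeriv f)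
    (g := wave c r P ζ) (g' := fun x => -(I * (c * (r * Complex.cosh ζ))) * wave c r P ζ x) (v := v)
    (integrable_mul_wave hr (timeDeriv f).integrable hfd' h0 h1)
    (by
      have := (integrable_mul_wave (P := P) hr f.integrable hfd h0 h1).const_mul
        (-(I * (c * (r * Complex.cosh ζ))))
      refine this.congr (Eventually.of_forall fun x => ?_)
      simp only [ContinuousLinearMap.mul_apply']
      ring)
    (integrable_mul_wave hr f.integrable hfd h0 h1)
    (fun x _ => by
      have := (f.differentiableAt (x := x)).hasFDerivAt.hasLineDerivAt v
      rwa [← SchwartzMap.lineDerivOp_apply_eq_fderiv] at this) (fun x _ => hg x)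
  simp only [ContinuousLinearMap.mul_apply'] at key
  rw [waveTransform, waveTransform, ← integral_const_mul, ← neg_eq_iff_eq_neg.2 key,
    ← integral_neg]
  refine integral_congr_ae (Eventually.of_forall fun x => ?_)
  simp only
  ring

/-- One time derivative is traded for a factor `r cosh ζ`, giving decay of order `1/|Re ζ|`
uniformly on the strip. A product of two transforms then decays quadratically, as the contour shift
requires. -/
theorem norm_waveTransform_mul_le (hr : 0 ≤ r)
    (hf : ∀ x ∈ tsupport f, |c * x 0| ≤ c * x 1) (hc : |c| = 1) {ζ : ℂ} (h0 : 0 ≤ ζ.im)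
    (h1 : ζ.im ≤ Real.pi) :
    r * |ζ.re| * ‖waveTransform c r P f ζ‖ ≤
      ∫ x, ‖timeDeriv f x‖ := by
  have h := norm_waveTransform_le (P := P) hr (timeDeriv f).integrable
    (timeDeriv_ne_zero_of_tsupport hf) h0 h1
  refine le_trans ?_ h
  refine le_of_le_of_eq ?_ (congrArg norm (waveTransform_timeDeriv hr hf h0 h1)).symm
  rw [norm_mul, norm_mul, norm_mul, norm_mul, Complex.norm_I, Complex.norm_real,
    Complex.norm_real, Real.norm_eq_abs, hc, Real.norm_of_nonneg hr, one_mul, one_mul]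
  gcongr
  exact abs_le_norm_cosh ζ

theorem waveTransform_ofReal (f : 𝓢(Spacetime n, ℂ)) (u : ℝ) :
    waveTransform c (transversalMass m P) P f u =
      ∫ x, f x * Complex.exp (-(I * (c * minkowski (onShell m (rapidityMomentum m u P)) x))) := by
  simp only [waveTransform, wave, minkowski_rapidityMomentum]

theorem waveTransform_add_pi (f : 𝓢(Spacetime n, ℂ)) (u : ℝ) :
    waveTransform c (transversalMass m P) P f (u + Real.pi * I) =
      ∫ x, f x * Complex.exp (I * (c * minkowski (onShell m (rapidityMomentum m u (-P))) x)) := by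
  simp only [waveTransform, wave, minkowski_rapidityMomentum, complexPairing_add_pi,
    transversalMass_neg, mul_neg, neg_neg]

/-- The contour shift in the rapidity variable, at fixed transversal momentum. -/
theorem integral_rapidity_eq (hm : 0 < m) (hf : tsupport f ⊆ rightWedge n)
    (hg : tsupport g ⊆ leftWedge n) {k : Spacetime n} (hk : |k 0| ≤ k 1) (P : Fin n → ℝ) :
    ∫ u : ℝ, testMinus m f (rapidityMomentum m u P) * testPlus m g (rapidityMomentum m u P) *
        Complex.exp (-(I * (2 * minkowski (onShell m (rapidityMomentum m u P)) k))) =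
      ∫ u : ℝ, testMinus m g (rapidityMomentum m u (-P)) *
        testPlus m f (rapidityMomentum m u (-P)) *
        Complex.exp (I * (2 * minkowski (onShell m (rapidityMomentum m u (-P))) k)) := by
  set r := transversalMass m P with hrdef
  have hr : 0 < r := transversalMass_pos hm P
  have hf' : ∀ x ∈ tsupport f, |(1 : ℝ) * x 0| ≤ 1 * x 1 := fun x hx => by
    rw [one_mul, one_mul]
    exact le_of_lt (hf hx)
  have hg' : ∀ x ∈ tsupport g, |(-1 : ℝ) * x 0| ≤ -1 * x 1 := fun x hx => by
    rw [neg_one_mul, neg_one_mul]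
    exact le_of_lt (hg hx)
  have hk' : |(2 : ℝ) * k 0| ≤ 2 * k 1 := by
    rw [abs_mul, abs_two]
    linarith
  have hnorm : ∀ h : 𝓢(Spacetime n, ℂ), Integrable fun x => ‖x‖ * ‖h x‖ := fun h => by
    simpa using h.integrable_pow_mul volume 1
  -- The constants `c` are `1` for `f` in the right wedge, `-1` for `g` in the left wedge, and `2`
  -- for the phase at `k`; each factor is bounded on the strip.
  set F : ℂ → ℂ := fun ζ => waveTransform 1 r P f ζ * waveTransform (-1) r P g ζ *
    wave 2 r P ζ k with hF
  have hwave : ∀ ζ, HasDerivAt (fun ζ => wave 2 r P ζ k) _ ζ := fun ζ => hasDerivAt_wave 2 r P ζ k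
  have hc : ContinuousOn F {ζ | 0 ≤ ζ.im ∧ ζ.im ≤ Real.pi} :=
    ((continuousOn_waveTransform hr.le f.integrable (apply_ne_zero_of_tsupport hf')).mul
      (continuousOn_waveTransform hr.le g.integrable (apply_ne_zero_of_tsupport hg'))).mul
      fun ζ _ => (hwave ζ).continuousAt.continuousWithinAt
  have hd : DifferentiableOn ℂ F {ζ | 0 < ζ.im ∧ ζ.im < Real.pi} :=
    ((differentiableOn_waveTransform hr.le f.integrable (hnorm f)
      (apply_ne_zero_of_tsupport hf')).mul
      (differentiableOn_waveTransform hr.le g.integrable (hnorm g)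
        (apply_ne_zero_of_tsupport hg'))).mul
      fun ζ _ => (hwave ζ).differentiableAt.differentiableWithinAt
  set A0 := ∫ x, ‖f x‖
  set B0 := ∫ x, ‖g x‖
  set A1 := ∫ x, ‖timeDeriv f x‖
  set B1 := ∫ x, ‖timeDeriv g x‖
  -- In `1 + (Re ζ)²` the first summand is controlled by the `L¹` norms of `f` and `g`, the second
  -- by those of their time derivatives, divided by `r²`.
  have hb : ∀ ζ : ℂ, 0 ≤ ζ.im → ζ.im ≤ Real.pi →
      ‖F ζ‖ ≤ (A0 * B0 + A1 * B1 / r ^ 2) * (1 + ζ.re ^ 2)⁻¹ := by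
    intro ζ h0 h1
    have a0 := norm_waveTransform_le (P := P) hr.le f.integrable (apply_ne_zero_of_tsupport hf')
      h0 h1
    have b0 := norm_waveTransform_le (P := P) hr.le g.integrable (apply_ne_zero_of_tsupport hg')
      h0 h1
    have a1 := norm_waveTransform_mul_le (P := P) hr.le hf' (by simp) h0 h1
    have b1 := norm_waveTransform_mul_le (P := P) hr.le hg' (by simp) h0 h1
    have hw : ‖wave 2 r P ζ k‖ ≤ 1 := norm_wave_le_one hr.le h0 h1 hk'
    rw [← div_eq_mul_inv, le_div_iff₀ (by positivity)]
    have hFle : ‖F ζ‖ ≤ ‖waveTransform 1 r P f ζ‖ * ‖waveTransform (-1) r P g ζ‖ := by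
      rw [hF]
      simp only [norm_mul]
      exact mul_le_of_le_one_right (by positivity) hw
    refine (mul_le_mul_of_nonneg_right hFle (by positivity)).trans ?_
    rw [mul_add, mul_one]
    refine add_le_add (mul_le_mul a0 b0 (norm_nonneg _) ((norm_nonneg _).trans a0)) ?_
    rw [le_div_iff₀ (by positivity)]
    refine le_of_eq_of_le ?_ (mul_le_mul a1 b1 (by positivity) ((by positivity : (0 : ℝ) ≤
      r * |ζ.re| * ‖waveTransform 1 r P f ζ‖).trans a1))
    rw [← sq_abs ζ.re]
    ring
  have key := integral_eq_integral_add_mul_I Real.pi_pos.le hc hd hb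
  have hrn : r = transversalMass m (-P) := (transversalMass_neg P).symm
  convert key using 1
  · refine integral_congr_ae (Eventually.of_forall fun u => ?_)
    simp only [hF]
    rw [waveTransform_ofReal, waveTransform_ofReal, wave, testMinus, testPlus,
      minkowski_rapidityMomentum]
    simp [← hrdef]
  -- On the upper line crossing reverses all three exponents, so `f⁻ g⁺` becomes `f⁺ g⁻` at the
  -- reflected transversal momentum.
  · refine integral_congr_ae (Eventually.of_forall fun u => ?_)
    simp only [hF]
    rw [waveTransform_add_pi, waveTransform_add_pi, wave, complexPairing_add_pi, testMinus,
      testPlus, minkowski_rapidityMomentum, ← hrn]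
    simp
    ring

theorem norm_exp_I_mul (t : ℝ) : ‖Complex.exp (I * t)‖ = 1 := by
  rw [mul_comm]; exact Complex.norm_exp_ofReal_mul_I t

theorem integrable_mul_mul_phase {φ ψ : Momentum n → ℂ} (hφ : MemLp φ 2 (shellMeasure n m))
    (hψ : MemLp ψ 2 (shellMeasure n m)) {h : Momentum n → ℝ} (hh : Continuous h) :
    Integrable (fun p => φ p * ψ p * Complex.exp (I * h p)) (shellMeasure n m) := by
  have hi : Integrable (fun p => φ p * ψ p) (shellMeasure n m) := hφ.integrable_mul hψ
  refine hi.norm.mono' (hi.aestronglyMeasurable.mul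
    (Continuous.aestronglyMeasurable (by fun_prop))) (Eventually.of_forall fun p => ?_)
  rw [norm_mul, norm_exp_I_mul, mul_one]

/-- Test functions supported in opposite wedges satisfy the twisted locality relation. -/
theorem integral_testMinus_mul_testPlus (hm : 0 < m) (hf : tsupport f ⊆ rightWedge n)
    (hg : tsupport g ⊆ leftWedge n) {k : Spacetime n} (hk : |k 0| ≤ k 1) :
    ∫ p, testMinus m f p * testPlus m g p *
        Complex.exp (I * ((-(2 * minkowski (onShell m p) k) : ℝ) : ℂ)) ∂(shellMeasure n m) =
      ∫ p, testMinus m g p * testPlus m f p *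
        Complex.exp (I * ((2 * minkowski (onShell m p) k : ℝ) : ℂ)) ∂(shellMeasure n m) := by
  have hcont : Continuous fun p : Momentum n => minkowski (onShell m p) k := by
    simp only [minkowski_comm _ k]
    exact (continuous_minkowski k).comp (continuous_onShell m)
  rw [integral_shellMeasure hm (integrable_mul_mul_phase (memLp_testMinus hm f)
      (memLp_testPlus hm g) (by fun_prop)),
    integral_shellMeasure hm (integrable_mul_mul_phase (memLp_testMinus hm g)
      (memLp_testPlus hm f) (by fun_prop)),
    ← integral_neg_eq_self (μ := volume) fun P : Fin n → ℝ => ∫ u : ℝ, (2 : ℂ)⁻¹ * (testMinus m g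
      (rapidityMomentum m u P) * testPlus m f (rapidityMomentum m u P) * Complex.exp (I *
      ((2 * minkowski (onShell m (rapidityMomentum m u P)) k : ℝ) : ℂ)))]
  -- The reflection `P ↦ -P` left over by the contour shift has been absorbed in the outer integral.
  refine integral_congr_ae (Eventually.of_forall fun P => ?_)
  have := integral_rapidity_eq hm hf hg hk P
  simp only [integral_const_mul]
  congr 1
  simp only [Complex.ofReal_neg, Complex.ofReal_mul, Complex.ofReal_ofNat, mul_neg]
  exact this

end Waves


/-! ### Continuity and hermiticity of the deformed fields -/

section OneParticleVectors

variable {n : ℕ} {m s : ℝ}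

theorem memLp_comp_fourierPoint (hm : 0 < m) (hs : |s| = 1) (g : 𝓢(Spacetime n, ℂ)) :
    MemLp (fun p => g (fourierPoint m s p)) 2 (shellMeasure n m) := by
  have := memLp_fourier hm hs (FourierTransformInv.fourierInv g)
  rwa [FourierTransform.fourier_fourierInv_eq] at this

/-- The exponent `n + 2` exceeds the dimension `n + 1`, so already the first power is integrable;
the square is smaller. -/
theorem memLp_shell_decay (hm : 0 < m) :
    MemLp (fun p : Momentum n => (1 + ‖p‖) ^ (-((n + 2 : ℕ) : ℝ))) 2 (shellMeasure n m) := by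
  refine MemLp.of_measure_le_smul (c := ENNReal.ofReal (1 / (2 * m))) ENNReal.ofReal_ne_top
    (shellMeasure_le hm) ?_
  have hcont : Continuous fun p : Momentum n => (1 + ‖p‖) ^ (-((n + 2 : ℕ) : ℝ)) :=
    (by fun_prop : Continuous fun p : Momentum n => 1 + ‖p‖).rpow_const
      fun p => Or.inl (by positivity)
  rw [memLp_two_iff_integrable_sq_norm hcont.aestronglyMeasurable]
  have hi : Integrable (fun p : Momentum n => (1 + ‖p‖) ^ (-((n + 2 : ℕ) : ℝ))) volume :=
    integrable_one_add_norm (by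
      rw [finrank_euclideanSpace_fin]; push_cast; linarith)
  refine hi.mono' (hcont.norm.pow 2).aestronglyMeasurable (Eventually.of_forall fun p => ?_)
  have h0 : 0 ≤ (1 + ‖p‖) ^ (-((n + 2 : ℕ) : ℝ)) := by positivity
  have h1 : (1 + ‖p‖) ^ (-((n + 2 : ℕ) : ℝ)) ≤ 1 :=
    Real.rpow_le_one_of_one_le_of_nonpos (by linarith [norm_nonneg p]) (by
      rw [neg_nonpos]; positivity)
  rw [Real.norm_of_nonneg (by positivity), Real.norm_of_nonneg h0]
  nlinarith

/-- Only the modulus of `F` enters, so the same bound serves the restriction to the shell and its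
complex conjugate. -/
theorem exists_norm_le_seminorm (hm : 0 < m) (hs : |s| = 1) : ∃ (S : Finset (ℕ × ℕ)) (C : ℝ), 0 ≤ C ∧
    ∀ (g : 𝓢(Spacetime n, ℂ)) (F : OneParticle n m),
      (∀ᵐ p ∂(shellMeasure n m), ‖F p‖ = ‖g (fourierPoint m s p)‖) →
        ‖F‖ ≤ C * S.sup (schwartzSeminormFamily ℂ (Spacetime n) ℂ) g := by
  set c : ℝ := 1 / (2 * Real.pi) with hc
  have hcpos : 0 < c := by positivity
  have hc1 : c ≤ 1 := by
    rw [hc, div_le_one (by positivity)]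
    linarith [Real.pi_gt_three]
  set w := (memLp_shell_decay (n := n) hm).toLp _ with hw
  refine ⟨Finset.Iic (n + 2, 0), 2 ^ (n + 2) * (c⁻¹) ^ (n + 2) * ‖w‖, by positivity,
    fun g F hF => ?_⟩
  set K : ℝ := (Finset.Iic (n + 2, 0)).sup (schwartzSeminormFamily ℂ (Spacetime n) ℂ) g
  rw [mul_assoc, mul_comm ‖w‖, ← mul_assoc]
  refine Lp.norm_le_mul_norm_of_ae_le_mul ?_
  filter_upwards [hF, (memLp_shell_decay (n := n) hm).coeFn_toLp] with p h1 h2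
  have h3 : (1 + ‖fourierPoint m s p‖) ^ (n + 2) * ‖g (fourierPoint m s p)‖ ≤ 2 ^ (n + 2) * K := by
    have h := SchwartzMap.one_add_le_sup_seminorm_apply (𝕜 := ℂ) (m := (n + 2, 0))
      (k := n + 2) (n := 0) le_rfl le_rfl g (fourierPoint m s p)
    rw [norm_iteratedFDeriv_zero] at h
    exact h
  have h4 : c * (1 + ‖p‖) ≤ 1 + ‖fourierPoint m s p‖ := by
    have := norm_le_fourierPoint m hs p
    rw [← hc] at this
    linarith
  have h5 : (c * (1 + ‖p‖)) ^ (n + 2) * ‖g (fourierPoint m s p)‖ ≤ 2 ^ (n + 2) * K :=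
    le_trans (by gcongr) h3
  rw [h1, hw, h2, Real.norm_of_nonneg (by positivity), Real.rpow_neg (by positivity),
    Real.rpow_natCast, ← div_eq_mul_inv, le_div_iff₀ (by positivity), inv_pow]
  rw [mul_pow] at h5
  have h6 : ((c ^ (n + 2))⁻¹ : ℝ) * (c ^ (n + 2) * (1 + ‖p‖) ^ (n + 2) *
      ‖g (fourierPoint m s p)‖) ≤ (c ^ (n + 2))⁻¹ * (2 ^ (n + 2) * K) := by gcongr
  have h7 : c ^ (n + 2) ≠ 0 := by positivity
  rw [← mul_assoc, ← mul_assoc, inv_mul_cancel₀ h7, one_mul] at h6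
  linarith

/-- Restriction of a test function to the mass shell. -/
def shellRestriction (hm : 0 < m) (hs : |s| = 1) : 𝓢(Spacetime n, ℂ) →L[ℂ] OneParticle n m :=
  SchwartzMap.mkCLMtoNormedSpace (fun g => (memLp_comp_fourierPoint hm hs g).toLp _)
    (fun f g => by
      rw [← MemLp.toLp_add]
      rfl)
    (fun a f => by
      rw [RingHom.id_apply, ← MemLp.toLp_const_smul]
      rfl)
    (by
      obtain ⟨S, C, hC, h⟩ := exists_norm_le_seminorm (n := n) hm hs
      refine ⟨S, C, hC, fun f => h f _ ?_⟩
      filter_upwards [(memLp_comp_fourierPoint hm hs f).coeFn_toLp] with p hp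
      rw [hp])

/-- The complex conjugate of the restriction of a test function to the mass shell. -/
def conjShellRestriction (hm : 0 < m) (hs : |s| = 1) :
    𝓢(Spacetime n, ℂ) →SL[starRingEnd ℂ] OneParticle n m :=
  SchwartzMap.mkCLMtoNormedSpace (fun g => (memLp_comp_fourierPoint hm hs g).star.toLp _)
    (fun f g => by
      rw [← MemLp.toLp_add, MemLp.toLp_eq_toLp_iff]
      exact Eventually.of_forall fun p => map_add conj (f _) (g _))
    (fun a f => by
      rw [← MemLp.toLp_const_smul, MemLp.toLp_eq_toLp_iff]
      exact Eventually.of_forall fun p => map_mul conj a (f _))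
    (by
      obtain ⟨S, C, hC, h⟩ := exists_norm_le_seminorm (n := n) hm hs
      refine ⟨S, C, hC, fun f => h f _ ?_⟩
      filter_upwards [(memLp_comp_fourierPoint hm hs f).star.coeFn_toLp] with p hp
      rw [hp, Pi.star_apply, norm_star])

/-- The continuous linear map `f ↦ f⁺`. -/
def plusCLM (hm : 0 < m) : 𝓢(Spacetime n, ℂ) →L[ℂ] OneParticle n m :=
  (shellRestriction hm (by simp : |(1 : ℝ)| = 1)).comp (FourierTransform.fourierCLM ℂ _)

theorem plusCLM_apply (hm : 0 < m) (f : 𝓢(Spacetime n, ℂ)) : plusCLM hm f = plusVector hm f := by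
  refine MemLp.toLp_congr (memLp_comp_fourierPoint hm (by simp) (FourierTransform.fourier f))
    (memLp_testPlus hm f) (Eventually.of_forall fun p => ?_)
  change FourierTransform.fourier f (fourierPoint m 1 p) = testPlus m f p
  rw [← integral_eq_fourier, testPlus]
  simp

/-- The continuous conjugate linear map `f ↦ conj f⁻`. -/
def conjMinusCLM (hm : 0 < m) : 𝓢(Spacetime n, ℂ) →SL[starRingEnd ℂ] OneParticle n m :=
  (conjShellRestriction hm (by simp : |(-1 : ℝ)| = 1)).comp (FourierTransform.fourierCLM ℂ _)

theorem conjMinusCLM_apply (hm : 0 < m) (f : 𝓢(Spacetime n, ℂ)) :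
    conjMinusCLM hm f = conjMinusVector hm f := by
  refine MemLp.toLp_congr
    (memLp_comp_fourierPoint hm (by simp) (FourierTransform.fourier f)).star
    (memLp_testMinus hm f).star (Eventually.of_forall fun p => ?_)
  change conj (FourierTransform.fourier f (fourierPoint m (-1) p)) = conj (testMinus m f p)
  rw [← integral_eq_fourier, testMinus]
  simp

theorem plusVector_add (hm : 0 < m) (f g : 𝓢(Spacetime n, ℂ)) :
    plusVector hm (f + g) = plusVector hm f + plusVector hm g := by
  simp only [← plusCLM_apply, map_add]

theorem plusVector_smul (hm : 0 < m) (a : ℂ) (f : 𝓢(Spacetime n, ℂ)) :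
    plusVector hm (a • f) = a • plusVector hm f := by
  simp only [← plusCLM_apply, map_smul]

theorem conjMinusVector_add (hm : 0 < m) (f g : 𝓢(Spacetime n, ℂ)) :
    conjMinusVector hm (f + g) = conjMinusVector hm f + conjMinusVector hm g := by
  simp only [← conjMinusCLM_apply, map_add]

theorem conjMinusVector_smul (hm : 0 < m) (a : ℂ) (f : 𝓢(Spacetime n, ℂ)) :
    conjMinusVector hm (a • f) = conj a • conjMinusVector hm f := by
  simp only [← conjMinusCLM_apply, map_smulₛₗ]

theorem testPlus_conj {f g : 𝓢(Spacetime n, ℂ)} (h : ∀ x, g x = conj (f x)) (p : Momentum n) :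
    testPlus m g p = conj (testMinus m f p) := by
  rw [testPlus, testMinus, ← integral_conj]
  refine integral_congr_ae (Eventually.of_forall fun x => ?_)
  simp only [h, map_mul, ← Complex.exp_conj, map_neg, Complex.conj_I, Complex.conj_ofReal]
  simp

theorem plusVector_conj (hm : 0 < m) {f g : 𝓢(Spacetime n, ℂ)} (h : ∀ x, g x = conj (f x)) :
    plusVector hm g = conjMinusVector hm f :=
  MemLp.toLp_congr _ _ (Eventually.of_forall (testPlus_conj h))

theorem conjMinusVector_conj (hm : 0 < m) {f g : 𝓢(Spacetime n, ℂ)}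
    (h : ∀ x, g x = conj (f x)) : conjMinusVector hm g = plusVector hm f :=
  (plusVector_conj hm fun x => by rw [h, Complex.conj_conj]).symm

end OneParticleVectors

/-- Continuity into an `ℓ²` direct sum, for maps with finitely many components. -/
theorem continuous_lp_of_components {E : ℕ → Type*} [∀ k, NormedAddCommGroup (E k)] {X : Type*}
    [TopologicalSpace X] {u : X → lp E 2} {N : ℕ} (hN : ∀ x k, N ≤ k → u x k = 0)
    (hu : ∀ k, Continuous fun x => u x k) : Continuous u := by
  have h : u = fun x => ∑ j ∈ Finset.range N, lp.single 2 j (u x j) := by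
    funext x
    ext1
    funext i
    rw [lp.coeFn_sum, Finset.sum_apply]
    by_cases hi : i < N
    · rw [Finset.sum_eq_single i, lp.single_apply_self]
      · intro j _ hj
        exact lp.single_apply_ne 2 j _ hj.symm
      · intro h
        exact absurd (Finset.mem_range.2 hi) h
    · rw [Finset.sum_eq_zero, hN x i (not_lt.1 hi)]
      intro j hj
      exact lp.single_apply_ne 2 j _ (by
        rintro rfl
        exact hi (Finset.mem_range.1 hj))
  rw [h]
  refine continuous_finsetSum _ fun j _ => ?_
  have hiso : Isometry (lp.single (E := E) 2 j) :=
    AddMonoidHomClass.isometry_of_norm (lp.singleAddMonoidHom (E := E) 2 j)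
      fun x => lp.norm_single (by norm_num) j x
  exact hiso.continuous.comp (hu j)

/-! ### Dependence of the twisted fields on their one-particle vectors. -/

section Continuity

open ContinuousLinearMap (adjoint)

variable {α : Type*} [MeasurableSpace α] {μ : Measure α} [SigmaFinite μ]
variable {s : α → α → ℝ} (hs : Measurable (Function.uncurry s)) (k : ℕ)

theorem twistedTensor_add (f g : Lp ℂ 2 μ) (F : TensorL2 μ k) :
    twistedTensor hs k (f + g) F = twistedTensor hs k f F + twistedTensor hs k g F := by
  apply Lp.ext
  filter_upwards [coeFn_twistedTensor hs (f + g) F, coeFn_twistedTensor hs f F,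
    coeFn_twistedTensor hs g F, Lp.coeFn_add (twistedTensor hs k f F) (twistedTensor hs k g F),
    ae_eval (0 : Fin (k + 1)) (Lp.coeFn_add f g)] with p h1 h2 h3 h4 h5
  rw [h1, h4, Pi.add_apply, h2, h3, h5, Pi.add_apply]
  ring

theorem twistedTensor_smul (a : ℂ) (f : Lp ℂ 2 μ) (F : TensorL2 μ k) :
    twistedTensor hs k (a • f) F = a • twistedTensor hs k f F := by
  apply Lp.ext
  filter_upwards [coeFn_twistedTensor hs (a • f) F, coeFn_twistedTensor hs f F,
    Lp.coeFn_smul a (twistedTensor hs k f F),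
    ae_eval (0 : Fin (k + 1)) (Lp.coeFn_smul a f)] with p h1 h2 h3 h4
  rw [h1, h3, Pi.smul_apply, h2, h4, Pi.smul_apply, smul_eq_mul, smul_eq_mul]
  ring

theorem norm_twistedTensor (f : Lp ℂ 2 μ) (F : TensorL2 μ k) :
    ‖twistedTensor hs k f F‖ = ‖f‖ * ‖F‖ :=
  (LinearIsometry.norm_map (phaseMul _ (twist s k) (measurable_twist hs k)) _).trans
    (norm_tensorLeft μ f F)

theorem twistedPart_add (f g : Lp ℂ 2 μ) (F : bosons μ k) :
    twistedPart hs k (f + g) F = twistedPart hs k f F + twistedPart hs k g F := by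
  rw [twistedPart_apply, twistedPart_apply, twistedPart_apply, twistedTensor_add, map_add,
    smul_add]

theorem twistedPart_smul (a : ℂ) (f : Lp ℂ 2 μ) (F : bosons μ k) :
    twistedPart hs k (a • f) F = a • twistedPart hs k f F := by
  rw [twistedPart_apply, twistedPart_apply, twistedTensor_smul, map_smul, smul_comm]

theorem norm_twistedPart_le (f : Lp ℂ 2 μ) :
    ‖twistedPart hs k f‖ ≤ Real.sqrt (k + 1) * ‖f‖ := by
  refine ContinuousLinearMap.opNorm_le_bound _ (by positivity) fun F => ?_
  rw [twistedPart_apply, norm_smul, Complex.norm_real, Real.norm_of_nonneg (Real.sqrt_nonneg _),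
    mul_assoc]
  refine mul_le_mul_of_nonneg_left ?_ (Real.sqrt_nonneg _)
  exact (Submodule.norm_orthogonalProjectionOnto_apply_le _ _).trans
    (norm_twistedTensor hs k f F).le

theorem adjoint_twistedPart_add (f g : Lp ℂ 2 μ) (F : bosons μ (k + 1)) :
    adjoint (twistedPart hs k (f + g)) F =
      adjoint (twistedPart hs k f) F + adjoint (twistedPart hs k g) F := by
  refine ext_inner_left ℂ fun B => ?_
  rw [inner_add_right, ContinuousLinearMap.adjoint_inner_right,
    ContinuousLinearMap.adjoint_inner_right, ContinuousLinearMap.adjoint_inner_right,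
    twistedPart_add, inner_add_left]

theorem adjoint_twistedPart_smul (a : ℂ) (f : Lp ℂ 2 μ) (F : bosons μ (k + 1)) :
    adjoint (twistedPart hs k (a • f)) F = conj a • adjoint (twistedPart hs k f) F := by
  refine ext_inner_left ℂ fun B => ?_
  refine Eq.trans ?_ (inner_smul_right B (adjoint (twistedPart hs k f) F) (conj a)).symm
  rw [ContinuousLinearMap.adjoint_inner_right, ContinuousLinearMap.adjoint_inner_right,
    twistedPart_smul]
  exact inner_smul_left (𝕜 := ℂ) (twistedPart hs k f B) F a

theorem continuous_twistedPart (F : bosons μ k) : Continuous fun f => twistedPart hs k f F :=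
  (LinearMap.mkContinuous (σ := RingHom.id ℂ)
    { toFun := fun f => twistedPart hs k f F
      map_add' := fun f g => twistedPart_add hs k f g F
      map_smul' := fun a f => twistedPart_smul hs k a f F } (Real.sqrt (k + 1) * ‖F‖)
    fun f => by
      refine ((twistedPart hs k f).le_of_opNorm_le (norm_twistedPart_le hs k f) F).trans_eq ?_
      ring).continuous

theorem continuous_adjoint_twistedPart (F : bosons μ (k + 1)) :
    Continuous fun f => adjoint (twistedPart hs k f) F :=
  (LinearMap.mkContinuous (σ := starRingEnd ℂ)
    { toFun := fun f => adjoint (twistedPart hs k f) F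
      map_add' := fun f g => adjoint_twistedPart_add hs k f g F
      map_smul' := fun a f => adjoint_twistedPart_smul hs k a f F } (Real.sqrt (k + 1) * ‖F‖)
    fun f => by
      refine ((adjoint (twistedPart hs k f)).le_of_opNorm_le (c := Real.sqrt (k + 1) * ‖f‖)
        ?_ F).trans_eq ?_
      · rw [LinearIsometryEquiv.norm_map]
        exact norm_twistedPart_le hs k f
      · ring).continuous

theorem twistedField_add (g f g' f' : Lp ℂ 2 μ) (Ψ : finiteParticle μ) :
    twistedField hs (g + g') (f + f') Ψ = twistedField hs g f Ψ + twistedField hs g' f' Ψ := by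
  have hl : lowerOp (fun k => twistedPart hs k (g + g')) Ψ =
      lowerOp (fun k => twistedPart hs k g) Ψ + lowerOp (fun k => twistedPart hs k g') Ψ :=
    finiteParticle_ext fun k => adjoint_twistedPart_add hs k g g' _
  have hr : raiseOp (fun k => twistedPart hs k (f + f')) Ψ =
      raiseOp (fun k => twistedPart hs k f) Ψ + raiseOp (fun k => twistedPart hs k f') Ψ :=
    finiteParticle_ext fun k => by
      cases k with
      | zero => exact (add_zero (0 : bosons μ 0)).symm
      | succ k => exact twistedPart_add hs k f f' _
  simp only [twistedField, LinearMap.add_apply, hl, hr]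
  abel

theorem twistedField_smul (a : ℂ) (g f : Lp ℂ 2 μ) (Ψ : finiteParticle μ) :
    twistedField hs (conj a • g) (a • f) Ψ = a • twistedField hs g f Ψ := by
  have hl : lowerOp (fun k => twistedPart hs k (conj a • g)) Ψ =
      a • lowerOp (fun k => twistedPart hs k g) Ψ :=
    finiteParticle_ext fun k =>
      (adjoint_twistedPart_smul hs k (conj a) g _).trans (by rw [Complex.conj_conj]; rfl)
  have hr : raiseOp (fun k => twistedPart hs k (a • f)) Ψ =
      a • raiseOp (fun k => twistedPart hs k f) Ψ :=
    finiteParticle_ext fun k => by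
      cases k with
      | zero => exact (smul_zero a).symm
      | succ k => exact twistedPart_smul hs k a f _
  simp only [twistedField, LinearMap.add_apply, hl, hr, smul_add]

/-- For fixed `Ψ` the number of nonzero components is bounded independently of `x`, so continuity
may be checked componentwise. -/
theorem continuous_twistedField {X : Type*} [TopologicalSpace X] {g f : X → Lp ℂ 2 μ}
    (hg : Continuous g) (hf : Continuous f) (Ψ : finiteParticle μ) :
    Continuous fun x => (twistedField hs (g x) (f x) Ψ : Fock μ) := by
  obtain ⟨N, hN⟩ := Ψ.2
  have hl : Continuous fun x => (lowerOp (fun k => twistedPart hs k (g x)) Ψ : Fock μ) :=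
    continuous_lp_of_components (N := N)
      (fun x k hk => by rw [lowerOp_apply, hN (k + 1) (by omega), map_zero])
      fun k => (continuous_adjoint_twistedPart hs k _).comp hg
  have hr : Continuous fun x => (raiseOp (fun k => twistedPart hs k (f x)) Ψ : Fock μ) := by
    refine continuous_lp_of_components (N := N + 1) (fun x k hk => ?_) fun k => ?_
    · obtain ⟨k, rfl⟩ : ∃ j, k = j + 1 := ⟨k - 1, by omega⟩
      rw [raiseOp_succ, hN k (by omega), map_zero]
    · cases k with
      | zero => exact continuous_const
      | succ k => exact (continuous_twistedPart hs k _).comp hf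
  exact hl.add hr

end Continuity

/-! ### Dependence of the deformed field on the test function. -/

section WarpedFields

variable {n : ℕ} {m : ℝ} (hm : 0 < m) (V : OneParticle n m ≃ₗᵢ[ℂ] OneParticle n m)
  (M : Matrix (Fin (n + 2)) (Fin (n + 2)) ℝ)

theorem warpedField_add (f g : 𝓢(Spacetime n, ℂ)) (Ψ : finiteParticle (shellMeasure n m)) :
    warpedField hm V M (f + g) Ψ = warpedField hm V M f Ψ + warpedField hm V M g Ψ := by
  have h := twistedField_add (measurable_shellTwist m M) (V (conjMinusVector hm f))
    (V (plusVector hm f)) (V (conjMinusVector hm g)) (V (plusVector hm g))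
    (secondQuantFinite V Ψ)
  have e1 : V (conjMinusVector hm (f + g)) = V (conjMinusVector hm f) + V (conjMinusVector hm g) :=
    (congrArg V (conjMinusVector_add hm f g)).trans (map_add V _ _)
  have e2 : V (plusVector hm (f + g)) = V (plusVector hm f) + V (plusVector hm g) :=
    (congrArg V (plusVector_add hm f g)).trans (map_add V _ _)
  have h0 := congrArg₂ (twistedField (measurable_shellTwist m M)) e1 e2
  have h := (LinearMap.congr_fun h0 (secondQuantFinite V Ψ)).trans h
  exact (congrArg (secondQuantFinite V.symm) h).trans (LinearMap.map_add _ _ _)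

theorem warpedField_smul (a : ℂ) (f : 𝓢(Spacetime n, ℂ))
    (Ψ : finiteParticle (shellMeasure n m)) :
    warpedField hm V M (a • f) Ψ = a • warpedField hm V M f Ψ := by
  have h := twistedField_smul (measurable_shellTwist m M) a (V (conjMinusVector hm f))
    (V (plusVector hm f)) (secondQuantFinite V Ψ)
  have e1 : V (conjMinusVector hm (a • f)) = conj a • V (conjMinusVector hm f) :=
    (congrArg V (conjMinusVector_smul hm a f)).trans (map_smul V _ _)
  have e2 : V (plusVector hm (a • f)) = a • V (plusVector hm f) :=
    (congrArg V (plusVector_smul hm a f)).trans (map_smul V _ _)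
  have h0 := congrArg₂ (twistedField (measurable_shellTwist m M)) e1 e2
  have h := (LinearMap.congr_fun h0 (secondQuantFinite V Ψ)).trans h
  exact (congrArg (secondQuantFinite V.symm) h).trans (LinearMap.map_smul _ _ _)

/-- The deformed field, as a linear map of the test function. -/
def warpedFieldLinear : 𝓢(Spacetime n, ℂ) →ₗ[ℂ]
    finiteParticle (shellMeasure n m) →ₗ[ℂ] finiteParticle (shellMeasure n m) where
  toFun f := warpedField hm V M f
  map_add' f g := LinearMap.ext (warpedField_add hm V M f g)
  map_smul' a f := LinearMap.ext (warpedField_smul hm V M a f)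

theorem warpedFieldLinear_apply (f : 𝓢(Spacetime n, ℂ)) :
    warpedFieldLinear hm V M f = warpedField hm V M f := rfl

theorem continuous_warpedField (Ψ : finiteParticle (shellMeasure n m)) :
    Continuous fun f => (warpedField hm V M f Ψ : Fock (shellMeasure n m)) := by
  have hg : Continuous fun f => V (conjMinusVector hm f) := by
    simp only [← conjMinusCLM_apply]
    exact V.continuous.comp (conjMinusCLM hm).continuous
  have hf : Continuous fun f => V (plusVector hm f) := by
    simp only [← plusCLM_apply]
    exact V.continuous.comp (plusCLM hm).continuous
  exact (secondQuant V.symm).continuous.comp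
    (continuous_twistedField (measurable_shellTwist m M) hg hf (secondQuantFinite V Ψ))

/-- Conjugating the test function exchanges the two one-particle vectors, which is also the effect
of passing to the adjoint of the twisted field. -/
theorem inner_warpedField {f g : 𝓢(Spacetime n, ℂ)} (h : ∀ x, g x = conj (f x))
    (Ψ Φ : finiteParticle (shellMeasure n m)) :
    inner ℂ (warpedField hm V M f Ψ : Fock (shellMeasure n m)) (Φ : Fock (shellMeasure n m)) =
      inner ℂ (Ψ : Fock (shellMeasure n m)) (warpedField hm V M g Φ : Fock (shellMeasure n m)) := by
  simp only [warpedField, LinearMap.comp_apply]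
  rw [inner_secondQuantFinite, inner_twistedField, plusVector_conj hm h,
    conjMinusVector_conj hm h]
  have := inner_secondQuantFinite V.symm Ψ (twistedField (measurable_shellTwist m M)
    (V (plusVector hm f)) (V (conjMinusVector hm f)) (secondQuantFinite V Φ))
  rwa [LinearIsometryEquiv.symm_symm] at this

end WarpedFields


/-! ### Wedge-locality -/

section WedgeLocality

variable {n : ℕ} {m : ℝ} {θ : Matrix (Fin (n + 2)) (Fin (n + 2)) ℝ}

theorem IsAdmissible.act_apply_zero_one (hθ : IsAdmissible θ) : ∃ lam : ℝ, 0 ≤ lam ∧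
    ∀ x : Spacetime n, act θ x 0 = lam * x 1 ∧ act θ x 1 = lam * x 0 := by
  obtain ⟨lam, η, hlam, -, h⟩ := hθ
  refine ⟨lam, hlam, fun x => ?_⟩
  rw [act_apply, act_apply, Fin.sum_univ_succ, Fin.sum_univ_succ, Finset.sum_eq_zero,
    Fin.sum_univ_succ, Fin.sum_univ_succ, Finset.sum_eq_zero]
  · simp [h]
  · intro i _
    simp [h]
  · intro i _
    simp [h]

theorem abs_onShell_one_le (p : Momentum n) : |onShell m p 1| ≤ onShell m p 0 := by
  change |p 0| ≤ Real.sqrt (m ^ 2 + ∑ i, p i ^ 2)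
  refine Real.abs_le_sqrt ?_
  have := Finset.single_le_sum (f := fun i => p i ^ 2) (fun i _ => sq_nonneg (p i))
    (Finset.mem_univ 0)
  nlinarith [sq_nonneg m]

/-- Admissible matrices map sums of on-shell momenta into the closed right wedge. -/
theorem IsAdmissible.abs_act_sum_le (hθ : IsAdmissible θ) {k : ℕ} (q : Fin k → Momentum n) :
    |(∑ j, act θ (onShell m (q j))) 0| ≤ (∑ j, act θ (onShell m (q j))) 1 := by
  obtain ⟨lam, hlam, h⟩ := hθ.act_apply_zero_one
  simp only [WithLp.ofLp_sum, Finset.sum_apply, (h _).1, (h _).2]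
  refine (Finset.abs_sum_le_sum_abs _ _).trans (Finset.sum_le_sum fun j _ => ?_)
  rw [abs_mul, abs_of_nonneg hlam]
  exact mul_le_mul_of_nonneg_left (abs_onShell_one_le _) hlam

theorem shellTwist_neg (M : Matrix (Fin (n + 2)) (Fin (n + 2)) ℝ) (p q : Momentum n) :
    shellTwist m (-M) p q = -shellTwist m M p q := by
  rw [shellTwist, act_neg, minkowski_neg_right, shellTwist]

/-- The reason for giving opposite wedges opposite matrices: it supplies the transposition relation
needed by the exchange relation. -/
theorem IsSkew.shellTwist_neg_comm (hM : IsSkew θ) (p q : Momentum n) :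
    shellTwist m (-θ) p q = shellTwist m θ q p := by
  rw [shellTwist_neg, shellTwist, shellTwist, ← hM, minkowski_comm]

theorem integral_conjMinusVector_mul_plusVector (hm : 0 < m) (f g : 𝓢(Spacetime n, ℂ))
    (h : Momentum n → ℂ) :
    ∫ p, conj (conjMinusVector hm f p) * plusVector hm g p * h p ∂(shellMeasure n m) =
      ∫ p, testMinus m f p * testPlus m g p * h p ∂(shellMeasure n m) := by
  refine integral_congr_ae ?_
  filter_upwards [(memLp_testMinus hm f).star.coeFn_toLp, (memLp_testPlus hm g).coeFn_toLp]
    with p h1 h2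
  rw [conjMinusVector, plusVector, h1, h2, Pi.star_apply]
  congr 2
  exact Complex.conj_conj _

theorem twistedField_wedge_comm (hm : 0 < m) (hθ : IsAdmissible θ) {f g : 𝓢(Spacetime n, ℂ)}
    (hf : tsupport f ⊆ rightWedge n) (hg : tsupport g ⊆ leftWedge n)
    (Ψ : finiteParticle (shellMeasure n m)) :
    twistedField (measurable_shellTwist m θ) (conjMinusVector hm f) (plusVector hm f)
        (twistedField (measurable_shellTwist m (-θ)) (conjMinusVector hm g) (plusVector hm g) Ψ) =
      twistedField (measurable_shellTwist m (-θ)) (conjMinusVector hm g) (plusVector hm g)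
        (twistedField (measurable_shellTwist m θ) (conjMinusVector hm f) (plusVector hm f) Ψ) := by
  refine twistedField_comm _ _ hθ.isSkew.shellTwist_neg_comm _ _ _ _ (fun k F => ?_) Ψ
  refine adjoint_twistedTensor_mixed _ _ _ _ _ _ k (fun q => ?_) F
  have hsum : ∀ p, ∑ j, shellTwist m θ p (q j) =
      minkowski (onShell m p) (∑ j, act θ (onShell m (q j))) := fun p =>
    (minkowski_sum_right _ _ _).symm
  -- The opposite twists add up to the phase `∓2 p·k` with `k = ∑ⱼ θqⱼ`, a vector of the closed
  -- right wedge by `IsAdmissible.abs_act_sum_le`.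
  have e1 : ∀ p, ∑ j, shellTwist m (-θ) p (q j) - ∑ j, shellTwist m θ p (q j) =
      -(2 * minkowski (onShell m p) (∑ j, act θ (onShell m (q j)))) := fun p => by
    simp only [shellTwist_neg, Finset.sum_neg_distrib, hsum]
    ring
  have e2 : ∀ p, ∑ j, shellTwist m θ p (q j) - ∑ j, shellTwist m (-θ) p (q j) =
      2 * minkowski (onShell m p) (∑ j, act θ (onShell m (q j))) := fun p => by
    simp only [shellTwist_neg, Finset.sum_neg_distrib, hsum]
    ring
  simp only [e1, e2]
  exact (integral_conjMinusVector_mul_plusVector hm f g _).trans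
    ((integral_testMinus_mul_testPlus hm hf hg (hθ.abs_act_sum_le q)).trans
      (integral_conjMinusVector_mul_plusVector hm g f _).symm)

/-- The factors `Γ(V)Γ(V⁻¹)` between the two fields cancel, and the vectors twisted inside are those
of the images `f'` and `g'`, so only the supports of the images matter. -/
theorem warpedField_comm (hm : 0 < m) (hθ : IsAdmissible θ)
    (V : OneParticle n m ≃ₗᵢ[ℂ] OneParticle n m) {f g f' g' : 𝓢(Spacetime n, ℂ)}
    (hf : IsImage hm V f f') (hg : IsImage hm V g g') (hf' : tsupport f' ⊆ rightWedge n)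
    (hg' : tsupport g' ⊆ leftWedge n) (Ψ : finiteParticle (shellMeasure n m)) :
    warpedField hm V θ f (warpedField hm V (-θ) g Ψ) =
      warpedField hm V (-θ) g (warpedField hm V θ f Ψ) := by
  have h := twistedField_wedge_comm hm hθ hf' hg' (secondQuantFinite V Ψ)
  rw [hf.1, hf.2, hg.1, hg.2] at h
  simp only [warpedField, LinearMap.comp_apply, secondQuantFinite_apply_symm_apply]
  exact congrArg (secondQuantFinite V.symm) h

open Classical in
/-- The family `W ↦ φ_{Q(W),X}` of deformed fields. -/
def warpedFamily (hm : 0 < m) (V : OneParticle n m ≃ₗᵢ[ℂ] OneParticle n m)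
    (θ : Matrix (Fin (n + 2)) (Fin (n + 2)) ℝ) : FieldFamily n m := fun W =>
  if h : ∃ Λ, IsProperLorentz Λ ∧ W = act Λ '' rightWedge n then
    warpedFieldLinear hm V (gammaAct h.choose θ) else 0

theorem warpedFamily_image (hm : 0 < m) (V : OneParticle n m ≃ₗᵢ[ℂ] OneParticle n m)
    (hθ : IsAdmissible θ) {Λ : Matrix (Fin (n + 2)) (Fin (n + 2)) ℝ} (hΛ : IsProperLorentz Λ)
    (f : 𝓢(Spacetime n, ℂ)) :
    warpedFamily hm V θ (act Λ '' rightWedge n) f = warpedField hm V (gammaAct Λ θ) f := by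
  have h : ∃ Λ', IsProperLorentz Λ' ∧ act Λ '' rightWedge n = act Λ' '' rightWedge n :=
    ⟨Λ, hΛ, rfl⟩
  rw [warpedFamily, dif_pos h, warpedFieldLinear_apply,
    gammaAct_eq_of_image_eq hθ h.choose_spec.1 hΛ h.choose_spec.2.symm]

theorem warpedFamily_rightWedge (hm : 0 < m) (V : OneParticle n m ≃ₗᵢ[ℂ] OneParticle n m)
    (hθ : IsAdmissible θ) (f : 𝓢(Spacetime n, ℂ)) :
    warpedFamily hm V θ (rightWedge n) f = warpedField hm V θ f := by
  have h := warpedFamily_image hm V hθ isProperLorentz_one f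
  rwa [image_act_one, gammaAct_one] at h

theorem warpedFamily_leftWedge (hm : 0 < m) (V : OneParticle n m ≃ₗᵢ[ℂ] OneParticle n m)
    (hθ : IsAdmissible θ) (f : 𝓢(Spacetime n, ℂ)) :
    warpedFamily hm V θ (leftWedge n) f = warpedField hm V (-θ) f := by
  have h := warpedFamily_image hm V hθ isProperLorentz_wedgeReflection f
  rwa [image_act_wedgeReflection, gammaAct_wedgeReflection hθ] at h

end WedgeLocality

end
end WarpedField

theorem mainTheorem1 (n : ℕ) (m : ℝ) (hm : 0 < m)
    (θ : Matrix (Fin (n + 2)) (Fin (n + 2)) ℝ) (hθ : IsAdmissible θ)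
    (V : OneParticle n m ≃ₗᵢ[ℂ] OneParticle n m)
    (hright : PreservesSupport hm V (rightWedge n))
    (hleft : PreservesSupport hm V (leftWedge n)) :
    ∃ φ : FieldFamily n m, IsWarpedFamily hm V θ φ ∧ IsWedgeLocal φ := by
  refine ⟨warpedFamily hm V θ, fun Λ hΛ f Ψ => ?_, ?_, ?_, ?_⟩
  · rw [warpedFamily_image hm V hθ hΛ]
    exact isWarpedValue_warpedField hm V (hθ.isSkew.gammaAct hΛ) f Ψ
  · rintro W ⟨Λ, hΛ, rfl⟩ Ψ
    simp only [warpedFamily_image hm V hθ hΛ]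
    exact continuous_warpedField hm V (gammaAct Λ θ) Ψ
  · rintro W ⟨Λ, hΛ, rfl⟩ f g h Ψ Φ
    rw [warpedFamily_image hm V hθ hΛ, warpedFamily_image hm V hθ hΛ]
    exact inner_warpedField hm V (gammaAct Λ θ) h Ψ Φ
  -- Compact support serves to obtain the images under `V`. These are merely Schwartz functions
  -- supported in the wedges, which suffices for the contour shift.
  · intro f g hfc hgc hf hg Ψ
    obtain ⟨f', hf', hff'⟩ := hright f hfc hf
    obtain ⟨g', hg', hgg'⟩ := hleft g hgc hg
    rw [warpedFamily_rightWedge hm V hθ, warpedFamily_leftWedge hm V hθ]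
    exact warpedField_comm hm hθ V hff' hgg' hf' hg' Ψ
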